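/- Let $0<m<M$, $0\le\alpha<1$, and put $$\lambda_{\mathrm{ref}}=\frac{1}{1-\alpha^2}\Bigl(2\sqrt{M+m}-\frac{(1-\alpha)m}{\sqrt{M+m}}\Bigr),\qquad \mu=\frac{(1+\alpha)m}{\sqrt{M+m}}-\frac{\alpha m^{3/2}}{2(M+m)}.$$ For $d\ge 1$ let $U\in C^2(\mathbb R^d)$ satisfy $m|v|^2\le\langle v,\nabla^2U(x)v\rangle\le M|v|^2$ for all $x,v\in\mathbb R^d$, and let $\pi$ be the probability measure on $\mathbb R^d\times\mathbb R^d$ with density proportional to $\exp(-U(x)-|v|^2/2)$. The randomized Hamiltonian Monte Carlo (RHMC) process $Z(t)=(X(t),V(t))$ follows the Hamiltonian dynamics $x'=v$, $v'=-\nabla U(x)$ between the arrival times of a Poisson process of rate $\lambda_{\mathrm{ref}}$; at each arrival time the velocity is refreshed by $v\mapsto\alpha v+\sqrt{1-\alpha^2}\,\xi$, with a fresh independent $\xi\sim N(0,I_d)$. Let $P^tf(z)=\mathbb E[f(Z(t))\mid Z(0)=z]$ be its semigroup. Couple two RHMC processes $Z_1,Z_2$ synchronously: they are refreshed at the same times and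 with the same Gaussian vectors $\xi$. Let $L_{1,2}$ be the generator of the coupled Markov process $(Z_1,Z_2)$, i.e. $L_{1,2}F(z_1,z_2)=\lim_{t\downarrow0}\frac1t\bigl(\mathbb E[F(Z_1(t),Z_2(t))\mid Z_1(0)=z_1,Z_2(0)=z_2]-F(z_1,z_2)\bigr)$. For real $a,b,c$ put $A=\begin{pmatrix}a&b\\b&c\end{pmatrix}$ and $$d_A^2\bigl((x_1,v_1),(x_2,v_2)\bigr)=a|x_2-x_1|^2+2b\langle x_2-x_1,v_2-v_1\rangle+c|v_2-v_1|^2 .$$ **Theorem.** There are constants $a,b,c$, depending only on $m$, $M$ and $\alpha$, such that $A$ is positive definite and, for every $d\ge1$ and every $U$ as above: 1. The function $d_A^2$ is in the pointwise domain of $L_{1,2}$ (the expectations exist and the limit exists at every pair of states), and $L_{1,2}\,d_A^2(z_1,z_2)\le-\mu\, d_A^2(z_1,z_2)$ for all $z_1,z_2\in\mathbb R^d\times\mathbb R^d$. In particular, $L_{1,2}\,d_A^2(Z_1(t),Z_2(t))\le-\mu\, d_A^2(Z_1(t),Z_2(t))$ for all $t\ge0$. 2. For every $f\in L^2(\pi)$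 with $\int f\,d\pi=0$ and every $t\ge0$, $P^tf$ is defined $\pi$-almost everywhere, lies in $L^2(\pi)$, and $$\|P^tf\|_{L^2(\pi)}^2\le\min(Ce^{-\mu t},1)\,\|f\|_{L^2(\pi)}^2,\qquad C=\frac{ac+b^2+2\sqrt{acb^2}}{ac-b^2}.$$ -/

import Mathlib

open MeasureTheory ProbabilityTheory Set

noncomputable section

namespace RHMC

/-- Positions (and velocities): Euclidean space `ℝ^d`. -/
abbrev Pos (d : ℕ) : Type := EuclideanSpace ℝ (Fin d)

/-- The phase space `ℝ^d × ℝ^d` of pairs `(x, v)` of a position and a velocity. -/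
abbrev Phase (d : ℕ) : Type := Pos d × Pos d

/-- `U` is twice continuously differentiable and `m |v|² ≤ ⟨v, ∇²U(x) v⟩ ≤ M |v|²` for all
`x, v`.  The Hessian is the derivative of the gradient. -/
structure HessianBounds {d : ℕ} (m M : ℝ) (U : Pos d → ℝ) : Prop where
  contDiff : ContDiff ℝ 2 U
  lower : ∀ x v : Pos d, m * inner ℝ v v ≤ inner ℝ v (fderiv ℝ (gradient U) x v)
  upper : ∀ x v : Pos d, inner ℝ v (fderiv ℝ (gradient U) x v) ≤ M * inner ℝ v v

/-- The Hamiltonian `H(x, v) = U(x) + |v|² / 2`. -/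
def hamiltonian {d : ℕ} (U : Pos d → ℝ) (z : Phase d) : ℝ := U z.1 + ‖z.2‖ ^ 2 / 2

/-- The probability measure on phase space with Lebesgue density proportional to `exp (-H)`. -/
def target {d : ℕ} (U : Pos d → ℝ) : Measure (Phase d) :=
  (volume : Measure (Phase d)).tilted (fun z => -hamiltonian U z)

/-- `γ` solves Hamilton's equations `x' = v`, `v' = -∇U(x)` for all times. -/
def IsHamiltonianPath {d : ℕ} (U : Pos d → ℝ) (γ : ℝ → Phase d) : Prop :=
  ∀ t : ℝ, HasDerivAt γ ((γ t).2, -gradient U (γ t).1) t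

open scoped Classical in
/-- The Hamiltonian flow: `flow U t z` is the value at time `t` of the solution of Hamilton's
equations that starts from `z` at time `0`.  (Under `HessianBounds` the gradient is Lipschitz, so
that solution exists for all times and is unique; the second branch is never used.) -/
def flow {d : ℕ} (U : Pos d → ℝ) (t : ℝ) (z : Phase d) : Phase d :=
  if h : ∃ γ : ℝ → Phase d, γ 0 = z ∧ IsHamiltonianPath U γ then h.choose t else z

/-- Auto-regressive refreshment of the velocity, `(x, v) ↦ (x, α v + √(1 - α²) ξ)`. -/
def refresh {d : ℕ} (α : ℝ) (ξ : Pos d) (z : Phase d) : Phase d :=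
  (z.1, α • z.2 + Real.sqrt (1 - α ^ 2) • ξ)

/-- The randomness that drives the process: for each `n` a waiting time `(ω n).1` and a vector
`(ω n).2` that is used in the refreshment at the end of this waiting time. -/
abbrev Noise (d : ℕ) : Type := ℕ → ℝ × Pos d

/-- The law of the driving randomness: all waiting times are exponential of rate `lam`, all
refreshment vectors are standard Gaussian, and all of them are independent. -/
def noiseLaw (d : ℕ) (lam : ℝ) : Measure (Noise d) :=
  Measure.infinitePi (fun _ : ℕ => (expMeasure lam).prod (stdGaussian (Pos d)))

/-- The time of the `n`-th refreshment (`n ≥ 1`); the zeroth value is `0`. -/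
def arrival {d : ℕ} (ω : Noise d) (n : ℕ) : ℝ := ∑ i ∈ Finset.range n, (ω i).1

/-- The Poisson process that counts the refreshments up to time `t`. -/
def refreshCount {d : ℕ} (ω : Noise d) (t : ℝ) : ℕ := {n : ℕ | arrival ω (n + 1) ≤ t}.ncard

/-- The state just after the `n`-th refreshment, for the path that starts from `z`. -/
def skeleton {d : ℕ} (U : Pos d → ℝ) (α : ℝ) (ω : Noise d) (z : Phase d) : ℕ → Phase d
  | 0 => z
  | n + 1 => refresh α (ω n).2 (flow U (ω n).1 (skeleton U α ω z n))

/-- The path of the RHMC process that starts from `z`: between the arrival times of a Poisson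
process it follows the Hamiltonian flow, at the arrival times the velocity is refreshed. -/
def path {d : ℕ} (U : Pos d → ℝ) (α : ℝ) (ω : Noise d) (z : Phase d) (t : ℝ) : Phase d :=
  flow U (t - arrival ω (refreshCount ω t)) (skeleton U α ω z (refreshCount ω t))

/-- The RHMC semigroup, `P^t f (z) = E^z [f (Z_t)]`. -/
def semigroup {d : ℕ} (U : Pos d → ℝ) (α lam t : ℝ) (f : Phase d → ℝ) (z : Phase d) : ℝ :=
  ∫ ω, f (path U α ω z t) ∂(noiseLaw d lam)

/-- The synchronous coupling of two RHMC processes: both are driven by the same noise, so they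
refresh at the same times and with the same Gaussian vectors. -/
def coupledPath {d : ℕ} (U : Pos d → ℝ) (α : ℝ) (ω : Noise d) (w : Phase d × Phase d) (t : ℝ) :
    Phase d × Phase d :=
  (path U α ω w.1 t, path U α ω w.2 t)

/-- The semigroup of the coupled process, `F ↦ E^w [F (Z₁(t), Z₂(t))]`. -/
def coupledSemigroup {d : ℕ} (U : Pos d → ℝ) (α lam t : ℝ) (F : Phase d × Phase d → ℝ)
    (w : Phase d × Phase d) : ℝ :=
  ∫ ω, F (coupledPath U α ω w t) ∂(noiseLaw d lam)

/-- `F` is in the (pointwise) domain of the generator of the coupled process: all expectations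
`E^w [F (Z₁(t), Z₂(t))]` exist, and they have a right derivative in `t` at `t = 0`, where their
value is `F w`. -/
def InCoupledDomain {d : ℕ} (U : Pos d → ℝ) (α lam : ℝ) (F : Phase d × Phase d → ℝ) : Prop :=
  ∀ w : Phase d × Phase d,
    (∀ t : ℝ, 0 ≤ t → Integrable (fun ω => F (coupledPath U α ω w t)) (noiseLaw d lam)) ∧
    coupledSemigroup U α lam 0 F w = F w ∧
    DifferentiableWithinAt ℝ (fun t : ℝ => coupledSemigroup U α lam t F w) (Ici 0) 0

/-- The generator `L_{1,2}` of the coupled process,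
`L_{1,2} F (w) = lim_{t ↓ 0} (E^w [F (Z₁(t), Z₂(t))] - F w) / t`. -/
def coupledGenerator {d : ℕ} (U : Pos d → ℝ) (α lam : ℝ) (F : Phase d × Phase d → ℝ)
    (w : Phase d × Phase d) : ℝ :=
  derivWithin (fun t : ℝ => coupledSemigroup U α lam t F w) (Ici 0) 0

/-- The weighted quadratic distance
`d_A² ((x₁, v₁), (x₂, v₂)) = a |x₂ - x₁|² + 2 b ⟨x₂ - x₁, v₂ - v₁⟩ + c |v₂ - v₁|²`. -/
def distSq {d : ℕ} (a b c : ℝ) (w : Phase d × Phase d) : ℝ :=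
  a * ‖w.2.1 - w.1.1‖ ^ 2 + 2 * b * inner ℝ (w.2.1 - w.1.1) (w.2.2 - w.1.2)
    + c * ‖w.2.2 - w.1.2‖ ^ 2

/-- The refreshment rate `λ_ref`. -/
def refreshRate (m M α : ℝ) : ℝ :=
  1 / (1 - α ^ 2) * (2 * Real.sqrt (M + m) - (1 - α) * m / Real.sqrt (M + m))

/-- The contraction rate `μ`. -/
def contractionRate (m M α : ℝ) : ℝ :=
  (1 + α) * m / Real.sqrt (M + m) - α * m ^ (3 / 2 : ℝ) / (2 * (M + m))

end RHMC

end

/-!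
The process is treated through its *jump expansion*: the paths with exactly `n` refreshments before
time `t` contribute to the expectation of a nonnegative function at time `t` the factor
`exp (-λ t) λⁿ` times an integral over the refreshment times and the Gaussian vectors
(`lintegral_jumpPath`).
The same expansion serves the process itself and the synchronous coupling.

*Contraction.* With `a = coefA`, `b = coefB`, `c = 1`, let `F` be the square distance, `D` its
derivative along two Hamiltonian paths and `G` its value after a simultaneous refreshment; the
noise cancels in the difference of the velocities, so `G` is again a quadratic form. The gradients
differ by an average of Hessians applied to the difference of the positions, and the coefficients
are chosen so that `D + λ (G - F) ≤ -μ F` (`flowDistSqDeriv_add_le`). An induction on the number of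
jumps turns this infinitesimal bound into `E F(Z₁(t), Z₂(t)) ≤ exp (-μ t) F` (`jumpPartialSum_le`,
`coupledSemigroup_le_exp_mul`). Along the way `E F` is squeezed between two explicit functions of
`t` with the same value and the same derivative `D + λ (G - F)` at `t = 0`, so that this derivative
is the generator (`hasDerivWithinAt_coupledSemigroup`).

*Decay in `L²`.* The Hamiltonian flow preserves the target measure and is conjugated to its inverse
by the reversal of velocities; a refreshment is reversible and commutes with this reversal. Reading
the jump expansion backwards shows that the semigroup followed by the reversal of the velocity is a
self-adjoint operator `T`, and that the target is invariant (`map_swap_flip`). By the contraction,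
`T` multiplies squared Lipschitz constants with respect to `F` by at most `ρ = C exp (-μ t)`, where
`C` is the price of the reversal, which changes the sign of `b` (`distSq_flip_le`). So
`‖Tᵏ g‖² ≤ K ρᵏ` for Lipschitz `g` of mean zero. By self-adjointness `k ↦ ‖Tᵏ g‖²` is log-convex,
hence at least geometric with ratio `‖T g‖² / ‖g‖²`, and this ratio is at most `ρ` (`le_mul_of_sq_le_mul`): the
constant `K` disappears. Lipschitz functions are dense in `L²`.

Liouville's theorem is obtained from the symplectic Euler method, whose steps are compositions of
shears and converge to the flow (`measurePreserving_flow`).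
-/

/-! ### Global solutions of Lipschitz differential equations -/

section LipschitzODE

open scoped Manifold NNReal

variable {E : Type*} [NormedAddCommGroup E] [NormedSpace ℝ E] [CompleteSpace E] {f : E → E}
  {K : ℝ≥0}

/-- Picard–Lindelöf with an existence time that does not depend on the initial point. -/
lemma LipschitzWith.exists_localIntegralCurve (hf : LipschitzWith K f) (hK : 0 < K) (x : E) :
    ∃ γ : ℝ → E, γ 0 = x ∧
      ∀ t ∈ Ioo (-(1 / (2 * K) : ℝ)) (1 / (2 * K)), HasDerivAt γ (f (γ t)) t := by
  have hε : (0 : ℝ) < 1 / (2 * K) := by positivity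
  -- on the ball of radius `‖f x‖ / K` the field is bounded by `2 ‖f x‖`
  have hpl : IsPicardLindelof (fun _ => f) (tmin := -(1 / (2 * K) : ℝ)) (tmax := 1 / (2 * K))
      ⟨0, by constructor <;> linarith⟩ x (‖f x‖₊ / K) 0 (2 * ‖f x‖₊) K := by
    refine .of_time_independent (fun y hy => ?_) hf.lipschitzOnWith ?_
    · rw [Metric.mem_closedBall, dist_eq_norm] at hy
      have h1 : ‖f y - f x‖ ≤ K * ‖y - x‖ := by simpa [dist_eq_norm] using hf.dist_le_mul y x
      have h2 : (K : ℝ) * ‖y - x‖ ≤ ‖f x‖ := by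
        calc (K : ℝ) * ‖y - x‖ ≤ K * (‖f x‖₊ / K : ℝ≥0) := by gcongr
          _ = ‖f x‖ := by push_cast; field_simp
      have h3 : ‖f y‖ ≤ ‖f y - f x‖ + ‖f x‖ := by simpa using norm_add_le (f y - f x) (f x)
      push_cast
      linarith
    · push_cast
      simp only [sub_zero, zero_sub, neg_neg, max_self]
      apply le_of_eq
      field_simp
  obtain ⟨γ, h0, hγ⟩ := hpl.exists_eq_forall_mem_Icc_hasDerivWithinAt₀
  exact ⟨γ, h0, fun t ht => (hγ t (Ioo_subset_Icc_self ht)).hasDerivAt (Icc_mem_nhds ht.1 ht.2)⟩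

/-- Local solutions of a uniform life time are glued to a global one; the gluing is Mathlib's, for
vector fields of class `C¹` on manifolds. -/
lemma LipschitzWith.exists_globalIntegralCurve (hf : LipschitzWith K f) (hK : 0 < K)
    (hf' : ContDiff ℝ 1 f) (x : E) :
    ∃ γ : ℝ → E, γ 0 = x ∧ ∀ t, HasDerivAt γ (f (γ t)) t := by
  have hε : (0 : ℝ) < 1 / (2 * K) := by positivity
  obtain ⟨γ, h0, hγ⟩ := exists_isMIntegralCurve_of_isMIntegralCurveOn (I := 𝓘(ℝ, E)) (M := E)
    (v := f) (contMDiff_vectorSpace_iff_contDiff.2 hf') hε (fun x => by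
      obtain ⟨γ, h0, hγ⟩ := hf.exists_localIntegralCurve hK x
      exact ⟨γ, h0, fun t ht => (hγ t ht).hasFDerivAt.hasMFDerivAt.hasMFDerivWithinAt⟩) x
  refine ⟨γ, h0, fun t => ?_⟩
  have h : HasFDerivAt γ ((1 : ℝ →L[ℝ] ℝ).smulRight (f (γ t))) t := (hγ t).hasFDerivAt
  simpa using h.hasDerivAt

end LipschitzODE

namespace RHMC

/-! ### The potential -/

/-- A positive symmetric operator `T ≤ L` satisfies `T² ≤ L T`: test positivity of `T` on
`v - L⁻¹ T v`. -/
lemma norm_sq_apply_le_of_symmetric {E : Type*} [NormedAddCommGroup E] [InnerProductSpace ℝ E]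
    (T : E →L[ℝ] E) (hT : ∀ v w, inner ℝ (T v) w = inner ℝ v (T w)) {L : ℝ} (hL : 0 < L)
    (h0 : ∀ v, 0 ≤ inner ℝ v (T v)) (h1 : ∀ v, inner ℝ v (T v) ≤ L * inner ℝ v v) (v : E) :
    ‖T v‖ ^ 2 ≤ L * inner ℝ v (T v) := by
  have h := h0 (v - L⁻¹ • T v)
  have h2 := h1 (T v)
  simp only [map_sub, map_smul, inner_sub_left, inner_sub_right, real_inner_smul_left,
    real_inner_smul_right, ← hT v (T v), real_inner_self_eq_norm_sq] at h h2
  have h3 : L⁻¹ * (L⁻¹ * inner ℝ (T v) (T (T v))) ≤ L⁻¹ * ‖T v‖ ^ 2 := by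
    have : L⁻¹ * inner ℝ (T v) (T (T v)) ≤ ‖T v‖ ^ 2 := by
      rw [inv_mul_le_iff₀ hL]; exact h2
    gcongr
  have h4 : L⁻¹ * ‖T v‖ ^ 2 ≤ inner ℝ v (T v) := by linarith
  rwa [inv_mul_le_iff₀ hL] at h4

namespace HessianBounds

variable {d : ℕ} {m M : ℝ} {U : Pos d → ℝ}

lemma contDiff_gradient (h : HessianBounds m M U) : ContDiff ℝ 1 (gradient U) := by
  have h1 : ContDiff ℝ 1 (fderiv ℝ U) := h.contDiff.fderiv_right (by norm_num)
  exact (InnerProductSpace.toDual ℝ (Pos d)).symm.contDiff.comp h1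

lemma hasFDerivAt_gradient (h : HessianBounds m M U) (x : Pos d) :
    HasFDerivAt (gradient U) (fderiv ℝ (gradient U) x) x :=
  (h.contDiff_gradient.differentiable (by norm_num) x).hasFDerivAt

lemma hasGradientAt (h : HessianBounds m M U) (x : Pos d) :
    HasGradientAt U (gradient U x) x :=
  (h.contDiff.differentiable (by norm_num) x).hasGradientAt

lemma inner_fderiv_gradient (h : HessianBounds m M U) (x v w : Pos d) :
    inner ℝ (fderiv ℝ (gradient U) x v) w = fderiv ℝ (fderiv ℝ U) x v w := by
  have h1 : ContDiff ℝ 1 (fderiv ℝ U) := h.contDiff.fderiv_right (by norm_num)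
  have h2 := (h1.differentiable (by norm_num) x).hasFDerivAt.clm_apply (hasFDerivAt_const w x)
  have h3 := (h.hasFDerivAt_gradient x).inner ℝ (hasFDerivAt_const w x)
  have h4 : (fun y => inner ℝ (gradient U y) w) = fun y => fderiv ℝ U y w := by
    ext y
    exact InnerProductSpace.toDual_symm_apply
  rw [h4] at h3
  have h5 := DFunLike.congr_fun (h3.unique h2) v
  simpa [fderivInnerCLM_apply] using h5

lemma inner_fderiv_gradient_comm (h : HessianBounds m M U) (x v w : Pos d) :
    inner ℝ (fderiv ℝ (gradient U) x v) w = inner ℝ v (fderiv ℝ (gradient U) x w) := by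
  have hs : IsSymmSndFDerivAt ℝ U x :=
    h.contDiff.contDiffAt.isSymmSndFDerivAt (by simp)
  rw [real_inner_comm (fderiv ℝ (gradient U) x w), h.inner_fderiv_gradient,
    h.inner_fderiv_gradient]
  exact hs v w

/-- For `T = ∇²U(x) - m`, which satisfies `0 ≤ T ≤ M - m`. -/
lemma norm_sq_hessian_sub_le (h : HessianBounds m M U) (hmM : m < M) (x v : Pos d) :
    ‖fderiv ℝ (gradient U) x v - m • v‖ ^ 2 ≤
      (M - m) * inner ℝ v (fderiv ℝ (gradient U) x v - m • v) := by
  have := norm_sq_apply_le_of_symmetric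
    (fderiv ℝ (gradient U) x - m • ContinuousLinearMap.id ℝ (Pos d))
    (fun v w => by
      simp [inner_sub_left, inner_sub_right, h.inner_fderiv_gradient_comm, real_inner_smul_left,
        real_inner_smul_right])
    (sub_pos.2 hmM)
    (fun v => by
      have := h.lower x v
      simp [inner_sub_right, real_inner_smul_right] at this ⊢; linarith)
    (fun v => by
      have := h.upper x v
      simp [inner_sub_right, real_inner_smul_right] at this ⊢; linarith) v
  simpa using this

lemma norm_fderiv_gradient_le (h : HessianBounds m M U) (hm : 0 < m) (hmM : m < M) (x : Pos d) :
    ‖fderiv ℝ (gradient U) x‖ ≤ M := by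
  have hM : 0 < M := hm.trans hmM
  refine ContinuousLinearMap.opNorm_le_bound _ hM.le fun v => ?_
  have h1 := norm_sq_apply_le_of_symmetric (fderiv ℝ (gradient U) x)
    (h.inner_fderiv_gradient_comm x) hM
    (fun v => le_trans (mul_nonneg hm.le (real_inner_self_nonneg)) (h.lower x v)) (h.upper x) v
  have h2 := h.upper x v
  rw [real_inner_self_eq_norm_sq] at h2
  refine abs_le_of_sq_le_sq' ?_ (by positivity) |>.2
  calc _ ≤ _ := h1
    _ ≤ M * (M * ‖v‖ ^ 2) := by gcongr
    _ = _ := by ring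

lemma lipschitzWith_gradient (h : HessianBounds m M U) (hm : 0 < m) (hmM : m < M) :
    LipschitzWith M.toNNReal (gradient U) :=
  lipschitzWith_of_nnnorm_fderiv_le (h.contDiff_gradient.differentiable (by norm_num))
    fun x => by
      rw [← NNReal.coe_le_coe, coe_nnnorm, Real.coe_toNNReal _ (hm.trans hmM).le]
      exact h.norm_fderiv_gradient_le hm hmM x

/-- The part of the dissipation of the quadratic distance along two Hamiltonian paths that
involves the forces.  It is proved for one Hessian and integrated along the segment. -/
lemma dissipation_nonneg (h : HessianBounds m M U) (hmM : m < M) {s q : ℝ} (hs : 0 < s)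
    (hq : M - m ≤ q * s) (x y v : Pos d) :
    0 ≤ q * ‖v‖ ^ 2 + s * inner ℝ (y - x) (gradient U y - gradient U x - m • (y - x))
      + 2 * inner ℝ v (gradient U y - gradient U x - m • (y - x)) := by
  set w := y - x with hw
  set g : ℝ → Pos d := fun t => gradient U (x + t • w) - t • (m • w) with hg
  have hline : ∀ t : ℝ, HasDerivAt (fun t : ℝ => x + t • w) w t := fun t => by
    simpa using ((hasDerivAt_id t).smul_const w).const_add x
  have hder : ∀ t, HasDerivAt g (fderiv ℝ (gradient U) (x + t • w) w - m • w) t := fun t => by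
    refine ((h.hasFDerivAt_gradient _).comp_hasDerivAt t (hline t)).sub ?_
    simpa using (hasDerivAt_id t).smul_const (m • w)
  set ψ : ℝ → ℝ := fun t => q * ‖v‖ ^ 2 * t + s * inner ℝ w (g t) + 2 * inner ℝ v (g t) with hψ
  have hψd : ∀ t, HasDerivAt ψ (q * ‖v‖ ^ 2
      + s * inner ℝ w (fderiv ℝ (gradient U) (x + t • w) w - m • w)
      + 2 * inner ℝ v (fderiv ℝ (gradient U) (x + t • w) w - m • w)) t := fun t => by
    have h1 := ((hasDerivAt_const t w).inner ℝ (hder t)).const_mul s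
    have h2 := ((hasDerivAt_const t v).inner ℝ (hder t)).const_mul 2
    have h3 := (hasDerivAt_id t).const_mul (q * ‖v‖ ^ 2)
    simpa using (h3.fun_add h1).fun_add h2
  have hmono : Monotone ψ := by
    refine monotone_of_deriv_nonneg (fun t => (hψd t).differentiableAt) fun t => ?_
    rw [(hψd t).deriv]
    set T := fderiv ℝ (gradient U) (x + t • w) w - m • w
    have hL : 0 < M - m := sub_pos.2 hmM
    have h1 : ‖T‖ ^ 2 ≤ (M - m) * inner ℝ w T := h.norm_sq_hessian_sub_le hmM _ _
    have h2 : 0 ≤ ‖(M - m) • v + s • T‖ ^ 2 := by positivity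
    rw [norm_add_sq_real, norm_smul, norm_smul, mul_pow, mul_pow, real_inner_smul_left,
      real_inner_smul_right, Real.norm_eq_abs, Real.norm_eq_abs, sq_abs, sq_abs] at h2
    have h3 : 0 ≤ (M - m) * s *
        (q * ‖v‖ ^ 2 + s * inner ℝ w T + 2 * inner ℝ v T) := by
      have h4 := mul_le_mul_of_nonneg_left h1 (sq_nonneg s)
      have h5 := mul_le_mul_of_nonneg_right hq (mul_nonneg hL.le (sq_nonneg ‖v‖))
      nlinarith
    exact nonneg_of_mul_nonneg_right h3 (by positivity)
  have h01 := hmono zero_le_one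
  simp only [hψ, hg, zero_smul, one_smul, add_zero, sub_zero, mul_zero, mul_one, zero_add, hw,
    add_sub_cancel] at h01
  simp only [inner_sub_right] at h01 ⊢
  linarith

lemma le_inner_gradient_sub (h : HessianBounds m M U) (x y : Pos d) :
    m * ‖y - x‖ ^ 2 ≤ inner ℝ (y - x) (gradient U y - gradient U x) := by
  set w := y - x with hw
  have hline : ∀ t : ℝ, HasDerivAt (fun t : ℝ => x + t • w) w t := fun t => by
    simpa using ((hasDerivAt_id t).smul_const w).const_add x
  set ψ : ℝ → ℝ := fun t => inner ℝ w (gradient U (x + t • w)) - t * (m * ‖w‖ ^ 2) with hψ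
  have hψd : ∀ t, HasDerivAt ψ
      (inner ℝ w (fderiv ℝ (gradient U) (x + t • w) w) - m * ‖w‖ ^ 2) t := fun t => by
    have h1 := (hasDerivAt_const t w).inner ℝ
      ((h.hasFDerivAt_gradient _).comp_hasDerivAt t (hline t))
    have h2 := (hasDerivAt_id t).mul_const (m * ‖w‖ ^ 2)
    simpa only [one_mul, inner_zero_left, add_zero, Function.comp_def, id] using h1.fun_sub h2
  have hmono : Monotone ψ := by
    refine monotone_of_deriv_nonneg (fun t => (hψd t).differentiableAt) fun t => ?_
    rw [(hψd t).deriv]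
    have := h.lower (x + t • w) w
    rw [real_inner_self_eq_norm_sq] at this
    linarith
  have h01 := hmono zero_le_one
  simp only [hψ, zero_smul, one_smul, add_zero, zero_mul, sub_zero, one_mul, hw,
    add_sub_cancel] at h01
  simp only [inner_sub_right] at h01 ⊢
  linarith

lemma quadratic_lower_bound (h : HessianBounds m M U) (x : Pos d) :
    U 0 + inner ℝ (gradient U 0) x + m / 2 * ‖x‖ ^ 2 ≤ U x := by
  have hline : ∀ t : ℝ, HasDerivAt (fun t : ℝ => t • x) x t := fun t => by
    simpa using (hasDerivAt_id t).smul_const x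
  set ψ : ℝ → ℝ := fun t => U (t • x) - t * inner ℝ (gradient U 0) x - m / 2 * ‖x‖ ^ 2 * t ^ 2
    with hψ
  have hψd : ∀ t, HasDerivAt ψ (inner ℝ (gradient U (t • x)) x - inner ℝ (gradient U 0) x
      - m * ‖x‖ ^ 2 * t) t := fun t => by
    have h1 : HasDerivAt (fun t : ℝ => U (t • x)) (inner ℝ (gradient U (t • x)) x) t := by
      exact (h.hasGradientAt (t • x)).hasFDerivAt.comp_hasDerivAt t (hline t)
    have h2 := (hasDerivAt_id t).mul_const (inner ℝ (gradient U 0) x)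
    have h3 := (hasDerivAt_pow 2 t).const_mul (m / 2 * ‖x‖ ^ 2)
    refine ((h1.fun_sub h2).fun_sub h3).congr_deriv ?_
    push_cast
    ring
  have hmono : MonotoneOn ψ (Icc 0 1) := by
    refine monotoneOn_of_deriv_nonneg (convex_Icc 0 1)
      (fun t _ => (hψd t).continuousAt.continuousWithinAt)
      (fun t _ => (hψd t).differentiableAt.differentiableWithinAt) fun t ht => ?_
    rw [interior_Icc] at ht
    rw [(hψd t).deriv]
    have := h.le_inner_gradient_sub 0 (t • x)
    rw [sub_zero, norm_smul, mul_pow, real_inner_smul_left, real_inner_comm, Real.norm_eq_abs,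
      sq_abs, inner_sub_left] at this
    have h5 : t * (m * ‖x‖ ^ 2 * t) ≤
        t * (inner ℝ (gradient U (t • x)) x - inner ℝ (gradient U 0) x) := by linarith
    have := le_of_mul_le_mul_left h5 ht.1
    linarith
  have h01 := hmono (left_mem_Icc.2 zero_le_one) (right_mem_Icc.2 zero_le_one) zero_le_one
  simp only [hψ, zero_smul, one_smul, zero_mul, sub_zero, one_mul] at h01
  linarith

end HessianBounds

/-! ### The Hamiltonian flow -/

/-- The Hamiltonian vector field `(x, v) ↦ (v, -∇U(x))`. -/
noncomputable def hamiltonianField {d : ℕ} (U : Pos d → ℝ) (z : Phase d) : Phase d :=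
  (z.2, -gradient U z.1)

/-- The reversal of the velocity. -/
def flip {d : ℕ} (z : Phase d) : Phase d := (z.1, -z.2)

/-- A potential with Hessian bounds `0 < m < M`. -/
structure StrictHessianBounds {d : ℕ} (m M : ℝ) (U : Pos d → ℝ) : Prop
    extends HessianBounds m M U where
  pos : 0 < m
  lt : m < M

section flip

variable {d : ℕ}

@[simp] lemma flip_flip (z : Phase d) : flip (flip z) = z := by simp [flip]

lemma isometry_flip : Isometry (flip : Phase d → Phase d) :=
  Isometry.of_dist_eq fun z w => by simp [flip, Prod.dist_eq]

lemma continuous_flip : Continuous (flip : Phase d → Phase d) := isometry_flip.continuous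

lemma measurable_flip : Measurable (flip : Phase d → Phase d) := continuous_flip.measurable

end flip

namespace StrictHessianBounds

variable {d : ℕ} {m M : ℝ} {U : Pos d → ℝ} (hU : StrictHessianBounds m M U)

/-- A Lipschitz constant of the Hamiltonian vector field for the maximum norm of the product. -/
noncomputable def lip (M : ℝ) : NNReal := max 1 M.toNNReal

lemma lip_pos (M : ℝ) : 0 < lip M := lt_of_lt_of_le one_pos (le_max_left _ _)

include hU

lemma lipschitzWith_hamiltonianField : LipschitzWith (lip M) (hamiltonianField U) := by
  have h1 : LipschitzWith 1 (fun z : Phase d => z.2) := LipschitzWith.prod_snd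
  have h2 : LipschitzWith (M.toNNReal * 1) (fun z : Phase d => -gradient U z.1) :=
    ((hU.lipschitzWith_gradient hU.pos hU.lt).comp LipschitzWith.prod_fst).neg
  rw [mul_one] at h2
  exact h1.prodMk h2

lemma contDiff_hamiltonianField : ContDiff ℝ 1 (hamiltonianField U) :=
  contDiff_snd.prodMk (hU.contDiff_gradient.comp contDiff_fst).neg

lemma flow_spec (z : Phase d) :
    flow U 0 z = z ∧ ∀ t, HasDerivAt (fun t => flow U t z) (hamiltonianField U (flow U t z)) t := by
  have h : ∃ γ : ℝ → Phase d, γ 0 = z ∧ IsHamiltonianPath U γ :=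
    hU.lipschitzWith_hamiltonianField.exists_globalIntegralCurve (lip_pos M)
      hU.contDiff_hamiltonianField z
  have hf : (fun t => flow U t z) = h.choose := by
    funext t
    simp only [flow, dif_pos h]
  refine ⟨(congrFun hf 0).trans h.choose_spec.1, ?_⟩
  intro t
  have := h.choose_spec.2 t
  rw [← hf] at this
  exact this

lemma flow_zero (z : Phase d) : flow U 0 z = z := (hU.flow_spec z).1

lemma hasDerivAt_flow (z : Phase d) (t : ℝ) :
    HasDerivAt (fun t => flow U t z) (hamiltonianField U (flow U t z)) t := (hU.flow_spec z).2 t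

lemma hasDerivAt_flow_fst (z : Phase d) (t : ℝ) :
    HasDerivAt (fun t => (flow U t z).1) (flow U t z).2 t :=
  (ContinuousLinearMap.fst ℝ (Pos d) (Pos d)).hasFDerivAt.comp_hasDerivAt t (hU.hasDerivAt_flow z t)

lemma hasDerivAt_flow_snd (z : Phase d) (t : ℝ) :
    HasDerivAt (fun t => (flow U t z).2) (-gradient U (flow U t z).1) t :=
  (ContinuousLinearMap.snd ℝ (Pos d) (Pos d)).hasFDerivAt.comp_hasDerivAt t (hU.hasDerivAt_flow z t)

lemma eq_flow {γ : ℝ → Phase d} (hγ : ∀ t, HasDerivAt γ (hamiltonianField U (γ t)) t) (t : ℝ) :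
    γ t = flow U t (γ 0) := by
  have := ODE_solution_unique_univ (v := fun _ => hamiltonianField U) (s := fun _ => univ)
    (t₀ := 0) (fun _ => hU.lipschitzWith_hamiltonianField.lipschitzOnWith)
    (fun t => ⟨hγ t, mem_univ _⟩) (fun t => ⟨hU.hasDerivAt_flow (γ 0) t, mem_univ _⟩)
    (hU.flow_zero _).symm
  exact congrFun this t

lemma flow_add (s t : ℝ) (z : Phase d) : flow U (s + t) z = flow U s (flow U t z) := by
  have := hU.eq_flow (γ := fun s => flow U (s + t) z)
    (fun s => (hU.hasDerivAt_flow z (s + t)).comp_add_const s t) s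
  simpa using this

lemma flow_flow_neg (t : ℝ) (z : Phase d) : flow U t (flow U (-t) z) = z := by
  rw [← hU.flow_add, add_neg_cancel, hU.flow_zero]

/-- The flow is reversed by the reversal of the velocity. -/
lemma flow_neg (t : ℝ) (z : Phase d) : flow U (-t) z = flip (flow U t (flip z)) := by
  have h (t : ℝ) : HasDerivAt (fun t => flip (flow U (-t) (flip z)))
      (hamiltonianField U (flip (flow U (-t) (flip z)))) t := by
    have h1 := (hU.hasDerivAt_flow_fst (flip z) (-t)).scomp t (hasDerivAt_neg t)
    have h2 := ((hU.hasDerivAt_flow_snd (flip z) (-t)).scomp t (hasDerivAt_neg t)).neg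
    refine (h1.prodMk h2).congr_deriv ?_
    simp [hamiltonianField, flip]
  have := hU.eq_flow h (-t)
  simpa [hU.flow_zero] using this.symm

lemma flow_flip (t : ℝ) (z : Phase d) : flow U t (flip z) = flip (flow U (-t) z) := by
  rw [hU.flow_neg, flip_flip]

lemma dist_flow_le (t : ℝ) (z w : Phase d) :
    dist (flow U t z) (flow U t w) ≤ dist z w * Real.exp (lip M * |t|) := by
  have key : ∀ t : ℝ, 0 ≤ t → ∀ z w : Phase d,
      dist (flow U t z) (flow U t w) ≤ dist z w * Real.exp (lip M * t) := by
    intro t ht z w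
    have := dist_le_of_trajectories_ODE (v := fun _ => hamiltonianField U) (a := 0) (b := t)
      (f := fun t => flow U t z) (g := fun t => flow U t w) (δ := dist z w)
      (fun _ => hU.lipschitzWith_hamiltonianField)
      (fun s _ => (hU.hasDerivAt_flow z s).continuousAt.continuousWithinAt)
      (fun s _ => (hU.hasDerivAt_flow z s).hasDerivWithinAt)
      (fun s _ => (hU.hasDerivAt_flow w s).continuousAt.continuousWithinAt)
      (fun s _ => (hU.hasDerivAt_flow w s).hasDerivWithinAt)
      (by simp [hU.flow_zero]) t ⟨ht, le_rfl⟩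
    simpa using this
  rcases le_total 0 t with ht | ht
  · rw [abs_of_nonneg ht]; exact key t ht z w
  · have h1 := key (-t) (by linarith) (flip z) (flip w)
    rw [hU.flow_flip, hU.flow_flip, neg_neg, isometry_flip.dist_eq, isometry_flip.dist_eq] at h1
    rwa [abs_of_nonpos ht]

lemma continuous_flow : Continuous (fun p : ℝ × Phase d => flow U p.1 p.2) := by
  rw [continuous_iff_continuousAt]
  rintro ⟨t, z⟩
  rw [ContinuousAt, tendsto_iff_dist_tendsto_zero]
  have h1 : Filter.Tendsto (fun p : ℝ × Phase d => dist p.2 z * Real.exp (lip M * |p.1|)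
      + dist (flow U p.1 z) (flow U t z)) (nhds (t, z)) (nhds 0) := by
    have h2 : Continuous (fun s => flow U s z) :=
      continuous_iff_continuousAt.2 fun s => (hU.hasDerivAt_flow z s).continuousAt
    have h3 : Continuous (fun p : ℝ × Phase d => dist p.2 z * Real.exp (lip M * |p.1|)
      + dist (flow U p.1 z) (flow U t z)) := by fun_prop
    simpa using h3.tendsto (t, z)
  refine squeeze_zero (fun _ => dist_nonneg) (fun p => ?_) h1
  exact (dist_triangle _ (flow U p.1 z) _).trans
    (add_le_add_left (hU.dist_flow_le p.1 p.2 z) _)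

lemma measurable_flow : Measurable (fun p : ℝ × Phase d => flow U p.1 p.2) :=
  hU.continuous_flow.measurable

lemma continuous_flow_right (t : ℝ) : Continuous (flow U t) :=
  hU.continuous_flow.comp (by fun_prop : Continuous fun z : Phase d => (t, z))

lemma continuous_flow_left (z : Phase d) : Continuous (fun t => flow U t z) :=
  hU.continuous_flow.comp (by fun_prop : Continuous fun t : ℝ => (t, z))

lemma hamiltonian_flow (t : ℝ) (z : Phase d) : hamiltonian U (flow U t z) = hamiltonian U z := by
  have h (t : ℝ) : HasDerivAt (fun t => hamiltonian U (flow U t z)) 0 t := by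
    have h2 := (hU.hasGradientAt (flow U t z).1).hasFDerivAt.comp_hasDerivAt t
      (hU.hasDerivAt_flow_fst z t)
    have h3 := (hU.hasDerivAt_flow_snd z t).norm_sq.div_const 2
    refine (h2.fun_add h3).congr_deriv ?_
    simp only [InnerProductSpace.toDual_apply_apply, inner_neg_right]
    rw [real_inner_comm]
    ring
  have := is_const_of_deriv_eq_zero (fun t => (h t).differentiableAt) (fun t => (h t).deriv) t 0
  simpa [hU.flow_zero] using this

end StrictHessianBounds

/-! ### Preservation of volume -/

section Euler

variable {d : ℕ}

/-- One step of size `h` of the symplectic Euler method, a composition of two shears. -/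
noncomputable def eulerStep (U : Pos d → ℝ) (h : ℝ) (z : Phase d) : Phase d :=
  (z.1 + h • z.2, z.2 - h • gradient U (z.1 + h • z.2))

lemma measurePreserving_eulerStep {U : Pos d → ℝ} (hU : Measurable (gradient U)) (h : ℝ) :
    MeasurePreserving (eulerStep U h) := by
  have h1 : MeasurePreserving (fun z : Phase d => (z.1, z.2 - h • gradient U z.1)) :=
    (MeasurePreserving.id volume).skew_product (by fun_prop)
      (.of_forall fun x => (measurePreserving_sub_right volume (h • gradient U x)).map_eq)
  have h2 : MeasurePreserving (fun z : Phase d => (z.1, z.2 + h • z.1)) :=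
    (MeasurePreserving.id volume).skew_product (by fun_prop)
      (.of_forall fun x => (measurePreserving_add_right volume (h • x)).map_eq)
  have h3 : MeasurePreserving (Prod.swap : Phase d → Phase d) := Measure.measurePreserving_swap
  exact h1.comp (h3.comp (h2.comp h3))

end Euler

namespace StrictHessianBounds

variable {d : ℕ} {m M : ℝ} {U : Pos d → ℝ} (hU : StrictHessianBounds m M U)

include hU

lemma measurable_gradient : Measurable (gradient U) :=
  hU.contDiff_gradient.continuous.measurable

lemma norm_gradient_sub_le (x y : Pos d) : ‖gradient U x - gradient U y‖ ≤ lip M * ‖x - y‖ := by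
  have h1 := (hU.lipschitzWith_gradient hU.pos hU.lt).dist_le_mul x y
  rw [dist_eq_norm, dist_eq_norm] at h1
  refine h1.trans ?_
  gcongr
  exact le_max_right _ _

lemma dist_eulerStep_le (h : ℝ) (z w : Phase d) :
    dist (eulerStep U h z) (eulerStep U h w) ≤ Real.exp (2 * lip M * |h|) * dist z w := by
  have hL : (1 : ℝ) ≤ lip M := NNReal.coe_le_coe.2 (le_max_left 1 M.toNNReal)
  set L : ℝ := ((lip M : NNReal) : ℝ)
  have hx : ‖z.1 - w.1‖ ≤ dist z w := by rw [dist_eq_norm]; exact norm_fst_le (z - w)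
  have hv : ‖z.2 - w.2‖ ≤ dist z w := by rw [dist_eq_norm]; exact norm_snd_le (z - w)
  have h0 : 0 ≤ dist z w := dist_nonneg
  have hLh : L * |h| + 1 ≤ Real.exp (L * |h|) := Real.add_one_le_exp _
  have h1 : ‖(z.1 + h • z.2) - (w.1 + h • w.2)‖ ≤ (L * |h| + 1) * dist z w := by
    calc _ = ‖(z.1 - w.1) + h • (z.2 - w.2)‖ := by congr 1; module
      _ ≤ ‖z.1 - w.1‖ + |h| * ‖z.2 - w.2‖ := by
        refine (norm_add_le _ _).trans ?_
        rw [norm_smul, Real.norm_eq_abs]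
      _ ≤ dist z w + |h| * dist z w := by gcongr
      _ ≤ dist z w + L * |h| * dist z w := by
        have := mul_le_mul_of_nonneg_right hL (mul_nonneg (abs_nonneg h) h0)
        linarith
      _ = _ := by ring
  have h2 : ‖(z.2 - h • gradient U (z.1 + h • z.2)) - (w.2 - h • gradient U (w.1 + h • w.2))‖
      ≤ (L * |h| + 1) * ((L * |h| + 1) * dist z w) := by
    calc _ = ‖(z.2 - w.2) - h • (gradient U (z.1 + h • z.2) - gradient U (w.1 + h • w.2))‖ := by
          congr 1; module
      _ ≤ ‖z.2 - w.2‖ + |h| * ‖gradient U (z.1 + h • z.2) - gradient U (w.1 + h • w.2)‖ := by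
        refine (norm_sub_le _ _).trans ?_
        rw [norm_smul, Real.norm_eq_abs]
      _ ≤ (L * |h| + 1) * dist z w + |h| * (L * ((L * |h| + 1) * dist z w)) := by
        gcongr
        · refine hv.trans (le_mul_of_one_le_left h0 ?_)
          have : 0 ≤ L * |h| := by positivity
          linarith
        · exact (hU.norm_gradient_sub_le _ _).trans (by gcongr)
      _ = _ := by ring
  have h3 : (L * |h| + 1) * ((L * |h| + 1) * dist z w) ≤ Real.exp (2 * L * |h|) * dist z w := by
    calc _ ≤ Real.exp (L * |h|) * (Real.exp (L * |h|) * dist z w) := by gcongr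
      _ = _ := by rw [← mul_assoc, ← Real.exp_add]; ring_nf
  rw [Prod.dist_eq, dist_eq_norm, dist_eq_norm]
  refine max_le (h1.trans (le_trans ?_ h3)) (h2.trans h3)
  refine le_mul_of_one_le_left (by positivity) ?_
  have : 0 ≤ L * |h| := by positivity
  linarith

/-- The local error of the symplectic Euler method along a Hamiltonian path. -/
lemma dist_eulerStep_flow_le {z : Phase d} {T B : ℝ}
    (hB : ∀ s ∈ Icc (-T) T, ‖hamiltonianField U (flow U s z)‖ ≤ B) {s h : ℝ}
    (hs : s ∈ Icc (-T) T) (hsh : s + h ∈ Icc (-T) T) :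
    dist (eulerStep U h (flow U s z)) (flow U (s + h) z) ≤ 2 * lip M * B * h ^ 2 := by
  set L : ℝ := ((lip M : NNReal) : ℝ)
  have hsub : uIcc s (s + h) ⊆ Icc (-T) T := uIcc_subset_Icc hs hsh
  have hB0 : 0 ≤ B := (norm_nonneg _).trans (hB s hs)
  have hlip : ∀ u ∈ uIcc s (s + h), ‖flow U u z - flow U s z‖ ≤ B * |h| := fun u hu => by
    refine ((convex_uIcc s (s + h)).norm_image_sub_le_of_norm_hasDerivWithin_le
      (fun r _ => (hU.hasDerivAt_flow z r).hasDerivWithinAt) (fun r hr => hB r (hsub hr))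
      left_mem_uIcc hu).trans ?_
    gcongr
    simpa using abs_sub_left_of_mem_uIcc hu
  have h1 : ‖flow U (s + h) z - flow U s z - h • hamiltonianField U (flow U s z)‖
      ≤ L * (B * |h|) * |h| := by
    have := (convex_uIcc s (s + h)).norm_image_sub_le_of_norm_hasDerivWithin_le
      (f := fun r => flow U r z - r • hamiltonianField U (flow U s z))
      (f' := fun r => hamiltonianField U (flow U r z) - hamiltonianField U (flow U s z))
      (C := L * (B * |h|))
      (fun r _ => ((hU.hasDerivAt_flow z r).sub
        (by simpa using (hasDerivAt_id r).smul_const (hamiltonianField U (flow U s z))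
          )).hasDerivWithinAt)
      (fun r hr => by
        have := hU.lipschitzWith_hamiltonianField.dist_le_mul (flow U r z) (flow U s z)
        rw [dist_eq_norm, dist_eq_norm] at this
        exact this.trans (by gcongr; exact hlip r hr))
      left_mem_uIcc right_mem_uIcc
    rw [add_sub_cancel_left, Real.norm_eq_abs] at this
    refine le_of_eq_of_le ?_ this
    congr 1
    module
  set y := flow U s z
  have h2 : ‖eulerStep U h y - y - h • hamiltonianField U y‖ ≤ L * (B * |h|) * |h| := by
    have h3 : eulerStep U h y - y - h • hamiltonianField U y
        = (0, -(h • (gradient U (y.1 + h • y.2) - gradient U y.1))) := by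
      ext1
      · simp [eulerStep, hamiltonianField]
      · simp only [eulerStep, hamiltonianField, Prod.snd_sub, Prod.smul_snd]
        module
    rw [h3, Prod.norm_def, norm_zero, max_eq_right (norm_nonneg _), norm_neg, norm_smul,
      Real.norm_eq_abs, mul_comm]
    gcongr
    refine (hU.norm_gradient_sub_le _ _).trans ?_
    gcongr
    rw [add_sub_cancel_left, norm_smul, Real.norm_eq_abs, mul_comm]
    gcongr
    exact (norm_fst_le (hamiltonianField U y)).trans (hB s hs)
  rw [dist_eq_norm]
  calc _ = ‖(eulerStep U h y - y - h • hamiltonianField U y)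
        - (flow U (s + h) z - y - h • hamiltonianField U y)‖ := by congr 1; abel
    _ ≤ L * (B * |h|) * |h| + L * (B * |h|) * |h| := (norm_sub_le _ _).trans (add_le_add h2 h1)
    _ = 2 * L * B * |h| ^ 2 := by ring
    _ = _ := by rw [sq_abs]

/-- The symplectic Euler method converges: local errors of order `n⁻²` are summed over `n` steps. -/
lemma tendsto_eulerStep_iterate (t : ℝ) (z : Phase d) :
    Filter.Tendsto (fun n : ℕ => (eulerStep U (t / (n + 1)))^[n + 1] z) Filter.atTop
      (nhds (flow U t z)) := by
  obtain ⟨B, hB⟩ := (isCompact_Icc (a := -|t|) (b := |t|)).exists_bound_of_continuousOn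
    (f := fun s => hamiltonianField U (flow U s z))
    (hU.lipschitzWith_hamiltonianField.continuous.comp (hU.continuous_flow_left z)).continuousOn
  have hB0 : 0 ≤ B := (norm_nonneg _).trans (hB 0 ⟨by simp, by simp⟩)
  set L : ℝ := ((lip M : NNReal) : ℝ)
  have hL0 : 0 ≤ L := NNReal.coe_nonneg _
  have key : ∀ n : ℕ, ∀ k ≤ n + 1,
      dist ((eulerStep U (t / (n + 1)))^[k] z) (flow U (k * (t / (n + 1))) z)
        ≤ k * (Real.exp (2 * L * |t / (n + 1)| * k) * (2 * L * B * (t / (n + 1)) ^ 2)) := by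
    intro n k
    set h := t / (n + 1 : ℝ) with hh
    have hmem : ∀ j : ℕ, j ≤ n + 1 → (j : ℝ) * h ∈ Icc (-|t|) |t| := fun j hj => by
      have hj' : (j : ℝ) ≤ n + 1 := by exact_mod_cast hj
      rw [mem_Icc, ← abs_le, abs_mul, hh, abs_div, Nat.abs_cast,
        abs_of_pos (by positivity : (0 : ℝ) < n + 1), mul_div_assoc', div_le_iff₀ (by positivity)]
      rw [mul_comm]
      gcongr
    induction k with
    | zero => intro _; simp [hU.flow_zero]
    | succ k ih =>
      intro hk
      have hk' : k ≤ n + 1 := by omega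
      have h1 := ih hk'
      have h2 := hU.dist_eulerStep_flow_le hB (s := k * h) (h := h) (hmem k hk')
        (by have := hmem (k + 1) hk; push_cast at this; rwa [add_mul, one_mul] at this)
      have h3 := hU.dist_eulerStep_le h ((eulerStep U h)^[k] z) (flow U (k * h) z)
      rw [Function.iterate_succ_apply']
      push_cast
      rw [add_mul (k : ℝ) 1 h, one_mul]
      set E := 2 * L * B * h ^ 2
      have hE : 0 ≤ E := by positivity
      have h4 : E ≤ Real.exp (2 * L * |h| * (k + 1)) * E :=
        le_mul_of_one_le_left hE (Real.one_le_exp (by positivity))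
      calc _ ≤ _ := dist_triangle _ _ _
        _ ≤ Real.exp (2 * L * |h|) * (k * (Real.exp (2 * L * |h| * k) * E)) + E :=
          add_le_add (h3.trans (by gcongr)) h2
        _ = k * (Real.exp (2 * L * |h| * (k + 1)) * E) + E := by
          rw [mul_add_one, Real.exp_add]; ring
        _ ≤ _ := by linarith
  rw [tendsto_iff_dist_tendsto_zero]
  have hlim : Filter.Tendsto (fun n : ℕ => Real.exp (2 * L * |t|) * (2 * L * B * t ^ 2)
      * (1 / ((n : ℝ) + 1))) Filter.atTop (nhds 0) := by
    have := (tendsto_one_div_add_atTop_nhds_zero_nat (𝕜 := ℝ)).const_mul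
      (Real.exp (2 * L * |t|) * (2 * L * B * t ^ 2))
    rwa [mul_zero] at this
  refine squeeze_zero (fun _ => dist_nonneg) (fun n => ?_) hlim
  have h := key n (n + 1) le_rfl
  have hn : (0 : ℝ) < n + 1 := by positivity
  have e1 : ((n + 1 : ℕ) : ℝ) * (t / (n + 1)) = t := by push_cast; field_simp
  have e2 : 2 * L * |t / (n + 1)| * ((n + 1 : ℕ) : ℝ) = 2 * L * |t| := by
    rw [abs_div, abs_of_pos hn]; push_cast; field_simp
  rw [e1, e2] at h
  refine h.trans (le_of_eq ?_)
  push_cast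
  field_simp

/-- For an open set `O`, the points that the flow carries into `O` are eventually carried into `O`
by the volume preserving Euler approximations; Fatou's lemma bounds their volume. -/
lemma volume_preimage_flow_le_of_isOpen (t : ℝ) {O : Set (Phase d)} (hO : IsOpen O) :
    volume (flow U t ⁻¹' O) ≤ volume O := by
  set S : ℕ → Phase d → Phase d := fun n => (eulerStep U (t / (n + 1)))^[n + 1]
  have hS : ∀ n, MeasurePreserving (S n) := fun n =>
    (measurePreserving_eulerStep hU.measurable_gradient _).iterate _
  calc volume (flow U t ⁻¹' O)
      = ∫⁻ z, (flow U t ⁻¹' O).indicator 1 z :=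
        (lintegral_indicator_one ((hU.continuous_flow_right t).measurable hO.measurableSet)).symm
    _ ≤ ∫⁻ z, Filter.liminf (fun n => (S n ⁻¹' O).indicator (1 : Phase d → ENNReal) z)
          Filter.atTop := by
        refine lintegral_mono fun z => ?_
        by_cases hz : z ∈ flow U t ⁻¹' O
        · rw [indicator_of_mem hz]
          refine Filter.le_liminf_of_le (by isBoundedDefault) ?_
          filter_upwards [(hU.tendsto_eulerStep_iterate t z).eventually (hO.mem_nhds hz)] with n hn
          rw [indicator_of_mem (show z ∈ S n ⁻¹' O from hn)]
        · rw [indicator_of_notMem hz]; exact zero_le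
    _ ≤ Filter.liminf (fun n => ∫⁻ z, (S n ⁻¹' O).indicator (1 : Phase d → ENNReal) z)
          Filter.atTop :=
        lintegral_liminf_le fun n =>
          measurable_one.indicator ((hS n).measurable hO.measurableSet)
    _ = volume O := by
        simp_rw [lintegral_indicator_one ((hS _).measurable hO.measurableSet),
          (hS _).measure_preimage hO.measurableSet.nullMeasurableSet]
        exact Filter.liminf_const _

/-- Liouville's theorem.  Outer regularity extends the bound from open to all sets, and the bound
for time `-t` gives the reverse inequality. -/
lemma measurePreserving_flow (t : ℝ) : MeasurePreserving (flow U t) := by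
  have hmeas : ∀ t, Measurable (flow U t) := fun t => (hU.continuous_flow_right t).measurable
  have hle : ∀ t, ∀ B : Set (Phase d), volume (flow U t ⁻¹' B) ≤ volume B := by
    intro t B
    rw [B.measure_eq_iInf_isOpen]
    exact le_iInf₂ fun O hO => le_iInf fun hO' =>
      (measure_mono (preimage_mono hO)).trans (hU.volume_preimage_flow_le_of_isOpen t hO')
  refine ⟨hmeas t, Measure.ext fun B hB => ?_⟩
  rw [Measure.map_apply (hmeas t) hB]
  refine le_antisymm (hle t B) ?_
  have h := hle (-t) (flow U t ⁻¹' B)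
  rwa [← preimage_comp, show flow U t ∘ flow U (-t) = id from funext (hU.flow_flow_neg t),
    preimage_id] at h

end StrictHessianBounds

/-! ### Symmetries of the target measure -/

section target

variable {d : ℕ} {U : Pos d → ℝ}

lemma measurePreserving_target (hUc : Continuous U) {f : Phase d → Phase d}
    (hf : MeasurePreserving f) (hH : ∀ z, hamiltonian U (f z) = hamiltonian U z) :
    MeasurePreserving f (target U) (target U) := by
  have hHm : Measurable (hamiltonian U) := by unfold hamiltonian; fun_prop
  refine ⟨hf.measurable, Measure.ext fun B hB => ?_⟩
  rw [Measure.map_apply hf.measurable hB, target, tilted_apply' _ _ hB,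
    tilted_apply' _ _ (hf.measurable hB), ← hf.setLIntegral_comp_preimage hB (by fun_prop)]
  simp_rw [hH]

lemma measurePreserving_flip_target (hUc : Continuous U) :
    MeasurePreserving flip (target U) (target U) :=
  measurePreserving_target hUc
    ((MeasurePreserving.id volume).prod (Measure.measurePreserving_neg volume))
    fun z => by simp [hamiltonian, flip]

lemma StrictHessianBounds.measurePreserving_flow_target {m M : ℝ}
    (hU : StrictHessianBounds m M U) (t : ℝ) :
    MeasurePreserving (flow U t) (target U) (target U) :=
  measurePreserving_target hU.contDiff.continuous (hU.measurePreserving_flow t)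
    (hU.hamiltonian_flow t)

end target

/-! ### Moments of the target measure -/

section Gaussian

variable {d : ℕ}

lemma integrable_exp_neg_mul_norm_sq {c : ℝ} (hc : 0 < c) :
    Integrable (fun v : Pos d => Real.exp (-c * ‖v‖ ^ 2)) := by
  refine not_imp_comm.1 integral_undef ?_
  rw [GaussianFourier.integral_rexp_neg_mul_sq_norm hc]
  positivity

lemma integrable_exp_neg_mul_add_norm_sq {c : ℝ} (hc : 0 < c) :
    Integrable (fun z : Phase d => Real.exp (-c * (‖z.1‖ ^ 2 + ‖z.2‖ ^ 2))) := by
  have h := (integrable_exp_neg_mul_norm_sq (d := d) hc).mul_prod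
    (integrable_exp_neg_mul_norm_sq (d := d) hc)
  refine h.congr (.of_forall fun z => ?_)
  simp only
  rw [← Real.exp_add]
  ring_nf

end Gaussian

namespace StrictHessianBounds

variable {d : ℕ} {m M : ℝ} {U : Pos d → ℝ} (hU : StrictHessianBounds m M U)

include hU

lemma exists_le_hamiltonian : ∃ A c : ℝ, 0 < c ∧ ∀ z : Phase d,
    A + c * (‖z.1‖ ^ 2 + ‖z.2‖ ^ 2) ≤ hamiltonian U z := by
  have hm := hU.pos
  refine ⟨U 0 - ‖gradient U 0‖ ^ 2 / m, min (m / 4) (1 / 2), by positivity, fun z => ?_⟩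
  have h1 := hU.quadratic_lower_bound z.1
  have h2 : 0 ≤ ‖(1 / m) • gradient U 0 + (1 / 2 : ℝ) • z.1‖ ^ 2 := by positivity
  rw [norm_add_sq_real, norm_smul, norm_smul, mul_pow, mul_pow, real_inner_smul_left,
    real_inner_smul_right, Real.norm_eq_abs, Real.norm_eq_abs, sq_abs, sq_abs] at h2
  have h3 : 0 ≤ ‖gradient U 0‖ ^ 2 / m + inner ℝ (gradient U 0) z.1 + m / 4 * ‖z.1‖ ^ 2 := by
    have := mul_nonneg hm.le h2
    refine this.trans (le_of_eq ?_)
    field_simp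
    ring
  have h4 : min (m / 4) (1 / 2) * ‖z.1‖ ^ 2 ≤ m / 4 * ‖z.1‖ ^ 2 := by gcongr; exact min_le_left _ _
  have h5 : min (m / 4) (1 / 2) * ‖z.2‖ ^ 2 ≤ 1 / 2 * ‖z.2‖ ^ 2 := by gcongr; exact min_le_right _ _
  rw [hamiltonian]
  linarith

lemma continuous_hamiltonian : Continuous (hamiltonian U) := by
  have := hU.contDiff.continuous
  unfold hamiltonian
  fun_prop

lemma integrable_exp_neg_hamiltonian :
    Integrable (fun z : Phase d => Real.exp (-hamiltonian U z)) := by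
  have hcont := hU.continuous_hamiltonian
  obtain ⟨A, c, hc, h⟩ := hU.exists_le_hamiltonian
  refine ((integrable_exp_neg_mul_add_norm_sq hc).const_mul (Real.exp (-A))).mono'
    (by fun_prop) (.of_forall fun z => ?_)
  rw [Real.norm_eq_abs, Real.abs_exp, ← Real.exp_add]
  gcongr
  linarith [h z]

lemma isProbabilityMeasure_target : IsProbabilityMeasure (target U) :=
  isProbabilityMeasure_tilted hU.integrable_exp_neg_hamiltonian

lemma integrable_norm_sq_target :
    Integrable (fun z : Phase d => ‖z.1‖ ^ 2 + ‖z.2‖ ^ 2) (target U) := by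
  have hcont := hU.continuous_hamiltonian
  obtain ⟨A, c, hc, h⟩ := hU.exists_le_hamiltonian
  rw [target, integrable_tilted_iff hU.integrable_exp_neg_hamiltonian]
  refine ((integrable_exp_neg_mul_add_norm_sq (half_pos hc)).const_mul
    (Real.exp (-A) * (2 / c))).mono' (by fun_prop) (.of_forall fun z => ?_)
  set y := ‖z.1‖ ^ 2 + ‖z.2‖ ^ 2
  have hy : 0 ≤ y := by positivity
  have h1 : y ≤ 2 / c * Real.exp (c / 2 * y) := by
    have := Real.add_one_le_exp (c / 2 * y)
    rw [div_mul_eq_mul_div, le_div_iff₀ hc]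
    linarith
  rw [smul_eq_mul, norm_mul, Real.norm_eq_abs, Real.abs_exp, Real.norm_eq_abs, abs_of_nonneg hy]
  calc Real.exp (-hamiltonian U z) * y
      ≤ Real.exp (-A + -c * y) * (2 / c * Real.exp (c / 2 * y)) := by
        gcongr
        linarith [h z]
    _ = _ := by
        rw [Real.exp_add, show -c * y = -(c / 2) * y + -(c / 2 * y) by ring,
          Real.exp_add (-(c / 2) * y), Real.exp_neg (c / 2 * y)]
        field_simp

end StrictHessianBounds

/-! ### Reversibility of the refreshment -/

section refresh

variable {d : ℕ}

/-- The standard Gaussian measure has the density that its name suggests, by comparison of the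
characteristic functions. -/
lemma tilted_neg_norm_sq_eq_stdGaussian :
    (volume : Measure (Pos d)).tilted (fun v => -(‖v‖ ^ 2 / 2)) = stdGaussian (Pos d) := by
  have e : ∀ v : Pos d, -(‖v‖ ^ 2 / 2) = -(1 / 2) * ‖v‖ ^ 2 := fun v => by ring
  simp_rw [e]
  have hint : Integrable (fun v : Pos d => Real.exp (-(1 / 2) * ‖v‖ ^ 2)) :=
    integrable_exp_neg_mul_norm_sq one_half_pos
  have := isProbabilityMeasure_tilted hint
  refine Measure.ext_of_charFun (funext fun t => ?_)
  rw [charFun_stdGaussian, charFun_apply, integral_tilted]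
  have hb : 0 < (1 / 2 : ℂ).re := by norm_num
  have h1 := GaussianFourier.integral_cexp_neg_mul_sq_norm_add hb Complex.I t
  have h2 := GaussianFourier.integral_cexp_neg_mul_sq_norm (V := Pos d) hb
  have h3 : ((∫ v : Pos d, Real.exp (-(1 / 2) * ‖v‖ ^ 2) : ℝ) : ℂ)
      = ∫ v : Pos d, Complex.exp (-(1 / 2) * (‖v‖ : ℂ) ^ 2) := by
    rw [← integral_complex_ofReal]
    congr 1 with v
    push_cast
    rfl
  have h4 : (∫ v : Pos d, Complex.exp (-(1 / 2) * (‖v‖ : ℂ) ^ 2)) ≠ 0 := by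
    rw [← h3]
    exact_mod_cast (integral_exp_pos hint).ne'
  calc _ = ∫ v : Pos d, (∫ v : Pos d, Complex.exp (-(1 / 2) * (‖v‖ : ℂ) ^ 2))⁻¹
        * Complex.exp (-(1 / 2) * (‖v‖ : ℂ) ^ 2 + Complex.I * inner ℝ t v) := by
        congr 1 with v
        rw [Complex.exp_add, ← h3, Complex.real_smul, real_inner_comm]
        push_cast
        ring_nf
    _ = _ := by
        rw [integral_const_mul, h1, ← mul_assoc, ← h2, inv_mul_cancel₀ h4, one_mul]
        congr 1
        rw [Complex.I_sq]
        ring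

/-- The product of two standard Gaussian measures is invariant under the orthogonal involution
`(v, ξ) ↦ (α v + β ξ, β v - α ξ)`. -/
lemma measurePreserving_gaussian_rotation {α β : ℝ} (hαβ : α ^ 2 + β ^ 2 = 1) :
    MeasurePreserving (fun p : Pos d × Pos d => (α • p.1 + β • p.2, β • p.1 - α • p.2))
      ((stdGaussian (Pos d)).prod (stdGaussian (Pos d)))
      ((stdGaussian (Pos d)).prod (stdGaussian (Pos d))) := by
  refine ⟨by fun_prop, ?_⟩
  set Θ : Pos d × Pos d →L[ℝ] Pos d × Pos d :=
    ContinuousLinearMap.prod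
      (α • ContinuousLinearMap.fst ℝ _ _ + β • ContinuousLinearMap.snd ℝ _ _)
      (β • ContinuousLinearMap.fst ℝ _ _ - α • ContinuousLinearMap.snd ℝ _ _) with hΘ
  change Measure.map Θ _ = _
  refine Measure.ext_of_charFunDual (funext fun L => ?_)
  rw [charFunDual_map, charFunDual_prod, charFunDual_prod]
  simp only [charFunDual_stdGaussian, ← Complex.exp_add]
  set L₁ := L.comp (.inl ℝ (Pos d) (Pos d))
  set L₂ := L.comp (.inr ℝ (Pos d) (Pos d))
  have hL (x y : Pos d) : L (x, y) = L₁ x + L₂ y := by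
    simp [L₁, L₂, ← map_add]
  have e1 : (L.comp Θ).comp (.inl ℝ (Pos d) (Pos d)) = α • L₁ + β • L₂ := by
    ext x
    simp [hΘ, hL]
  have e2 : (L.comp Θ).comp (.inr ℝ (Pos d) (Pos d)) = β • L₁ - α • L₂ := by
    ext x
    simp [hΘ, hL, sub_eq_add_neg]
  rw [e1, e2]
  obtain ⟨w₁, h₁⟩ := (InnerProductSpace.toDual ℝ (Pos d)).surjective L₁
  obtain ⟨w₂, h₂⟩ := (InnerProductSpace.toDual ℝ (Pos d)).surjective L₂
  have key : ‖α • L₁ + β • L₂‖ ^ 2 + ‖β • L₁ - α • L₂‖ ^ 2 = ‖L₁‖ ^ 2 + ‖L₂‖ ^ 2 := by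
    have f1 : α • L₁ + β • L₂ = InnerProductSpace.toDual ℝ (Pos d) (α • w₁ + β • w₂) := by
      simp [h₁, h₂]
    have f2 : β • L₁ - α • L₂ = InnerProductSpace.toDual ℝ (Pos d) (β • w₁ - α • w₂) := by
      simp [h₁, h₂]
    rw [f1, f2, ← h₁, ← h₂]
    simp only [LinearIsometryEquiv.norm_map]
    rw [norm_add_sq_real, norm_sub_sq_real]
    simp only [norm_smul, mul_pow, real_inner_smul_left, real_inner_smul_right, Real.norm_eq_abs,
      sq_abs]
    linear_combination (‖w₁‖ ^ 2 + ‖w₂‖ ^ 2) * hαβ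
  congr 1
  have key' := congrArg (fun x : ℝ => (x : ℂ)) key
  push_cast at key'
  linear_combination (-1 / 2) * key'

lemma measurable_refresh (α : ℝ) :
    Measurable (fun p : Pos d × Phase d => refresh α p.1 p.2) := by
  unfold refresh
  fun_prop

variable {U : Pos d → ℝ}

/-- The target measure disintegrates into a measure of the position and a standard Gaussian
velocity. -/
lemma exists_lintegral_target (hU : Continuous U) : ∃ ρ : Pos d → ENNReal,
    ∀ G : Phase d → ENNReal, Measurable G →
      ∫⁻ z, G z ∂(target U) = ∫⁻ x, ρ x * ∫⁻ v, G (x, v) ∂(stdGaussian (Pos d)) := by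
  -- if `exp (-H)` is not integrable then `Z = 0`, and both sides below vanish
  set Z := ∫ z : Phase d, Real.exp (-hamiltonian U z)
  set Zg := ∫ v : Pos d, Real.exp (-(‖v‖ ^ 2 / 2))
  have hZg : 0 < Zg := by
    refine integral_exp_pos ((integrable_exp_neg_mul_norm_sq (d := d) one_half_pos).congr
      (.of_forall fun v => ?_))
    simp only
    congr 1
    ring
  have hZ : 0 ≤ Z := integral_nonneg fun z => (Real.exp_pos _).le
  refine ⟨fun x => ENNReal.ofReal (Real.exp (-U x) * Zg / Z), fun G hG => ?_⟩
  have hHm : Measurable (hamiltonian U) := by unfold hamiltonian; fun_prop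
  rw [target, lintegral_tilted]
  refine (lintegral_prod (μ := volume) (ν := volume) _ (by fun_prop)).trans ?_
  refine lintegral_congr fun x => ?_
  rw [← tilted_neg_norm_sq_eq_stdGaussian, lintegral_tilted,
    ← lintegral_const_mul _ (by fun_prop)]
  refine lintegral_congr fun v => ?_
  rw [← mul_assoc, ← ENNReal.ofReal_mul (by positivity)]
  congr 2
  change Real.exp (-(U x + ‖v‖ ^ 2 / 2)) / Z
    = Real.exp (-U x) * Zg / Z * (Real.exp (-(‖v‖ ^ 2 / 2)) / Zg)
  rw [neg_add, Real.exp_add]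
  field_simp

/-- The refreshment kernel is reversible with respect to the target measure. -/
lemma lintegral_refresh_symm (hU : Continuous U) {α : ℝ} (h0 : 0 ≤ α) (h1 : α < 1)
    {f g : Phase d → ENNReal} (hf : Measurable f) (hg : Measurable g) :
    ∫⁻ z, g z * ∫⁻ ξ, f (refresh α ξ z) ∂(stdGaussian (Pos d)) ∂(target U)
      = ∫⁻ z, f z * ∫⁻ ξ, g (refresh α ξ z) ∂(stdGaussian (Pos d)) ∂(target U) := by
  obtain ⟨ρ, hρ⟩ := exists_lintegral_target hU
  set γ := stdGaussian (Pos d)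
  have hmr := measurable_refresh (d := d) α
  have hm : ∀ f : Phase d → ENNReal, Measurable f →
      Measurable fun z => ∫⁻ ξ, f (refresh α ξ z) ∂γ := fun f hf =>
    Measurable.lintegral_prod_left' (f := fun p : Pos d × Phase d => f (refresh α p.1 p.2))
      (hf.comp hmr)
  rw [hρ (fun z => g z * ∫⁻ ξ, f (refresh α ξ z) ∂γ) (hg.mul (hm f hf)),
    hρ (fun z => f z * ∫⁻ ξ, g (refresh α ξ z) ∂γ) (hf.mul (hm g hg))]
  refine lintegral_congr fun x => ?_
  congr 1
  set β := Real.sqrt (1 - α ^ 2)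
  have hαβ : α ^ 2 + β ^ 2 = 1 := by
    rw [Real.sq_sqrt (by nlinarith)]; ring
  have hΘ := measurePreserving_gaussian_rotation (d := d) hαβ
  have hcomb : ∀ f g : Phase d → ENNReal, Measurable f → Measurable g →
      ∫⁻ v, g (x, v) * ∫⁻ ξ, f (refresh α ξ (x, v)) ∂γ ∂γ
        = ∫⁻ p, g (x, p.1) * f (x, α • p.1 + β • p.2) ∂(γ.prod γ) := fun f g hf hg => by
    rw [lintegral_prod _ (by fun_prop)]
    refine lintegral_congr fun v => ?_
    exact (lintegral_const_mul (f := fun ξ => f (refresh α ξ (x, v))) _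
      (hf.comp (by unfold refresh; fun_prop))).symm
  rw [hcomb f g hf hg, hcomb g f hg hf, ← hΘ.lintegral_comp (by fun_prop)]
  refine lintegral_congr fun p => ?_
  have e : α • (α • p.1 + β • p.2) + β • (β • p.1 - α • p.2) = p.1 := by
    calc _ = (α ^ 2 + β ^ 2) • p.1 := by module
      _ = _ := by rw [hαβ, one_smul]
  simp only [e]
  rw [mul_comm]

/-- The refreshment kernel commutes with the reversal of the velocity. -/
lemma lintegral_refresh_flip (α : ℝ) {f : Phase d → ENNReal} (hf : Measurable f) (z : Phase d) :
    ∫⁻ ξ, f (refresh α ξ (flip z)) ∂(stdGaussian (Pos d))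
      = ∫⁻ ξ, f (flip (refresh α ξ z)) ∂(stdGaussian (Pos d)) := by
  have h := stdGaussian_map (LinearIsometryEquiv.neg ℝ (E := Pos d))
  have hmr := measurable_refresh (d := d) α
  conv_lhs => rw [← h]
  rw [lintegral_map (f := fun ξ => f (refresh α ξ (flip z)))
    (hf.comp (by unfold refresh; fun_prop)) (LinearIsometryEquiv.neg ℝ).continuous.measurable]
  refine lintegral_congr fun ξ => ?_
  congr 1
  simp [refresh, flip, add_comm]

end refresh

/-! ### The driving noise -/

section noise

variable {d : ℕ} {lam : ℝ}

/-- Put one waiting time and one refreshment vector in front of a sequence of these. -/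
def Noise.cons (p : (ℝ × Pos d) × Noise d) : Noise d
  | 0 => p.1
  | n + 1 => p.2 n

lemma Noise.measurable_cons : Measurable (Noise.cons : (ℝ × Pos d) × Noise d → Noise d) := by
  refine measurable_pi_iff.2 fun n => ?_
  cases n with
  | zero => exact measurable_fst
  | succ n => exact (measurable_pi_apply n).comp measurable_snd

instance : IsProbabilityMeasure (stdGaussian (Pos d)) := isProbabilityMeasure_stdGaussian

lemma isProbabilityMeasure_noiseLaw (hlam : 0 < lam) : IsProbabilityMeasure (noiseLaw d lam) := by
  have := isProbabilityMeasure_expMeasure hlam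
  unfold noiseLaw
  infer_instance

/-- The noise renews itself after the first refreshment. -/
lemma map_cons_noiseLaw (hlam : 0 < lam) :
    (((expMeasure lam).prod (stdGaussian (Pos d))).prod (noiseLaw d lam)).map Noise.cons
      = noiseLaw d lam := by
  have := isProbabilityMeasure_expMeasure hlam
  have := isProbabilityMeasure_noiseLaw (d := d) hlam
  set μ := (expMeasure lam).prod (stdGaussian (Pos d))
  refine Measure.eq_infinitePi (μ := fun _ : ℕ => μ) fun s t ht => ?_
  classical
  -- enlarge the finite set of constrained coordinates to an initial segment
  obtain ⟨N, hN⟩ := s.exists_nat_subset_range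
  set t' : ℕ → Set (ℝ × Pos d) := fun i => if i ∈ s then t i else univ with ht'
  have ht'm : ∀ i, MeasurableSet (t' i) := fun i => by
    simp only [ht']; split_ifs; exacts [ht i, .univ]
  have e1 : Set.pi (s : Set ℕ) t = Set.pi (Finset.range (N + 1) : Set ℕ) t' := by
    ext ω
    simp only [Set.mem_pi, ht', Finset.mem_coe, Finset.mem_range]
    constructor
    · intro h i _
      split_ifs with hi
      exacts [h i hi, mem_univ _]
    · intro h i hi
      have := h i (by have := Finset.mem_range.1 (hN hi); omega)
      rwa [if_pos hi] at this
  have e2 : ∏ i ∈ s, μ (t i) = ∏ i ∈ Finset.range (N + 1), μ (t' i) := by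
    rw [← Finset.prod_subset (hN.trans (Finset.range_mono (Nat.le_succ N)))]
    · exact Finset.prod_congr rfl fun i hi => by simp [ht', hi]
    · intro i _ hi
      simp [ht', hi]
  have e3 : Noise.cons ⁻¹' (Set.pi (Finset.range (N + 1) : Set ℕ) t')
      = t' 0 ×ˢ Set.pi (Finset.range N : Set ℕ) (fun i => t' (i + 1)) := by
    ext p
    simp only [mem_preimage, Set.mem_pi, mem_prod, Finset.mem_coe, Finset.mem_range]
    constructor
    · intro h
      exact ⟨h 0 (Nat.succ_pos N), fun i hi => h (i + 1) (by omega)⟩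
    · rintro ⟨h0, h⟩ i hi
      cases i with
      | zero => exact h0
      | succ i => exact h i (by omega)
  rw [e1, e2, Measure.map_apply Noise.measurable_cons
    (MeasurableSet.pi (Finset.countable_toSet _) fun i _ => ht'm i), e3, Measure.prod_prod,
    noiseLaw, Measure.infinitePi_pi _ (fun i _ => ht'm (i + 1)), Finset.prod_range_succ', mul_comm]

lemma lintegral_noiseLaw_cons (hlam : 0 < lam) {F : Noise d → ENNReal} (hF : Measurable F) :
    ∫⁻ ω, F ω ∂(noiseLaw d lam) = ∫⁻ p, ∫⁻ ω, F (Noise.cons (p, ω)) ∂(noiseLaw d lam)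
      ∂((expMeasure lam).prod (stdGaussian (Pos d))) := by
  have := isProbabilityMeasure_expMeasure hlam
  have := isProbabilityMeasure_noiseLaw (d := d) hlam
  conv_lhs => rw [← map_cons_noiseLaw hlam]
  rw [lintegral_map hF Noise.measurable_cons,
    lintegral_prod (fun p => F (Noise.cons p)) (hF.comp Noise.measurable_cons).aemeasurable]

lemma lintegral_expMeasure {g : ℝ → ENNReal} (hg : Measurable g) :
    ∫⁻ s, g s ∂(expMeasure lam)
      = ∫⁻ s in Ici 0, ENNReal.ofReal (lam * Real.exp (-(lam * s))) * g s := by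
  have e : expMeasure lam = volume.withDensity (exponentialPDF lam) := rfl
  have hm : Measurable (exponentialPDF lam) :=
    (measurable_exponentialPDFReal lam).ennreal_ofReal
  rw [e, lintegral_withDensity_eq_lintegral_mul _ hm hg, ← lintegral_indicator measurableSet_Ici]
  refine lintegral_congr fun s => ?_
  by_cases hs : 0 ≤ s
  · rw [indicator_of_mem (mem_Ici.2 hs), Pi.mul_apply, exponentialPDF_of_nonneg hs]
  · rw [indicator_of_notMem (by simpa using hs), Pi.mul_apply,
      exponentialPDF_of_neg (not_le.1 hs), zero_mul]

lemma measurable_arrival (n : ℕ) : Measurable (fun ω : Noise d => arrival ω n) := by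
  unfold arrival
  fun_prop

lemma arrival_cons (p : (ℝ × Pos d) × Noise d) (n : ℕ) :
    arrival (Noise.cons p) (n + 1) = p.1.1 + arrival p.2 n := by
  simp only [arrival, Finset.sum_range_succ', Noise.cons, add_comm]

lemma ae_waiting_nonneg (hlam : 0 < lam) : ∀ᵐ ω ∂(noiseLaw d lam), ∀ i, 0 ≤ (ω i).1 := by
  have := isProbabilityMeasure_expMeasure hlam
  refine ae_all_iff.2 fun i => ?_
  have h1 : ∀ᵐ s ∂(expMeasure lam), 0 ≤ s := by
    rw [ae_iff, ← lintegral_indicator_one (by measurability),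
      lintegral_expMeasure (measurable_one.indicator (by measurability))]
    rw [setLIntegral_congr_fun measurableSet_Ici (g := 0)]
    · simp
    · intro s hs
      simp only [Pi.zero_apply, mul_eq_zero]
      right
      exact indicator_of_notMem (by simpa using hs) _
  have h2 := (measurePreserving_eval_infinitePi
    (fun _ : ℕ => (expMeasure lam).prod (stdGaussian (Pos d))) i)
  have h3 := (measurePreserving_fst (μ := expMeasure lam) (ν := stdGaussian (Pos d))).comp h2
  exact h3.quasiMeasurePreserving.ae h1

lemma monotone_arrival {ω : Noise d} (hω : ∀ i, 0 ≤ (ω i).1) : Monotone (arrival ω) :=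
  monotone_nat_of_le_succ fun n => by
    rw [arrival, arrival, Finset.sum_range_succ]
    linarith [hω n]

lemma refreshCount_eq {ω : Noise d} (hω : ∀ i, 0 ≤ (ω i).1) {t : ℝ} {n : ℕ}
    (h1 : arrival ω n ≤ t) (h2 : t < arrival ω (n + 1)) : refreshCount ω t = n := by
  have e : {k : ℕ | arrival ω (k + 1) ≤ t} = Iio n := by
    ext k
    simp only [mem_ofPred_eq, mem_Iio]
    constructor
    · intro hk
      by_contra hkn
      have := monotone_arrival hω (show n + 1 ≤ k + 1 by omega)
      linarith
    · intro hk
      exact (monotone_arrival hω (show k + 1 ≤ n by omega)).trans h1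
  rw [refreshCount, e, ← Finset.coe_Iio, Set.ncard_coe_finset, Nat.card_Iio]

lemma measurable_refreshCount :
    Measurable (fun p : Noise d × ℝ => refreshCount p.1 p.2) := by
  set S : Noise d × ℝ → Set ℕ := fun p => {n | arrival p.1 (n + 1) ≤ p.2}
  -- also for an infinite set, whose `ncard` is `0` just like `∞.toReal`
  have h : (fun p : Noise d × ℝ => refreshCount p.1 p.2)
      = fun p => ⌊(∑' n, (S p).indicator (1 : ℕ → ENNReal) n).toReal⌋₊ := by
    funext p
    rw [← tsum_subtype]
    simp only [Pi.one_apply, ENNReal.tsum_set_one]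
    rw [show ((S p).encard : ENNReal).toReal = ((S p).ncard : ℝ) by
      rw [Set.ncard]
      cases (S p).encard <;> simp]
    rw [Nat.floor_natCast]
    rfl
  rw [h]
  refine Nat.measurable_floor.comp (ENNReal.measurable_toReal.comp (Measurable.tsum
    fun n => ?_))
  have e : (fun p => (S p).indicator (1 : ℕ → ENNReal) n)
      = {p : Noise d × ℝ | arrival p.1 (n + 1) ≤ p.2}.indicator 1 := by
    funext p
    simp [S, indicator]
  rw [e]
  exact measurable_one.indicator (measurableSet_le
    ((measurable_arrival _).comp measurable_fst) measurable_snd)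

end noise

/-! ### Deterministic motion interrupted by random jumps

A flow `Φ` on a state space `E` is interrupted at the arrival times of the noise, where the jump
map `r` is applied with the noise vector.  The randomized Hamiltonian process and its synchronous
coupling are two instances. -/

section JumpProcess

variable {d : ℕ} {E : Type*} (Φ : ℝ → E → E) (r : Pos d → E → E)

/-- The state just after the `n`-th jump. -/
def jumpChain (ω : Noise d) (z : E) : ℕ → E
  | 0 => z
  | n + 1 => r (ω n).2 (Φ (ω n).1 (jumpChain ω z n))

/-- The state at time `t`. -/
noncomputable def jumpPath (ω : Noise d) (z : E) (t : ℝ) : E :=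
  Φ (t - arrival ω (refreshCount ω t)) (jumpChain Φ r ω z (refreshCount ω t))

/-- The integral of `f` at the state at time `t` over all times `s₁, …, sₙ` of `n` jumps before
time `t` (with respect to Lebesgue measure) and over the noise vectors of these jumps; zero for
`t < 0`. -/
noncomputable def jumpIntegral (f : E → ENNReal) : ℕ → ℝ → E → ENNReal
  | 0, t, z => (Ici (0 : ℝ)).indicator (fun _ => f (Φ t z)) t
  | n + 1, t, z => ∫⁻ s in Ici (0 : ℝ), ∫⁻ ξ, jumpIntegral f n (t - s) (r ξ (Φ s z))
      ∂(stdGaussian (Pos d))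

/-- The expectation of `f` at the state at time `t`, as a sum over the number of jumps. -/
noncomputable def jumpSemigroup (lam : ℝ) (f : E → ENNReal) (t : ℝ) (z : E) : ENNReal :=
  ∑' n, ENNReal.ofReal (lam ^ n * Real.exp (-(lam * t))) * jumpIntegral Φ r f n t z

lemma jumpChain_cons (p : (ℝ × Pos d) × Noise d) (z : E) (n : ℕ) :
    jumpChain Φ r (Noise.cons p) z (n + 1) = jumpChain Φ r p.2 (r p.1.2 (Φ p.1.1 z)) n := by
  induction n with
  | zero => rfl
  | succ n ih =>
    rw [jumpChain, ih]
    rfl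

variable {Φ r} [MeasurableSpace E] {lam : ℝ}
  (hΦ : Measurable (fun p : ℝ × E => Φ p.1 p.2))
  (hr : Measurable (fun p : Pos d × E => r p.1 p.2))

include hΦ hr

lemma measurable_jumpChain (n : ℕ) :
    Measurable (fun p : Noise d × E => jumpChain Φ r p.1 p.2 n) := by
  induction n with
  | zero => exact measurable_snd
  | succ n ih =>
    have h1 : Measurable (fun p : Noise d × E => Φ (p.1 n).1 (jumpChain Φ r p.1 p.2 n)) :=
      hΦ.comp ((((measurable_pi_apply n).comp measurable_fst).fst).prodMk ih)
    exact hr.comp ((((measurable_pi_apply n).comp measurable_fst).snd).prodMk h1)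

lemma measurable_jumpPath :
    Measurable (fun p : Noise d × E × ℝ => jumpPath Φ r p.1 p.2.1 p.2.2) := by
  have h1 : Measurable (fun q : (Noise d × E × ℝ) × ℕ =>
      Φ (q.1.2.2 - arrival q.1.1 q.2) (jumpChain Φ r q.1.1 q.1.2.1 q.2)) := by
    refine measurable_from_prod_countable_left fun n => ?_
    have h2 := (measurable_jumpChain hΦ hr n).comp
      (measurable_fst.prodMk measurable_snd.fst :
        Measurable fun p : Noise d × E × ℝ => (p.1, p.2.1))
    have h3 := (measurable_arrival (d := d) n).comp
      (measurable_fst : Measurable fun p : Noise d × E × ℝ => p.1)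
    exact hΦ.comp ((measurable_snd.snd.sub h3).prodMk h2)
  have h4 : Measurable (fun p : Noise d × E × ℝ => refreshCount p.1 p.2.2) := by
    have h6 : Measurable fun p : Noise d × E × ℝ => (p.1, p.2.2) :=
      measurable_fst.prodMk measurable_snd.snd
    simpa only [Function.comp_def] using measurable_refreshCount.comp h6
  have h5 := h1.comp (measurable_id.prodMk h4)
  unfold jumpPath
  exact h5

lemma measurable_jumpIntegral_param {P : Type*} [MeasurableSpace P] {f : P → E → ENNReal}
    (hf : Measurable (fun p : P × E => f p.1 p.2)) (n : ℕ) :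
    Measurable (fun p : P × ℝ × E => jumpIntegral Φ r (f p.1) n p.2.1 p.2.2) := by
  induction n with
  | zero =>
    have h1 : Measurable (fun p : P × ℝ × E => f p.1 (Φ p.2.1 p.2.2)) :=
      hf.comp (measurable_fst.prodMk (hΦ.comp measurable_snd))
    exact h1.indicator (measurable_snd.fst measurableSet_Ici)
  | succ n ih =>
    refine Measurable.lintegral_prod_right' (f := fun q : (P × ℝ × E) × ℝ =>
      ∫⁻ ξ, jumpIntegral Φ r (f q.1.1) n (q.1.2.1 - q.2) (r ξ (Φ q.2 q.1.2.2))
        ∂(stdGaussian (Pos d))) ?_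
    refine Measurable.lintegral_prod_right' (f := fun q : ((P × ℝ × E) × ℝ) × Pos d =>
      jumpIntegral Φ r (f q.1.1.1) n (q.1.1.2.1 - q.1.2) (r q.2 (Φ q.1.2 q.1.1.2.2))) ?_
    have h1 : Measurable (fun q : ((P × ℝ × E) × ℝ) × Pos d => Φ q.1.2 q.1.1.2.2) :=
      hΦ.comp (measurable_fst.snd.prodMk measurable_fst.fst.snd.snd)
    have h2 : Measurable (fun q : ((P × ℝ × E) × ℝ) × Pos d => r q.2 (Φ q.1.2 q.1.1.2.2)) :=
      hr.comp (measurable_snd.prodMk h1)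
    exact ih.comp (measurable_fst.fst.fst.prodMk
      ((measurable_fst.fst.snd.fst.sub measurable_fst.snd).prodMk h2))

lemma measurable_jumpIntegral {f : E → ENNReal} (hf : Measurable f) (n : ℕ) :
    Measurable (fun p : ℝ × E => jumpIntegral Φ r f n p.1 p.2) :=
  (measurable_jumpIntegral_param hΦ hr (P := Unit) (f := fun _ => f)
    (hf.comp measurable_snd) n).comp
    (measurable_const.prodMk measurable_id : Measurable fun p : ℝ × E => ((), p))

/-- The contribution of the paths with exactly `n` jumps, by renewal at the first jump. -/
lemma lintegral_noiseLaw_indicator (hlam : 0 < lam) {f : E → ENNReal} (hf : Measurable f) (n : ℕ)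
    (t : ℝ) (z : E) :
    ∫⁻ ω, {ω : Noise d | arrival ω n ≤ t ∧ t < arrival ω (n + 1)}.indicator
        (fun ω => f (Φ (t - arrival ω n) (jumpChain Φ r ω z n))) ω ∂(noiseLaw d lam)
      = ENNReal.ofReal (lam ^ n * Real.exp (-(lam * t))) * jumpIntegral Φ r f n t z := by
  have := isProbabilityMeasure_expMeasure hlam
  have := isProbabilityMeasure_noiseLaw (d := d) hlam
  have hmeas : ∀ n t z, Measurable
      ({ω : Noise d | arrival ω n ≤ t ∧ t < arrival ω (n + 1)}.indicator
        (fun ω => f (Φ (t - arrival ω n) (jumpChain Φ r ω z n)))) := by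
    intro n t z
    refine Measurable.indicator (hf.comp (hΦ.comp ((measurable_const.sub
      (measurable_arrival n)).prodMk ((measurable_jumpChain hΦ hr n).comp
        (measurable_id.prodMk measurable_const : Measurable fun ω : Noise d => (ω, z)))))) ?_
    exact (measurableSet_le (measurable_arrival n) measurable_const).inter
      (measurableSet_lt measurable_const (measurable_arrival (n + 1)))
  induction n generalizing t z with
  | zero =>
    by_cases ht : 0 ≤ t
    · have h1 : (fun ω : Noise d =>
          {ω : Noise d | arrival ω 0 ≤ t ∧ t < arrival ω (0 + 1)}.indicator
          (fun ω => f (Φ (t - arrival ω 0) (jumpChain Φ r ω z 0))) ω)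
          = fun ω => {s : ℝ | t < s}.indicator (fun _ => f (Φ t z)) (ω 0).1 := by
        funext ω
        simp [indicator, arrival, ht, jumpChain]
      rw [h1]
      have h2 := measurePreserving_eval_infinitePi
        (fun _ : ℕ => (expMeasure lam).prod (stdGaussian (Pos d))) 0
      have h3 := (measurePreserving_fst (μ := expMeasure lam) (ν := stdGaussian (Pos d))).comp h2
      have h4 : MeasurableSet {s : ℝ | t < s} := measurableSet_Ioi
      have h5 : Measurable ({s : ℝ | t < s}.indicator (fun _ => f (Φ t z))) :=
        measurable_const.indicator h4
      have h6 := h3.lintegral_comp h5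
      simp only [Function.comp_apply, Function.eval] at h6
      rw [noiseLaw, h6, lintegral_indicator h4, setLIntegral_const, jumpIntegral,
        indicator_of_mem (mem_Ici.2 ht), mul_comm]
      congr 1
      rw [pow_zero, one_mul, show {s : ℝ | t < s} = (Iic t)ᶜ by ext; simp,
        prob_compl_eq_one_sub measurableSet_Iic,
        show expMeasure lam (Iic t) = ENNReal.ofReal (1 - Real.exp (-(lam * t))) by
          have e : expMeasure lam = volume.withDensity (exponentialPDF lam) := rfl
          rw [e, withDensity_apply _ measurableSet_Iic, lintegral_exponentialPDF_eq_antiDeriv hlam,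
            if_pos ht],
        ← ENNReal.ofReal_one, ← ENNReal.ofReal_sub]
      · simp
      · have : Real.exp (-(lam * t)) ≤ 1 := Real.exp_le_one_iff.2 (by
          have := mul_nonneg hlam.le ht; linarith)
        linarith
    · have h1 : (fun ω : Noise d =>
          {ω : Noise d | arrival ω 0 ≤ t ∧ t < arrival ω (0 + 1)}.indicator
          (fun ω => f (Φ (t - arrival ω 0) (jumpChain Φ r ω z 0))) ω) = 0 := by
        funext ω
        simp [indicator, arrival, ht]
      rw [h1, jumpIntegral, indicator_of_notMem (by simpa using ht), mul_zero]
      exact lintegral_zero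
  | succ n ih =>
    rw [lintegral_noiseLaw_cons hlam (hmeas _ _ _)]
    have h1 : ∀ p : ℝ × Pos d, ∫⁻ ω, {ω : Noise d | arrival ω (n + 1) ≤ t ∧
          t < arrival ω (n + 1 + 1)}.indicator (fun ω => f (Φ (t - arrival ω (n + 1))
            (jumpChain Φ r ω z (n + 1)))) (Noise.cons (p, ω)) ∂(noiseLaw d lam)
        = ENNReal.ofReal (lam ^ n * Real.exp (-(lam * (t - p.1))))
          * jumpIntegral Φ r f n (t - p.1) (r p.2 (Φ p.1 z)) := by
      intro p
      rw [← ih (t - p.1) (r p.2 (Φ p.1 z))]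
      refine lintegral_congr fun ω => ?_
      simp only [indicator, mem_ofPred_eq, arrival_cons, jumpChain_cons, sub_sub,
        le_sub_iff_add_le', sub_lt_iff_lt_add']
    simp_rw [h1]
    have hm1 := (measurable_jumpIntegral hΦ hr hf n)
    have hm2 : Measurable (fun p : ℝ × Pos d => jumpIntegral Φ r f n (t - p.1) (r p.2 (Φ p.1 z))) :=
      hm1.comp ((measurable_const.sub measurable_fst).prodMk (hr.comp (measurable_snd.prodMk
        (hΦ.comp (measurable_fst.prodMk measurable_const)))))
    have hm3 : Measurable (fun p : ℝ × Pos d =>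
        ENNReal.ofReal (lam ^ n * Real.exp (-(lam * (t - p.1))))) := by fun_prop
    have hm5 : Measurable (fun p : ℝ × Pos d =>
        ENNReal.ofReal (lam ^ n * Real.exp (-(lam * (t - p.1))))
          * jumpIntegral Φ r f n (t - p.1) (r p.2 (Φ p.1 z))) := hm3.mul hm2
    rw [lintegral_prod _ hm5.aemeasurable,
      lintegral_expMeasure hm5.lintegral_prod_right', jumpIntegral,
      ← lintegral_const_mul _ hm2.lintegral_prod_right']
    refine lintegral_congr fun s => ?_
    have hm4 : Measurable (fun ξ => jumpIntegral Φ r f n (t - s) (r ξ (Φ s z))) :=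
      hm2.comp (measurable_const.prodMk measurable_id : Measurable fun ξ : Pos d => (s, ξ))
    simp only
    rw [lintegral_const_mul _ hm4, ← mul_assoc, ← ENNReal.ofReal_mul (by positivity)]
    congr 2
    rw [show -(lam * t) = -(lam * s) + -(lam * (t - s)) by ring, Real.exp_add]
    ring

omit [MeasurableSpace E] hΦ hr in
/-- The volume of the simplex of `n` ordered jump times. -/
lemma jumpIntegral_one (n : ℕ) (t : ℝ) (z : E) :
    jumpIntegral Φ r 1 n t z
      = (Ici (0 : ℝ)).indicator (fun t => ENNReal.ofReal (t ^ n / n.factorial)) t := by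
  induction n generalizing t z with
  | zero => simp [jumpIntegral, indicator]
  | succ n ih =>
    rw [jumpIntegral]
    simp only [ih, lintegral_const, measure_univ, mul_one]
    have h1 : ∀ s, (Ici (0 : ℝ)).indicator
        (fun s => (Ici (0 : ℝ)).indicator (fun t => ENNReal.ofReal (t ^ n / n.factorial)) (t - s)) s
        = (Icc 0 t).indicator (fun s => ENNReal.ofReal ((t - s) ^ n / n.factorial)) s := by
      intro s
      simp only [indicator, mem_Ici, mem_Icc, sub_nonneg]
      split_ifs <;> first | rfl | (exfalso; tauto)
    rw [← lintegral_indicator measurableSet_Ici]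
    simp_rw [h1]
    rw [lintegral_indicator measurableSet_Icc]
    by_cases ht : 0 ≤ t
    · rw [indicator_of_mem (mem_Ici.2 ht), ← ofReal_integral_eq_lintegral_ofReal]
      · congr 1
        rw [integral_Icc_eq_integral_Ioc, ← intervalIntegral.integral_of_le ht,
          intervalIntegral.integral_comp_sub_left (fun s => s ^ n / (n.factorial : ℝ)),
          intervalIntegral.integral_div, integral_pow, Nat.factorial_succ]
        push_cast
        simp
        field_simp
      · exact ContinuousOn.integrableOn_Icc (by fun_prop)
      · filter_upwards [ae_restrict_mem measurableSet_Icc] with s hs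
        have := sub_nonneg.2 hs.2
        positivity
    · rw [Icc_eq_empty ht, indicator_of_notMem (by simpa using ht)]
      simp

omit hΦ hr in
lemma tsum_ofReal_poisson (hlam : 0 < lam) {t : ℝ} (ht : 0 ≤ t) :
    ∑' n : ℕ, ENNReal.ofReal (lam ^ n * Real.exp (-(lam * t)))
        * ENNReal.ofReal (t ^ n / n.factorial)
      = 1 := by
  have h1 : HasSum (fun n : ℕ => lam ^ n * Real.exp (-(lam * t)) * (t ^ n / n.factorial)) 1 := by
    have h := (NormedSpace.expSeries_div_hasSum_exp (𝔸 := ℝ) (lam * t)).mul_left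
      (Real.exp (-(lam * t)))
    rw [← Real.exp_eq_exp_ℝ, ← Real.exp_add, neg_add_cancel, Real.exp_zero] at h
    have e : (fun n : ℕ => lam ^ n * Real.exp (-(lam * t)) * (t ^ n / n.factorial))
        = fun n : ℕ => Real.exp (-(lam * t)) * ((lam * t) ^ n / n.factorial) := by
      funext n
      rw [mul_pow]
      ring
    rw [e]
    exact h
  simp_rw [← ENNReal.ofReal_mul (by positivity : (0 : ℝ) ≤ lam ^ _ * Real.exp (-(lam * t)))]
  rw [← ENNReal.ofReal_tsum_of_nonneg (fun n => by positivity) h1.summable, h1.tsum_eq,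
    ENNReal.ofReal_one]

end JumpProcess

section Path

variable {d : ℕ} {lam : ℝ}

/-- The refreshments do not accumulate: the probabilities of the numbers of refreshments up to time
`t` are the Poisson weights, which sum to one. -/
lemma ae_exists_arrival (hlam : 0 < lam) {t : ℝ} (ht : 0 ≤ t) :
    ∀ᵐ ω ∂(noiseLaw d lam), ∃ n, arrival ω n ≤ t ∧ t < arrival ω (n + 1) := by
  have := isProbabilityMeasure_noiseLaw (d := d) hlam
  set A : ℕ → Set (Noise d) := fun n => {ω | arrival ω n ≤ t ∧ t < arrival ω (n + 1)}
  have hA : ∀ n, MeasurableSet (A n) := fun n =>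
    (measurableSet_le (measurable_arrival n) measurable_const).inter
      (measurableSet_lt measurable_const (measurable_arrival (n + 1)))
  have hdisj : Pairwise (Function.onFun (AEDisjoint (noiseLaw d lam)) A) := by
    intro i j hij
    refine measure_mono_null ?_ (ae_iff.1 (ae_waiting_nonneg (d := d) hlam))
    rintro ω ⟨hi, hj⟩ hω
    exact hij ((refreshCount_eq hω hi.1 hi.2).symm.trans (refreshCount_eq hω hj.1 hj.2))
  have hone : noiseLaw d lam (⋃ n, A n) = 1 := by
    rw [measure_iUnion₀ hdisj fun n => (hA n).nullMeasurableSet, ← tsum_ofReal_poisson hlam ht]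
    refine tsum_congr fun n => ?_
    have := lintegral_noiseLaw_indicator (d := d) (E := Unit) (Φ := fun _ z => z)
      (r := fun _ z => z) measurable_snd measurable_snd hlam (f := 1) measurable_one n t ()
    rw [jumpIntegral_one, indicator_of_mem (mem_Ici.2 ht)] at this
    rw [← this, ← lintegral_indicator_one (hA n)]
    rfl
  have h := (prob_compl_eq_zero_iff (MeasurableSet.iUnion hA)).2 hone
  filter_upwards [compl_mem_ae_iff.2 h] with ω hω
  simpa [A] using hω

variable {E : Type*} {Φ : ℝ → E → E} {r : Pos d → E → E} [MeasurableSpace E]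
  (hΦ : Measurable (fun p : ℝ × E => Φ p.1 p.2))
  (hr : Measurable (fun p : Pos d × E => r p.1 p.2))

include hΦ hr

/-- The jump expansion of expectations. -/
lemma lintegral_jumpPath (hlam : 0 < lam) {f : E → ENNReal} (hf : Measurable f) {t : ℝ}
    (ht : 0 ≤ t) (z : E) :
    ∫⁻ ω, f (jumpPath Φ r ω z t) ∂(noiseLaw d lam) = jumpSemigroup Φ r lam f t z := by
  set A : ℕ → Set (Noise d) := fun n => {ω | arrival ω n ≤ t ∧ t < arrival ω (n + 1)} with hAdef
  have hA : ∀ n, MeasurableSet (A n) := fun n =>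
    (measurableSet_le (measurable_arrival n) measurable_const).inter
      (measurableSet_lt measurable_const (measurable_arrival (n + 1)))
  have h1 : (fun ω => f (jumpPath Φ r ω z t)) =ᵐ[noiseLaw d lam]
      fun ω => ∑' n, (A n).indicator
        (fun ω => f (Φ (t - arrival ω n) (jumpChain Φ r ω z n))) ω := by
    filter_upwards [ae_exists_arrival hlam ht, ae_waiting_nonneg hlam] with ω ⟨n, hn⟩ hω
    rw [tsum_eq_single n, indicator_of_mem (show ω ∈ A n from hn), jumpPath,
      refreshCount_eq hω hn.1 hn.2]
    intro k hk
    refine indicator_of_notMem (fun hk' => hk ?_) _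
    exact (refreshCount_eq hω hk'.1 hk'.2).symm.trans (refreshCount_eq hω hn.1 hn.2)
  rw [lintegral_congr_ae h1, lintegral_tsum fun n => ?_, jumpSemigroup]
  · exact tsum_congr fun n => lintegral_noiseLaw_indicator hΦ hr hlam hf n t z
  · refine (Measurable.indicator (hf.comp (hΦ.comp ((measurable_const.sub
      (measurable_arrival n)).prodMk ((measurable_jumpChain hΦ hr n).comp
        (measurable_id.prodMk measurable_const : Measurable fun ω : Noise d => (ω, z))))))
          (hA n)).aemeasurable

end Path

section JumpProcess

variable {d : ℕ} {E : Type*} {Φ : ℝ → E → E} {r : Pos d → E → E}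

lemma jumpIntegral_of_neg (f : E → ENNReal) (n : ℕ) {t : ℝ} (ht : t < 0) (z : E) :
    jumpIntegral Φ r f n t z = 0 := by
  induction n generalizing t z with
  | zero => exact indicator_of_notMem (by simpa using ht) _
  | succ n ih =>
    rw [jumpIntegral, setLIntegral_congr_fun measurableSet_Ici (g := 0)]
    · simp
    · intro s hs
      simp [ih (show t - s < 0 by have := mem_Ici.1 hs; linarith)]

/-- The sum over fewer than `n` jumps, without the factor `exp (-λ t)`. -/
noncomputable def jumpPartialSum (Φ : ℝ → E → E) (r : Pos d → E → E) (lam : ℝ) (f : E → ENNReal)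
    (n : ℕ) (t : ℝ) (z : E) : ENNReal :=
  ∑ k ∈ Finset.range n, ENNReal.ofReal (lam ^ k) * jumpIntegral Φ r f k t z

variable [MeasurableSpace E] {lam : ℝ}
  (hΦ : Measurable (fun p : ℝ × E => Φ p.1 p.2))
  (hr : Measurable (fun p : Pos d × E => r p.1 p.2))

omit [MeasurableSpace E] in
lemma jumpSemigroup_eq_iSup (hlam : 0 < lam) (f : E → ENNReal) (t : ℝ) (z : E) :
    jumpSemigroup Φ r lam f t z
      = ENNReal.ofReal (Real.exp (-(lam * t))) * ⨆ n, jumpPartialSum Φ r lam f n t z := by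
  simp only [jumpPartialSum]
  rw [← ENNReal.tsum_eq_iSup_nat, jumpSemigroup, ← ENNReal.tsum_mul_left]
  refine tsum_congr fun n => ?_
  rw [ENNReal.ofReal_mul (by positivity), ← mul_assoc]
  congr 1
  exact mul_comm _ _

include hΦ hr

/-- Renewal at the first jump. -/
lemma jumpPartialSum_succ (hlam : 0 < lam) {f : E → ENNReal} (hf : Measurable f) (n : ℕ) {t : ℝ}
    (ht : 0 ≤ t) (z : E) :
    jumpPartialSum Φ r lam f (n + 1) t z = f (Φ t z) + ∫⁻ s in Icc 0 t, ENNReal.ofReal lam *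
      ∫⁻ ξ, jumpPartialSum Φ r lam f n (t - s) (r ξ (Φ s z)) ∂(stdGaussian (Pos d)) := by
  have hm : ∀ k, Measurable (fun p : ℝ × Pos d =>
      jumpIntegral Φ r f k (t - p.1) (r p.2 (Φ p.1 z))) :=
    fun k => (measurable_jumpIntegral hΦ hr hf k).comp ((measurable_const.sub measurable_fst).prodMk
      (hr.comp (measurable_snd.prodMk (hΦ.comp (measurable_fst.prodMk measurable_const)))))
  have hm' : ∀ k s, Measurable (fun ξ => jumpIntegral Φ r f k (t - s) (r ξ (Φ s z))) := fun k s =>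
    (hm k).comp (measurable_const.prodMk measurable_id : Measurable fun ξ : Pos d => (s, ξ))
  rw [jumpPartialSum, Finset.sum_range_succ', add_comm]
  congr 1
  · simp [jumpIntegral, ht]
  simp only [jumpPartialSum]
  have h1 : ∀ s, ∫⁻ ξ, ∑ k ∈ Finset.range n, ENNReal.ofReal (lam ^ k)
        * jumpIntegral Φ r f k (t - s) (r ξ (Φ s z)) ∂(stdGaussian (Pos d))
      = ∑ k ∈ Finset.range n, ENNReal.ofReal (lam ^ k)
        * ∫⁻ ξ, jumpIntegral Φ r f k (t - s) (r ξ (Φ s z)) ∂(stdGaussian (Pos d)) := fun s => by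
    rw [lintegral_finsetSum _ fun k _ => (hm' k s).const_mul _]
    exact Finset.sum_congr rfl fun k _ => lintegral_const_mul _ (hm' k s)
  simp_rw [h1, Finset.mul_sum, ← mul_assoc]
  rw [lintegral_finsetSum _ fun k _ => (hm k).lintegral_prod_right'.const_mul _]
  refine Finset.sum_congr rfl fun k _ => ?_
  rw [lintegral_const_mul _ (hm k).lintegral_prod_right', ← ENNReal.ofReal_mul hlam.le,
    jumpIntegral, pow_succ']
  congr 1
  rw [← lintegral_indicator measurableSet_Ici, ← lintegral_indicator measurableSet_Icc]
  refine lintegral_congr fun s => ?_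
  by_cases hs : s ≤ t
  · simp [indicator, hs]
  · rw [indicator_of_notMem (s := Icc 0 t) (fun h => hs h.2)]
    simp only [indicator]
    split_ifs
    · simp [jumpIntegral_of_neg f k (show t - s < 0 by linarith [not_le.1 hs])]
    · rfl

/-- Suppose that `f`, evaluated before the first jump, plus `exp (c (t - s)) f` just after a first
jump at time `s`, stays below `exp (c t) f` on average.  Then this bound propagates to any number of
jumps, by renewal at the first one. -/
lemma jumpPartialSum_le (hlam : 0 < lam) {f : E → ENNReal} (hf : Measurable f) {c : ℝ}
    (hc : ∀ t, 0 ≤ t → ∀ z, f (Φ t z) + ∫⁻ s in Icc 0 t, ENNReal.ofReal lam *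
      ∫⁻ ξ, ENNReal.ofReal (Real.exp (c * (t - s))) * f (r ξ (Φ s z)) ∂(stdGaussian (Pos d))
      ≤ ENNReal.ofReal (Real.exp (c * t)) * f z)
    (n : ℕ) {t : ℝ} (ht : 0 ≤ t) (z : E) :
    jumpPartialSum Φ r lam f n t z ≤ f (Φ t z) + ∫⁻ s in Icc 0 t, ENNReal.ofReal lam *
      ∫⁻ ξ, ENNReal.ofReal (Real.exp (c * (t - s))) * f (r ξ (Φ s z)) ∂(stdGaussian (Pos d)) := by
  induction n generalizing t z with
  | zero => simp [jumpPartialSum]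
  | succ n ih =>
    rw [jumpPartialSum_succ hΦ hr hlam hf n ht z]
    refine add_le_add_right (setLIntegral_mono' measurableSet_Icc fun s hs => ?_) _
    gcongr with ξ
    have hts : 0 ≤ t - s := sub_nonneg.2 hs.2
    exact (ih hts _).trans (hc _ hts _)

/-- Splitting off the last instead of the first jump. -/
lemma lintegral_jumpIntegral_last {f : E → ENNReal} (hf : Measurable f) (n : ℕ) (t : ℝ) (z : E) :
    ∫⁻ s in Ici (0 : ℝ), jumpIntegral Φ r (fun z => ∫⁻ ξ, f (Φ s (r ξ z)) ∂(stdGaussian (Pos d)))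
      n (t - s) z = jumpIntegral Φ r f (n + 1) t z := by
  set γ := stdGaussian (Pos d)
  have hparam : Measurable (fun p : ℝ × E => ∫⁻ ξ, f (Φ p.1 (r ξ p.2)) ∂γ) := by
    refine Measurable.lintegral_prod_right' (f := fun q : (ℝ × E) × Pos d =>
      f (Φ q.1.1 (r q.2 q.1.2))) ?_
    exact hf.comp (hΦ.comp (measurable_fst.fst.prodMk (hr.comp
      (measurable_snd.prodMk measurable_fst.snd))))
  induction n generalizing t z with
  | zero =>
    have e : ∀ s, (Ici (0 : ℝ)).indicator (fun s => jumpIntegral Φ r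
          (fun z => ∫⁻ ξ, f (Φ s (r ξ z)) ∂γ) 0 (t - s) z) s
        = (fun u => (Ici (0 : ℝ)).indicator (fun u => ∫⁻ ξ, jumpIntegral Φ r f 0 (t - u)
          (r ξ (Φ u z)) ∂γ) u) (t - s) := by
      intro s
      simp only [jumpIntegral, indicator, mem_Ici, sub_sub_cancel]
      split_ifs <;> simp
    rw [← lintegral_indicator measurableSet_Ici]
    simp_rw [e]
    rw [lintegral_sub_left_eq_self, lintegral_indicator measurableSet_Ici, jumpIntegral]
  | succ n ih =>
    have hJ := measurable_jumpIntegral_param hΦ hr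
      (f := fun s z => ∫⁻ ξ, f (Φ s (r ξ z)) ∂γ) hparam n
    have hJ' : Measurable (fun q : (ℝ × ℝ) × Pos d => jumpIntegral Φ r
        (fun z => ∫⁻ ξ, f (Φ q.1.1 (r ξ z)) ∂γ) n (t - q.1.1 - q.1.2) (r q.2 (Φ q.1.2 z))) := by
      refine hJ.comp (measurable_fst.fst.prodMk (((measurable_const.sub measurable_fst.fst).sub
        measurable_fst.snd).prodMk (hr.comp (measurable_snd.prodMk (hΦ.comp
          (measurable_fst.snd.prodMk measurable_const))))))
    rw [jumpIntegral]
    simp_rw [← ih]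
    conv_lhs => enter [2, s]; rw [jumpIntegral]
    rw [lintegral_lintegral_swap hJ'.lintegral_prod_right'.aemeasurable]
    refine lintegral_congr fun u => ?_
    rw [lintegral_lintegral_swap]
    · simp_rw [sub_right_comm t _ u]
    · exact (hJ'.comp ((measurable_fst.prodMk measurable_const).prodMk measurable_snd :
        Measurable fun q : ℝ × Pos d => ((q.1, u), q.2))).aemeasurable

end JumpProcess

/-! ### Reversal of the process -/

section reversal

variable {d : ℕ} {m M : ℝ} {U : Pos d → ℝ} {α : ℝ}

/-- The adjoint of a fixed number of jumps is obtained by reversing the velocity: the flow, the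
refreshments and the order of the jump times are all reversed. -/
lemma StrictHessianBounds.lintegral_mul_jumpIntegral (hU : StrictHessianBounds m M U)
    (h0 : 0 ≤ α) (h1 : α < 1) (n : ℕ) (t : ℝ) {f g : Phase d → ENNReal} (hf : Measurable f)
    (hg : Measurable g) :
    ∫⁻ z, g z * jumpIntegral (flow U) (refresh α) f n t z ∂(target U)
      = ∫⁻ z, f (flip z) * jumpIntegral (flow U) (refresh α) (g ∘ flip) n t z ∂(target U) := by
  have := hU.isProbabilityMeasure_target
  have hUc := hU.contDiff.continuous
  have hflow := hU.measurable_flow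
  have href := measurable_refresh (d := d) α
  set γ := stdGaussian (Pos d)
  induction n generalizing t f g with
  | zero =>
    by_cases ht : 0 ≤ t
    · simp only [jumpIntegral, indicator_of_mem (mem_Ici.2 ht), Function.comp_apply]
      have hmt : Measurable (flow U t) := (hU.continuous_flow_right t).measurable
      rw [← (hU.measurePreserving_flow_target (-t)).lintegral_comp
          (f := fun z => g z * f (flow U t z)) (hg.mul (hf.comp hmt)),
        ← (measurePreserving_flip_target hUc).lintegral_comp
          (f := fun z => g (flow U (-t) z) * f (flow U t (flow U (-t) z)))]
      · refine lintegral_congr fun z => ?_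
        rw [hU.flow_flow_neg, hU.flow_flip (-t), neg_neg, mul_comm]
      · have hmt' : Measurable (flow U (-t)) := (hU.continuous_flow_right (-t)).measurable
        exact (hg.comp hmt').mul (hf.comp (hmt.comp hmt'))
    · simp [jumpIntegral, ht]
  | succ n ih =>
    have hR : Measurable (fun p : ℝ × Phase d => ∫⁻ ξ, jumpIntegral (flow U) (refresh α) f n
        (t - p.1) (refresh α ξ p.2) ∂γ) := by
      refine Measurable.lintegral_prod_right' (f := fun q : (ℝ × Phase d) × Pos d =>
        jumpIntegral (flow U) (refresh α) f n (t - q.1.1) (refresh α q.2 q.1.2)) ?_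
      exact (measurable_jumpIntegral hflow href hf n).comp ((measurable_const.sub
        measurable_fst.fst).prodMk (href.comp (measurable_snd.prodMk measurable_fst.snd)))
    have hback : ∀ s, Measurable (fun z => g (flow U (-s) z)) := fun s =>
      hg.comp (hU.continuous_flow_right (-s)).measurable
    have hgs : ∀ s, Measurable (fun z => ∫⁻ ξ, g (flow U (-s) (refresh α ξ z)) ∂γ) := fun s => by
      refine Measurable.lintegral_prod_right' (f := fun q : Phase d × Pos d =>
        g (flow U (-s) (refresh α q.2 q.1))) ?_
      exact (hback s).comp (href.comp (measurable_snd.prodMk measurable_fst))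
    have hgf : Measurable (g ∘ flip) := hg.comp measurable_flip
    have step : ∀ s, ∫⁻ z, g z * ∫⁻ ξ, jumpIntegral (flow U) (refresh α) f n (t - s)
          (refresh α ξ (flow U s z)) ∂γ ∂(target U)
        = ∫⁻ z, f (flip z) * jumpIntegral (flow U) (refresh α)
          (fun z => ∫⁻ ξ, (g ∘ flip) (flow U s (refresh α ξ z)) ∂γ) n (t - s) z ∂(target U) := by
      intro s
      have hfm : Measurable (fun z => jumpIntegral (flow U) (refresh α) f n (t - s) z) :=
        (measurable_jumpIntegral hflow href hf n).comp
          (measurable_const.prodMk measurable_id : Measurable fun z : Phase d => (t - s, z))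
      have hRs : Measurable (fun z => ∫⁻ ξ, jumpIntegral (flow U) (refresh α) f n (t - s)
          (refresh α ξ z) ∂γ) :=
        hR.comp (measurable_const.prodMk measurable_id : Measurable fun z : Phase d => (s, z))
      have hms : Measurable (flow U s) := (hU.continuous_flow_right s).measurable
      rw [← (hU.measurePreserving_flow_target (-s)).lintegral_comp (f := fun z => g z *
        ∫⁻ ξ, jumpIntegral (flow U) (refresh α) f n (t - s) (refresh α ξ (flow U s z)) ∂γ)
        (hg.mul (hRs.comp hms))]
      simp_rw [hU.flow_flow_neg]
      rw [lintegral_refresh_symm hUc h0 h1 hfm (hback s)]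
      simp_rw [mul_comm (jumpIntegral (flow U) (refresh α) f n (t - s) _)]
      rw [ih (t - s) hf (hgs s)]
      congr! 5 with z z'
      rw [Function.comp_apply, lintegral_refresh_flip α (hback s)]
      refine lintegral_congr fun ξ => ?_
      rw [Function.comp_apply, hU.flow_flip, neg_neg]
    have hparam : Measurable (fun p : ℝ × Phase d =>
        ∫⁻ ξ, (g ∘ flip) (flow U p.1 (refresh α ξ p.2)) ∂γ) := by
      refine Measurable.lintegral_prod_right' (f := fun q : (ℝ × Phase d) × Pos d =>
        (g ∘ flip) (flow U q.1.1 (refresh α q.2 q.1.2))) ?_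
      exact hgf.comp (hflow.comp (measurable_fst.fst.prodMk (href.comp
        (measurable_snd.prodMk measurable_fst.snd))))
    have hJ : Measurable (fun p : Phase d × ℝ => jumpIntegral (flow U) (refresh α)
        (fun z => ∫⁻ ξ, (g ∘ flip) (flow U p.2 (refresh α ξ z)) ∂γ) n (t - p.2) p.1) :=
      (measurable_jumpIntegral_param hflow href
        (f := fun s z => ∫⁻ ξ, (g ∘ flip) (flow U s (refresh α ξ z)) ∂γ) hparam n).comp
        (measurable_snd.prodMk ((measurable_const.sub measurable_snd).prodMk measurable_fst))
    have hRz : Measurable (fun p : Phase d × ℝ => ∫⁻ ξ, jumpIntegral (flow U) (refresh α) f n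
        (t - p.2) (refresh α ξ (flow U p.2 p.1)) ∂γ) :=
      hR.comp (measurable_snd.prodMk (hflow.comp (measurable_snd.prodMk measurable_fst)))
    calc ∫⁻ z, g z * jumpIntegral (flow U) (refresh α) f (n + 1) t z ∂(target U)
        = ∫⁻ z, (∫⁻ s in Ici (0 : ℝ), g z * ∫⁻ ξ, jumpIntegral (flow U) (refresh α) f n (t - s)
            (refresh α ξ (flow U s z)) ∂γ) ∂(target U) := by
          refine lintegral_congr fun z => ?_
          rw [jumpIntegral, lintegral_const_mul]
          exact hRz.comp (measurable_const.prodMk measurable_id : Measurable fun s : ℝ => (z, s))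
      _ = ∫⁻ s in Ici (0 : ℝ), ∫⁻ z, g z * ∫⁻ ξ, jumpIntegral (flow U) (refresh α) f n (t - s)
            (refresh α ξ (flow U s z)) ∂γ ∂(target U) :=
          lintegral_lintegral_swap ((hg.comp measurable_fst).mul hRz).aemeasurable
      _ = ∫⁻ s in Ici (0 : ℝ), ∫⁻ z, f (flip z) * jumpIntegral (flow U) (refresh α)
            (fun z => ∫⁻ ξ, (g ∘ flip) (flow U s (refresh α ξ z)) ∂γ) n (t - s) z ∂(target U) :=
          lintegral_congr fun s => step s
      _ = ∫⁻ z, (∫⁻ s in Ici (0 : ℝ), f (flip z) * jumpIntegral (flow U) (refresh α)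
            (fun z => ∫⁻ ξ, (g ∘ flip) (flow U s (refresh α ξ z)) ∂γ) n (t - s) z) ∂(target U) :=
          (lintegral_lintegral_swap (((hf.comp measurable_flip).comp measurable_fst).mul
            hJ).aemeasurable).symm
      _ = _ := by
          refine lintegral_congr fun z => ?_
          rw [lintegral_const_mul, lintegral_jumpIntegral_last hflow href hgf]
          exact hJ.comp (measurable_const.prodMk measurable_id : Measurable fun s : ℝ => (z, s))

end reversal

/-! ### The quadratic distance -/

/-- The coefficient of `|x₂ - x₁|²`, chosen so that the mixed term of the dissipation vanishes for
a Hessian equal to the lower bound `m`. -/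
noncomputable def coefA (m M α : ℝ) : ℝ :=
  (M + m + m * α * (1 - α) / 2) / (1 + α) + α * m ^ (3 / 2 : ℝ) / (4 * Real.sqrt (M + m))

/-- Half the coefficient of `⟨x₂ - x₁, v₂ - v₁⟩`. -/
noncomputable def coefB (m M : ℝ) : ℝ := Real.sqrt (M + m) / 2

section constants

variable {m M α : ℝ}

lemma rpow_three_halves (hm : 0 < m) : m ^ (3 / 2 : ℝ) = Real.sqrt m ^ 3 := by
  rw [Real.sqrt_eq_rpow, ← Real.rpow_natCast, ← Real.rpow_mul hm.le]
  norm_num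

lemma refreshRate_pos (hm : 0 < m) (hmM : m < M) (h0 : 0 ≤ α) (h1 : α < 1) :
    0 < refreshRate m M α := by
  have hs : 0 < Real.sqrt (M + m) := Real.sqrt_pos.2 (by linarith)
  have hs2 : Real.sqrt (M + m) ^ 2 = M + m := Real.sq_sqrt (by linarith)
  have h2 : 0 < 1 - α ^ 2 := by nlinarith
  refine mul_pos (by positivity) ?_
  rw [sub_pos, div_lt_iff₀ hs]
  nlinarith

lemma coefB_pos (hm : 0 < m) (hmM : m < M) : 0 < coefB m M :=
  half_pos (Real.sqrt_pos.2 (by linarith))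

lemma sq_coefB_lt_coefA (hm : 0 < m) (hmM : m < M) (h0 : 0 ≤ α) (h1 : α < 1) :
    coefB m M ^ 2 < coefA m M α := by
  have hs : 0 < Real.sqrt (M + m) := Real.sqrt_pos.2 (by linarith)
  have hs2 : Real.sqrt (M + m) ^ 2 = M + m := Real.sq_sqrt (by linarith)
  have e : coefB m M ^ 2 = (M + m) / 4 := by rw [coefB, div_pow, hs2]; norm_num
  have h2 : (M + m) / 4 < (M + m + m * α * (1 - α) / 2) / (1 + α) := by
    rw [lt_div_iff₀ (by linarith)]
    have : 0 ≤ m * α * (1 - α) / 2 := by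
      have := sub_pos.2 h1
      positivity
    nlinarith
  have h3 : 0 ≤ α * m ^ (3 / 2 : ℝ) / (4 * Real.sqrt (M + m)) := by positivity
  rw [e, coefA]
  linarith

/-- The inequality in the dimensionless variable `ϱ = √(m / (M + m))` that bounds the contraction
rate. -/
lemma contraction_polynomial_le {ϱ : ℝ} (h0 : 0 ≤ α) (h1 : α < 1) (hϱ : 0 < ϱ)
    (hϱ2 : ϱ ^ 2 < 1 / 2) :
    ((1 + α) * ϱ - α * ϱ ^ 2 / 2) * ((1 - α) + (1 + α) * ϱ / 2) ≤ 1 := by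
  -- both factors increase with `ϱ`, and `√(1/2) < 70711 / 100000`
  have hR : ϱ < 70711 / 100000 := by nlinarith
  have f1 : (1 + α) * ϱ - α * ϱ ^ 2 / 2
      ≤ (1 + α) * (70711 / 100000) - α * (70711 / 100000) ^ 2 / 2 := by nlinarith
  have f2 : (1 - α) + (1 + α) * ϱ / 2 ≤ (1 - α) + (1 + α) * (70711 / 100000) / 2 := by nlinarith
  have g2 : 0 ≤ (1 - α) + (1 + α) * ϱ / 2 := by
    have : 0 ≤ (1 + α) * ϱ := by positivity
    linarith
  calc _ ≤ ((1 + α) * (70711 / 100000) - α * (70711 / 100000) ^ 2 / 2)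
        * ((1 - α) + (1 + α) * (70711 / 100000) / 2) := by
        gcongr
        nlinarith
    _ ≤ 1 := by nlinarith [sq_nonneg (α - 27 / 100)]

/-- The coefficient of `|x₂ - x₁|²` in the dissipation at the Hessian `m` is nonnegative. -/
lemma contractionRate_mul_coefA_le (hm : 0 < m) (hmM : m < M) (h0 : 0 ≤ α) (h1 : α < 1) :
    contractionRate m M α * coefA m M α ≤ m * Real.sqrt (M + m) := by
  rw [contractionRate, coefA, rpow_three_halves hm]
  set s := Real.sqrt (M + m) with hs
  set p := Real.sqrt m with hp
  have hs0 : 0 < s := Real.sqrt_pos.2 (by linarith)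
  have hp0 : 0 < p := Real.sqrt_pos.2 hm
  have hs2 : M + m = s ^ 2 := (Real.sq_sqrt (by linarith)).symm
  have hp2 : m = p ^ 2 := (Real.sq_sqrt hm.le).symm
  rw [hs2, hp2]
  set ϱ := p / s with hϱ
  have hϱ0 : 0 < ϱ := by positivity
  have hps : p = ϱ * s := by rw [hϱ]; field_simp
  have hϱ2 : ϱ ^ 2 < 1 / 2 := by
    rw [hϱ, div_pow, div_lt_iff₀ (by positivity), ← hs2, ← hp2]
    linarith
  have key := contraction_polynomial_le h0 h1 hϱ0 hϱ2
  have e : p ^ 2 * s - ((1 + α) * p ^ 2 / s - α * p ^ 3 / (2 * s ^ 2))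
      * ((s ^ 2 + p ^ 2 * α * (1 - α) / 2) / (1 + α) + α * p ^ 3 / (4 * s))
      = s ^ 3 * ϱ ^ 3 * α / (2 * (1 + α)) *
        (1 - ((1 + α) * ϱ - α * ϱ ^ 2 / 2) * ((1 - α) + (1 + α) * ϱ / 2)) := by
    rw [hps]
    field_simp
    ring
  have h2 : 0 ≤ s ^ 3 * ϱ ^ 3 * α / (2 * (1 + α)) *
        (1 - ((1 + α) * ϱ - α * ϱ ^ 2 / 2) * ((1 - α) + (1 + α) * ϱ / 2)) :=
    mul_nonneg (by positivity) (by linarith)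
  linarith

/-- The mixed term of the dissipation vanishes at the Hessian `m`. -/
lemma two_mul_coefA (hm : 0 < m) (hmM : m < M) (h0 : 0 ≤ α) (h1 : α < 1) :
    2 * coefA m M α = refreshRate m M α * Real.sqrt (M + m) * (1 - α)
      - contractionRate m M α * Real.sqrt (M + m) + 2 * m := by
  rw [contractionRate, coefA, refreshRate]
  set s := Real.sqrt (M + m) with hs
  have hs0 : 0 < s := Real.sqrt_pos.2 (by linarith)
  have hs2 : M + m = s ^ 2 := (Real.sq_sqrt (by linarith)).symm
  have h2 : 1 - α ^ 2 = (1 - α) * (1 + α) := by ring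
  have h3 : 1 - α ≠ 0 := by linarith
  have h4 : 1 + α ≠ 0 := by linarith
  rw [hs2, h2]
  field_simp
  ring

/-- The velocity part of the dissipation dominates the spread `M - m` of the Hessians. -/
lemma sub_le_velocity_dissipation (hm : 0 < m) (hmM : m < M) (h0 : 0 ≤ α) (h1 : α < 1) :
    M - m ≤ (refreshRate m M α * (1 - α ^ 2) - contractionRate m M α - Real.sqrt (M + m))
      * Real.sqrt (M + m) := by
  rw [contractionRate, refreshRate]
  set s := Real.sqrt (M + m) with hs
  have hs0 : 0 < s := Real.sqrt_pos.2 (by linarith)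
  have hs2 : M + m = s ^ 2 := (Real.sq_sqrt (by linarith)).symm
  have h2 : 1 - α ^ 2 ≠ 0 := by nlinarith
  have h3 : 0 ≤ α * m ^ (3 / 2 : ℝ) / (2 * s) := by positivity
  have e : (1 / (1 - α ^ 2) * (2 * s - (1 - α) * m / s) * (1 - α ^ 2)
      - ((1 + α) * m / s - α * m ^ (3 / 2 : ℝ) / (2 * (M + m))) - s) * s
      = s ^ 2 - 2 * m + α * m ^ (3 / 2 : ℝ) / (2 * s) := by
    rw [hs2]
    field_simp
    ring
  rw [e, ← hs2]
  linarith

end constants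

section distSq

variable {d : ℕ}

lemma continuous_distSq (a b c : ℝ) :
    Continuous (distSq a b c : Phase d × Phase d → ℝ) := by
  unfold distSq
  fun_prop

lemma distSq_eq_add (a b : ℝ) (w : Phase d × Phase d) :
    distSq a b 1 w = ‖(w.2.2 - w.1.2) + b • (w.2.1 - w.1.1)‖ ^ 2
      + (a - b ^ 2) * ‖w.2.1 - w.1.1‖ ^ 2 := by
  rw [distSq, norm_add_sq_real, norm_smul, mul_pow, real_inner_smul_right, Real.norm_eq_abs, sq_abs,
    real_inner_comm (w.2.1 - w.1.1)]
  ring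

lemma distSq_nonneg {a b : ℝ} (hab : b ^ 2 < a) (w : Phase d × Phase d) : 0 ≤ distSq a b 1 w := by
  rw [distSq_eq_add]
  have := sub_pos.2 hab
  positivity

lemma norm_sq_add_norm_sq_le_distSq {a b : ℝ} (hab : b ^ 2 < a) (w : Phase d × Phase d) :
    ‖w.2.1 - w.1.1‖ ^ 2 + ‖w.2.2 - w.1.2‖ ^ 2
      ≤ (2 + (1 + 2 * b ^ 2) / (a - b ^ 2)) * distSq a b 1 w := by
  have hab' := sub_pos.2 hab
  rw [distSq_eq_add]
  set X := w.2.1 - w.1.1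
  set V := w.2.2 - w.1.2
  have h1 : ‖V‖ ^ 2 ≤ 2 * ‖V + b • X‖ ^ 2 + 2 * b ^ 2 * ‖X‖ ^ 2 := by
    have h2 : 0 ≤ ‖V + (2 * b) • X‖ ^ 2 := by positivity
    rw [norm_add_sq_real, norm_smul, mul_pow, real_inner_smul_right, Real.norm_eq_abs, sq_abs] at h2
    rw [norm_add_sq_real, norm_smul, mul_pow, real_inner_smul_right, Real.norm_eq_abs, sq_abs]
    linarith
  have h3 : (2 + (1 + 2 * b ^ 2) / (a - b ^ 2)) * (‖V + b • X‖ ^ 2 + (a - b ^ 2) * ‖X‖ ^ 2)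
      = 2 * ‖V + b • X‖ ^ 2 + (1 + 2 * b ^ 2) * ‖X‖ ^ 2
        + ((1 + 2 * b ^ 2) / (a - b ^ 2) * ‖V + b • X‖ ^ 2 + 2 * (a - b ^ 2) * ‖X‖ ^ 2) := by
    field_simp
    ring
  have h4 : 0 ≤ (1 + 2 * b ^ 2) / (a - b ^ 2) * ‖V + b • X‖ ^ 2 + 2 * (a - b ^ 2) * ‖X‖ ^ 2 := by
    positivity
  rw [h3]
  linarith

end distSq

/-! ### The synchronous coupling -/

section coupling

variable {d : ℕ} {m M : ℝ} {U : Pos d → ℝ} {α : ℝ}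

/-- The flow of two uncoupled copies. -/
noncomputable def pairFlow (U : Pos d → ℝ) (t : ℝ) (w : Phase d × Phase d) : Phase d × Phase d :=
  (flow U t w.1, flow U t w.2)

/-- Refreshment of two copies with the same vector. -/
noncomputable def pairRefresh (α : ℝ) (ξ : Pos d) (w : Phase d × Phase d) : Phase d × Phase d :=
  (refresh α ξ w.1, refresh α ξ w.2)

lemma skeleton_eq_jumpChain (ω : Noise d) (z : Phase d) (n : ℕ) :
    skeleton U α ω z n = jumpChain (flow U) (refresh α) ω z n := by
  induction n with
  | zero => rfl
  | succ n ih => rw [skeleton, jumpChain, ih]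

lemma path_eq_jumpPath (ω : Noise d) (z : Phase d) (t : ℝ) :
    path U α ω z t = jumpPath (flow U) (refresh α) ω z t := by
  rw [path, jumpPath, skeleton_eq_jumpChain]

lemma coupledPath_eq_jumpPath (ω : Noise d) (w : Phase d × Phase d) (t : ℝ) :
    coupledPath U α ω w t = jumpPath (pairFlow U) (pairRefresh α) ω w t := by
  have h : ∀ n, jumpChain (pairFlow U) (pairRefresh α) ω w n
      = (skeleton U α ω w.1 n, skeleton U α ω w.2 n) := by
    intro n
    induction n with
    | zero => rfl
    | succ n ih => rw [jumpChain, ih]; rfl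
  rw [coupledPath, jumpPath, h]
  rfl

/-- The square distance just after a simultaneous refreshment, in terms of the state before. -/
noncomputable def refreshedDistSq (a b α : ℝ) (w : Phase d × Phase d) : ℝ :=
  a * ‖w.2.1 - w.1.1‖ ^ 2 + 2 * b * α * inner ℝ (w.2.1 - w.1.1) (w.2.2 - w.1.2)
    + α ^ 2 * ‖w.2.2 - w.1.2‖ ^ 2

/-- The derivative of the square distance along two Hamiltonian paths. -/
noncomputable def flowDistSqDeriv (U : Pos d → ℝ) (a b : ℝ) (w : Phase d × Phase d) : ℝ :=
  2 * a * inner ℝ (w.2.1 - w.1.1) (w.2.2 - w.1.2)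
    + 2 * b * (‖w.2.2 - w.1.2‖ ^ 2
      - inner ℝ (w.2.1 - w.1.1) (gradient U w.2.1 - gradient U w.1.1))
    - 2 * inner ℝ (w.2.2 - w.1.2) (gradient U w.2.1 - gradient U w.1.1)

lemma distSq_pairRefresh (a b α : ℝ) (ξ : Pos d) (w : Phase d × Phase d) :
    distSq a b 1 (pairRefresh α ξ w) = refreshedDistSq a b α w := by
  have e : (pairRefresh α ξ w).2.2 - (pairRefresh α ξ w).1.2 = α • (w.2.2 - w.1.2) := by
    simp only [pairRefresh, refresh]
    module
  have e' : (pairRefresh α ξ w).2.1 - (pairRefresh α ξ w).1.1 = w.2.1 - w.1.1 := rfl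
  rw [distSq, refreshedDistSq, e, e', norm_smul, mul_pow, real_inner_smul_right, Real.norm_eq_abs,
    sq_abs]
  ring

lemma continuous_refreshedDistSq (a b α : ℝ) :
    Continuous (refreshedDistSq a b α : Phase d × Phase d → ℝ) := by
  unfold refreshedDistSq
  fun_prop

lemma measurable_pairRefresh :
    Measurable (fun p : Pos d × (Phase d × Phase d) => pairRefresh α p.1 p.2) :=
  ((measurable_refresh α).comp (measurable_fst.prodMk measurable_snd.fst)).prodMk
    ((measurable_refresh α).comp (measurable_fst.prodMk measurable_snd.snd))

namespace StrictHessianBounds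

variable (hU : StrictHessianBounds m M U)

include hU

lemma continuous_pairFlow :
    Continuous (fun p : ℝ × (Phase d × Phase d) => pairFlow U p.1 p.2) :=
  (hU.continuous_flow.comp (by fun_prop : Continuous fun p : ℝ × (Phase d × Phase d) =>
    (p.1, p.2.1))).prodMk
  (hU.continuous_flow.comp (by fun_prop : Continuous fun p : ℝ × (Phase d × Phase d) =>
    (p.1, p.2.2)))

lemma continuous_pairFlow_left (w : Phase d × Phase d) : Continuous (fun t => pairFlow U t w) :=
  (hU.continuous_flow_left w.1).prodMk (hU.continuous_flow_left w.2)

lemma pairFlow_zero (w : Phase d × Phase d) : pairFlow U 0 w = w := by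
  rw [pairFlow, hU.flow_zero, hU.flow_zero]

lemma hasDerivAt_distSq_pairFlow (a b : ℝ) (w : Phase d × Phase d) (t : ℝ) :
    HasDerivAt (fun t => distSq a b 1 (pairFlow U t w))
      (flowDistSqDeriv U a b (pairFlow U t w)) t := by
  have hx := (hU.hasDerivAt_flow_fst w.2 t).fun_sub (hU.hasDerivAt_flow_fst w.1 t)
  have hv := (hU.hasDerivAt_flow_snd w.2 t).fun_sub (hU.hasDerivAt_flow_snd w.1 t)
  have h := ((hx.norm_sq.const_mul a).fun_add ((hx.inner ℝ hv).const_mul (2 * b))).fun_add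
    (hv.norm_sq.const_mul 1)
  refine h.congr_deriv ?_
  simp only [flowDistSqDeriv, pairFlow]
  set X := (flow U t w.2).1 - (flow U t w.1).1
  set V := (flow U t w.2).2 - (flow U t w.1).2
  have e : -gradient U (flow U t w.2).1 - -gradient U (flow U t w.1).1
      = -(gradient U (flow U t w.2).1 - gradient U (flow U t w.1).1) := by abel
  rw [e, inner_neg_right, inner_neg_right, real_inner_self_eq_norm_sq]
  ring

/-- The bound on the generator applied to the square distance. -/
lemma flowDistSqDeriv_add_le (h0 : 0 ≤ α) (h1 : α < 1) (w : Phase d × Phase d) :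
    flowDistSqDeriv U (coefA m M α) (coefB m M) w
      + refreshRate m M α * (refreshedDistSq (coefA m M α) (coefB m M) α w
        - distSq (coefA m M α) (coefB m M) 1 w)
      ≤ -contractionRate m M α * distSq (coefA m M α) (coefB m M) 1 w := by
  have hs0 : 0 < Real.sqrt (M + m) := Real.sqrt_pos.2 (by linarith [hU.pos, hU.lt])
  have hdiss := hU.dissipation_nonneg hU.lt hs0
    (sub_le_velocity_dissipation hU.pos hU.lt h0 h1) w.1.1 w.2.1 (w.2.2 - w.1.2)
  have hA := two_mul_coefA hU.pos hU.lt h0 h1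
  have hN := mul_le_mul_of_nonneg_right (contractionRate_mul_coefA_le hU.pos hU.lt h0 h1)
    (sq_nonneg ‖w.2.1 - w.1.1‖)
  simp only [inner_sub_right _ _ (m • _), real_inner_smul_right,
    real_inner_self_eq_norm_sq] at hdiss
  rw [flowDistSqDeriv, refreshedDistSq, distSq, coefB]
  rw [real_inner_comm (w.2.1 - w.1.1)] at hdiss
  set s := Real.sqrt (M + m)
  set X := w.2.1 - w.1.1
  set V := w.2.2 - w.1.2
  set G := gradient U w.2.1 - gradient U w.1.1
  set A := coefA m M α
  set P : ℝ := inner ℝ X V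
  linear_combination hdiss + hN + P * hA

/-- The flow decreases the square distance at most exponentially. -/
lemma neg_mul_distSq_le_flowDistSqDeriv {a b : ℝ} (ha : 0 ≤ a) (hb : 0 ≤ b) (hab : b ^ 2 < a) :
    ∃ κ : ℝ, ∀ w : Phase d × Phase d, -κ * distSq a b 1 w ≤ flowDistSqDeriv U a b w := by
  have hM : 0 < M := hU.pos.trans hU.lt
  set K := 2 + (1 + 2 * b ^ 2) / (a - b ^ 2)
  refine ⟨(a + 2 * b * M + M) * K, fun w => ?_⟩
  have hK := norm_sq_add_norm_sq_le_distSq hab w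
  have hG : ‖gradient U w.2.1 - gradient U w.1.1‖ ≤ M * ‖w.2.1 - w.1.1‖ := by
    have := (hU.lipschitzWith_gradient hU.pos hU.lt).dist_le_mul w.2.1 w.1.1
    rwa [dist_eq_norm, dist_eq_norm, Real.coe_toNNReal _ hM.le] at this
  rw [flowDistSqDeriv]
  set X := w.2.1 - w.1.1
  set V := w.2.2 - w.1.2
  set G := gradient U w.2.1 - gradient U w.1.1
  have h1 := neg_le_of_abs_le (abs_real_inner_le_norm X V)
  have h2 := le_of_abs_le (abs_real_inner_le_norm X G)
  have h3 := le_of_abs_le (abs_real_inner_le_norm V G)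
  have h2' : ‖X‖ * ‖G‖ ≤ M * (‖X‖ ^ 2 + ‖V‖ ^ 2) := by
    calc ‖X‖ * ‖G‖ ≤ ‖X‖ * (M * ‖X‖) := by gcongr
      _ ≤ _ := by nlinarith [sq_nonneg ‖V‖]
  have h3' : 2 * (‖V‖ * ‖G‖) ≤ M * (‖X‖ ^ 2 + ‖V‖ ^ 2) := by
    calc 2 * (‖V‖ * ‖G‖) ≤ 2 * (‖V‖ * (M * ‖X‖)) := by gcongr
      _ ≤ _ := by nlinarith [two_mul_le_add_sq ‖X‖ ‖V‖]
  have h1' : 2 * (‖X‖ * ‖V‖) ≤ ‖X‖ ^ 2 + ‖V‖ ^ 2 := by nlinarith [two_mul_le_add_sq ‖X‖ ‖V‖]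
  have h4 : (a + 2 * b * M + M) * (‖X‖ ^ 2 + ‖V‖ ^ 2)
      ≤ (a + 2 * b * M + M) * (K * distSq a b 1 w) :=
    mul_le_mul_of_nonneg_left hK (by positivity)
  have h5 : a * (-(‖X‖ ^ 2 + ‖V‖ ^ 2)) ≤ a * (2 * inner ℝ X V) :=
    mul_le_mul_of_nonneg_left (by linarith) ha
  have h6 : 2 * b * inner ℝ X G ≤ 2 * b * (M * (‖X‖ ^ 2 + ‖V‖ ^ 2)) :=
    mul_le_mul_of_nonneg_left (h2.trans h2') (by positivity)
  have h7 : 0 ≤ 2 * b * ‖V‖ ^ 2 := by positivity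
  linarith

lemma exp_mul_distSq_le {a b κ : ℝ}
    (hκ : ∀ w : Phase d × Phase d, -κ * distSq a b 1 w ≤ flowDistSqDeriv U a b w)
    {t : ℝ} (ht : 0 ≤ t) (w : Phase d × Phase d) :
    Real.exp (-κ * t) * distSq a b 1 w ≤ distSq a b 1 (pairFlow U t w) := by
  have hder : ∀ t, HasDerivAt (fun t => Real.exp (κ * t) * distSq a b 1 (pairFlow U t w))
      (Real.exp (κ * t) * (κ * distSq a b 1 (pairFlow U t w)
        + flowDistSqDeriv U a b (pairFlow U t w))) t := fun t => by
    have h1 := ((hasDerivAt_id t).const_mul κ).exp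
    refine (h1.fun_mul (hU.hasDerivAt_distSq_pairFlow a b w t)).congr_deriv ?_
    simp only [id]
    ring
  have hmono : Monotone fun t => Real.exp (κ * t) * distSq a b 1 (pairFlow U t w) :=
    monotone_of_deriv_nonneg (fun t => (hder t).differentiableAt) fun t => by
      rw [(hder t).deriv]
      have := hκ (pairFlow U t w)
      exact mul_nonneg (Real.exp_pos _).le (by linarith)
  have h := hmono ht
  simp only [mul_zero, Real.exp_zero, one_mul, hU.pairFlow_zero] at h
  calc _ ≤ Real.exp (-κ * t) * (Real.exp (κ * t) * distSq a b 1 (pairFlow U t w)) := by gcongr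
    _ = _ := by rw [← mul_assoc, ← Real.exp_add]; simp

end StrictHessianBounds

end coupling

/-! ### Contraction of the coupling and its generator -/

section generator

variable {d : ℕ} {m M : ℝ} {U : Pos d → ℝ} {α : ℝ} {a b : ℝ} {lam c : ℝ}

lemma refreshedDistSq_nonneg (hab : b ^ 2 < a) (w : Phase d × Phase d) :
    0 ≤ refreshedDistSq a b α w := by
  rw [← distSq_pairRefresh a b α 0]
  exact distSq_nonneg hab _

/-- The square distance at time `t` without any jump, plus the contribution of the first jump if
the square distance grows like `exp (c t)` after it. -/
noncomputable def firstJumpBound (U : Pos d → ℝ) (a b α lam c t : ℝ) (w : Phase d × Phase d) : ℝ :=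
  distSq a b 1 (pairFlow U t w)
    + Real.exp (c * t) * ∫ s in (0 : ℝ)..t,
      lam * (Real.exp (-(c * s)) * refreshedDistSq a b α (pairFlow U s w))

namespace StrictHessianBounds

variable (hU : StrictHessianBounds m M U)

include hU

lemma continuous_firstJump (a b α lam c : ℝ) (w : Phase d × Phase d) : Continuous fun s : ℝ =>
    lam * (Real.exp (-(c * s)) * refreshedDistSq a b α (pairFlow U s w)) := by
  have := (continuous_refreshedDistSq a b α).comp (hU.continuous_pairFlow_left w)
  simp only [Function.comp_def] at this
  fun_prop

lemma ofReal_firstJumpBound (hab : b ^ 2 < a) (hlam : 0 < lam) (c : ℝ) {t : ℝ} (ht : 0 ≤ t)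
    (w : Phase d × Phase d) :
    ENNReal.ofReal (distSq a b 1 (pairFlow U t w)) + ∫⁻ s in Icc 0 t, ENNReal.ofReal lam *
      ∫⁻ ξ, ENNReal.ofReal (Real.exp (c * (t - s)))
        * ENNReal.ofReal (distSq a b 1 (pairRefresh α ξ (pairFlow U s w))) ∂(stdGaussian (Pos d))
      = ENNReal.ofReal (firstJumpBound U a b α lam c t w) := by
  have hnn : ∀ s, 0 ≤ Real.exp (c * t) * (lam * (Real.exp (-(c * s))
      * refreshedDistSq a b α (pairFlow U s w))) := fun s => by
    have := refreshedDistSq_nonneg (α := α) hab (pairFlow U s w)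
    positivity
  rw [firstJumpBound, ← intervalIntegral.integral_const_mul, intervalIntegral.integral_of_le ht,
    ← integral_Icc_eq_integral_Ioc, ENNReal.ofReal_add (distSq_nonneg hab _)
      (integral_nonneg fun s => hnn s), ofReal_integral_eq_lintegral_ofReal _
      (Filter.Eventually.of_forall fun s => hnn s)]
  · congr 1
    refine lintegral_congr fun s => ?_
    simp_rw [distSq_pairRefresh]
    rw [lintegral_const, measure_univ, mul_one, ← ENNReal.ofReal_mul (Real.exp_pos _).le,
      ← ENNReal.ofReal_mul hlam.le]
    congr 1
    rw [mul_sub, sub_eq_add_neg, Real.exp_add]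
    ring
  · exact ((hU.continuous_firstJump a b α lam c w).const_mul _).integrableOn_Icc

/-- The bound decays relative to `exp (c t)`: the derivative of `exp (-c s) F` along the flow
compensates the contribution of a jump at time `s`. -/
lemma firstJumpBound_le
    (hD : ∀ w, flowDistSqDeriv U a b w + lam * refreshedDistSq a b α w ≤ c * distSq a b 1 w)
    {t : ℝ} (ht : 0 ≤ t) (w : Phase d × Phase d) :
    firstJumpBound U a b α lam c t w ≤ Real.exp (c * t) * distSq a b 1 w := by
  set h : ℝ → ℝ := fun s => -(Real.exp (-(c * s)) * distSq a b 1 (pairFlow U s w))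
  have hder : ∀ s, HasDerivAt h (-(Real.exp (-(c * s)) * (flowDistSqDeriv U a b (pairFlow U s w)
      - c * distSq a b 1 (pairFlow U s w)))) s := fun s => by
    have h1 := ((hasDerivAt_id s).const_mul c).fun_neg.exp
    refine (h1.fun_mul (hU.hasDerivAt_distSq_pairFlow a b w s)).fun_neg.congr_deriv ?_
    simp only [id]
    ring
  have key := intervalIntegral.integral_le_sub_of_hasDeriv_right_of_le (a := 0) (b := t) ht
    (fun s _ => (hder s).continuousAt.continuousWithinAt)
    (fun s _ => (hder s).hasDerivWithinAt)
    (hU.continuous_firstJump a b α lam c w).integrableOn_Icc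
    (fun s _ => by
      have := mul_le_mul_of_nonneg_left (hD (pairFlow U s w)) (Real.exp_pos (-(c * s))).le
      linarith)
  simp only [h, hU.pairFlow_zero, mul_zero, neg_zero, Real.exp_zero, one_mul] at key
  have e : Real.exp (c * t) * Real.exp (-(c * t)) = 1 := by rw [← Real.exp_add]; simp
  have h2 := mul_le_mul_of_nonneg_left key (Real.exp_pos (c * t)).le
  rw [firstJumpBound]
  linear_combination h2 - distSq a b 1 (pairFlow U t w) * e

lemma firstJumpBound_zero (w : Phase d × Phase d) :
    firstJumpBound U a b α lam c 0 w = distSq a b 1 w := by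
  simp [firstJumpBound, hU.pairFlow_zero]

lemma hasDerivAt_firstJumpBound (w : Phase d × Phase d) :
    HasDerivAt (fun t => Real.exp (-(lam * t)) * firstJumpBound U a b α lam c t w)
      (flowDistSqDeriv U a b w + lam * (refreshedDistSq a b α w - distSq a b 1 w)) 0 := by
  have hc := hU.continuous_firstJump a b α lam c w
  have h1 := intervalIntegral.integral_hasDerivAt_right (hc.intervalIntegrable 0 0)
    (hc.stronglyMeasurableAtFilter _ _) hc.continuousAt
  have h2 := ((hasDerivAt_id (0 : ℝ)).const_mul lam).fun_neg.exp
  have h3 := ((hasDerivAt_id (0 : ℝ)).const_mul c).exp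
  refine (h2.fun_mul ((hU.hasDerivAt_distSq_pairFlow a b w 0).fun_add
    (h3.fun_mul h1))).congr_deriv ?_
  simp [hU.pairFlow_zero]
  ring

lemma lintegral_distSq_coupledPath (hlam : 0 < lam) {t : ℝ} (ht : 0 ≤ t)
    (w : Phase d × Phase d) :
    ∫⁻ ω, ENNReal.ofReal (distSq a b 1 (coupledPath U α ω w t)) ∂(noiseLaw d lam)
      = ENNReal.ofReal (Real.exp (-(lam * t))) * ⨆ n, jumpPartialSum (pairFlow U) (pairRefresh α)
        lam (fun w => ENNReal.ofReal (distSq a b 1 w)) n t w := by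
  have hf : Measurable fun w : Phase d × Phase d => ENNReal.ofReal (distSq a b 1 w) :=
    (continuous_distSq a b 1).measurable.ennreal_ofReal
  simp_rw [coupledPath_eq_jumpPath]
  rw [lintegral_jumpPath (f := fun w => ENNReal.ofReal (distSq a b 1 w))
      hU.continuous_pairFlow.measurable measurable_pairRefresh hlam hf ht,
    jumpSemigroup_eq_iSup hlam]

lemma lintegral_distSq_coupledPath_le (hab : b ^ 2 < a) (hlam : 0 < lam)
    (hD : ∀ w, flowDistSqDeriv U a b w + lam * refreshedDistSq a b α w ≤ c * distSq a b 1 w)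
    {t : ℝ} (ht : 0 ≤ t) (w : Phase d × Phase d) :
    ∫⁻ ω, ENNReal.ofReal (distSq a b 1 (coupledPath U α ω w t)) ∂(noiseLaw d lam)
      ≤ ENNReal.ofReal (Real.exp (-(lam * t)) * firstJumpBound U a b α lam c t w) := by
  have hf : Measurable fun w : Phase d × Phase d => ENNReal.ofReal (distSq a b 1 w) :=
    (continuous_distSq a b 1).measurable.ennreal_ofReal
  rw [hU.lintegral_distSq_coupledPath hlam ht, ENNReal.ofReal_mul (Real.exp_pos _).le]
  gcongr
  refine iSup_le fun n => ?_
  rw [← hU.ofReal_firstJumpBound hab hlam c ht]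
  refine jumpPartialSum_le hU.continuous_pairFlow.measurable measurable_pairRefresh hlam hf
    (c := c) (fun t ht w => ?_) n ht w
  rw [hU.ofReal_firstJumpBound hab hlam c ht, ← ENNReal.ofReal_mul (Real.exp_pos _).le]
  exact ENNReal.ofReal_le_ofReal (hU.firstJumpBound_le hD ht w)

lemma le_lintegral_distSq_coupledPath (hab : b ^ 2 < a) (hlam : 0 < lam) {κ : ℝ}
    (hκ : ∀ w : Phase d × Phase d, -κ * distSq a b 1 w ≤ flowDistSqDeriv U a b w)
    {t : ℝ} (ht : 0 ≤ t) (w : Phase d × Phase d) :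
    ENNReal.ofReal (Real.exp (-(lam * t)) * firstJumpBound U a b α lam (-κ) t w)
      ≤ ∫⁻ ω, ENNReal.ofReal (distSq a b 1 (coupledPath U α ω w t)) ∂(noiseLaw d lam) := by
  have hf : Measurable fun w : Phase d × Phase d => ENNReal.ofReal (distSq a b 1 w) :=
    (continuous_distSq a b 1).measurable.ennreal_ofReal
  rw [hU.lintegral_distSq_coupledPath hlam ht, ENNReal.ofReal_mul (Real.exp_pos _).le]
  gcongr
  -- the paths with at most one jump already give the lower bound
  refine le_trans ?_ (le_iSup _ 2)
  rw [← hU.ofReal_firstJumpBound hab hlam (-κ) ht, jumpPartialSum_succ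
    hU.continuous_pairFlow.measurable measurable_pairRefresh hlam hf 1 ht]
  refine add_le_add_right (setLIntegral_mono' measurableSet_Icc fun s hs => ?_) _
  gcongr with ξ
  have hts : 0 ≤ t - s := sub_nonneg.2 hs.2
  rw [jumpPartialSum, Finset.sum_range_one, pow_zero, ENNReal.ofReal_one, one_mul, jumpIntegral,
    indicator_of_mem (mem_Ici.2 hts), ← ENNReal.ofReal_mul (Real.exp_pos _).le]
  exact ENNReal.ofReal_le_ofReal (hU.exp_mul_distSq_le hκ hts _)

lemma measurable_coupledPath (w : Phase d × Phase d) (t : ℝ) :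
    Measurable fun ω : Noise d => coupledPath U α ω w t := by
  simp_rw [coupledPath_eq_jumpPath]
  exact (measurable_jumpPath hU.continuous_pairFlow.measurable
    (measurable_pairRefresh (α := α))).comp
    (measurable_id.prodMk measurable_const : Measurable fun ω : Noise d => (ω, (w, t)))

lemma integrable_distSq_coupledPath (hab : b ^ 2 < a) (hlam : 0 < lam)
    (hD : ∀ w, flowDistSqDeriv U a b w + lam * refreshedDistSq a b α w ≤ c * distSq a b 1 w)
    {t : ℝ} (ht : 0 ≤ t) (w : Phase d × Phase d) :
    Integrable (fun ω => distSq a b 1 (coupledPath U α ω w t)) (noiseLaw d lam) := by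
  refine ⟨((continuous_distSq a b 1).measurable.comp
    (hU.measurable_coupledPath w t)).aestronglyMeasurable, ?_⟩
  rw [hasFiniteIntegral_iff_ofReal (Filter.Eventually.of_forall fun ω => distSq_nonneg hab _)]
  exact (hU.lintegral_distSq_coupledPath_le hab hlam hD ht w).trans_lt ENNReal.ofReal_lt_top

lemma coupledSemigroup_distSq_le (hab : b ^ 2 < a) (hlam : 0 < lam)
    (hD : ∀ w, flowDistSqDeriv U a b w + lam * refreshedDistSq a b α w ≤ c * distSq a b 1 w)
    {t : ℝ} (ht : 0 ≤ t) (w : Phase d × Phase d) :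
    coupledSemigroup U α lam t (distSq a b 1) w
      ≤ Real.exp (-(lam * t)) * firstJumpBound U a b α lam c t w := by
  have h := hU.lintegral_distSq_coupledPath_le (α := α) hab hlam hD ht w
  rw [← ofReal_integral_eq_lintegral_ofReal (hU.integrable_distSq_coupledPath hab hlam hD ht w)
    (Filter.Eventually.of_forall fun ω => distSq_nonneg hab _)] at h
  refine (ENNReal.ofReal_le_ofReal_iff (mul_nonneg (Real.exp_pos _).le ?_)).1 h
  refine add_nonneg (distSq_nonneg hab _) (mul_nonneg (Real.exp_pos _).le
    (intervalIntegral.integral_nonneg ht fun s _ => ?_))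
  have := refreshedDistSq_nonneg (α := α) hab (pairFlow U s w)
  positivity

/-- The pointwise generator of the coupling on the square distance.  The upper bound has the growth
rate `c` and the lower bound the growth rate `-κ` after the first jump, but this rate does not enter
the derivative at time `0`. -/
lemma hasDerivWithinAt_coupledSemigroup (ha : 0 ≤ a) (hb : 0 ≤ b) (hab : b ^ 2 < a)
    (hlam : 0 < lam)
    (hD : ∀ w, flowDistSqDeriv U a b w + lam * refreshedDistSq a b α w ≤ c * distSq a b 1 w)
    (w : Phase d × Phase d) :
    coupledSemigroup U α lam 0 (distSq a b 1) w = distSq a b 1 w ∧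
    HasDerivWithinAt (fun t => coupledSemigroup U α lam t (distSq a b 1) w)
      (flowDistSqDeriv U a b w + lam * (refreshedDistSq a b α w - distSq a b 1 w)) (Ici 0) 0 := by
  obtain ⟨κ, hκ⟩ := hU.neg_mul_distSq_le_flowDistSqDeriv ha hb hab
  have hlow : ∀ t, 0 ≤ t → Real.exp (-(lam * t)) * firstJumpBound U a b α lam (-κ) t w
      ≤ coupledSemigroup U α lam t (distSq a b 1) w := fun t ht => by
    have h := hU.le_lintegral_distSq_coupledPath (α := α) hab hlam hκ ht w
    rw [← ofReal_integral_eq_lintegral_ofReal (hU.integrable_distSq_coupledPath hab hlam hD ht w)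
      (Filter.Eventually.of_forall fun ω => distSq_nonneg hab _)] at h
    exact (ENNReal.ofReal_le_ofReal_iff (integral_nonneg fun ω => distSq_nonneg hab _)).1 h
  have hup := fun t (ht : 0 ≤ t) => hU.coupledSemigroup_distSq_le (α := α) hab hlam hD ht w
  have h0 : coupledSemigroup U α lam 0 (distSq a b 1) w = distSq a b 1 w := by
    have h1 := hlow 0 le_rfl
    have h2 := hup 0 le_rfl
    rw [hU.firstJumpBound_zero] at h1 h2
    simp only [mul_zero, neg_zero, Real.exp_zero, one_mul] at h1 h2
    exact le_antisymm h2 h1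
  refine ⟨h0, ?_⟩
  have dl := (hU.hasDerivAt_firstJumpBound (a := a) (b := b) (α := α) (lam := lam) (c := -κ)
    w).hasDerivWithinAt (s := Ici 0)
  have du := (hU.hasDerivAt_firstJumpBound (a := a) (b := b) (α := α) (lam := lam) (c := c)
    w).hasDerivWithinAt (s := Ici 0)
  rw [hasDerivWithinAt_iff_tendsto_slope, Ici_sdiff_left] at dl du ⊢
  refine tendsto_of_tendsto_of_tendsto_of_le_of_le' dl du ?_ ?_ <;>
  · filter_upwards [self_mem_nhdsWithin] with t ht
    have ht0 : 0 < t := ht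
    simp only [slope_def_field, h0, hU.firstJumpBound_zero, mul_zero, neg_zero, Real.exp_zero,
      one_mul, sub_zero]
    have h1 := hlow t ht0.le
    have h2 := hup t ht0.le
    gcongr

/-- The hypothesis on the growth rate `c = λ - μ` between jumps, from the bound on the generator. -/
lemma drift_bound (h0 : 0 ≤ α) (h1 : α < 1) (w : Phase d × Phase d) :
    flowDistSqDeriv U (coefA m M α) (coefB m M) w
      + refreshRate m M α * refreshedDistSq (coefA m M α) (coefB m M) α w
      ≤ (refreshRate m M α - contractionRate m M α)
        * distSq (coefA m M α) (coefB m M) 1 w := by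
  linarith [hU.flowDistSqDeriv_add_le h0 h1 w]

lemma coefA_nonneg (h0 : 0 ≤ α) (h1 : α < 1) : 0 ≤ coefA m M α :=
  (sq_nonneg _).trans (sq_coefB_lt_coefA hU.pos hU.lt h0 h1).le

lemma inCoupledDomain (h0 : 0 ≤ α) (h1 : α < 1) :
    InCoupledDomain U α (refreshRate m M α) (distSq (coefA m M α) (coefB m M) 1) := fun w => by
  have hab := sq_coefB_lt_coefA hU.pos hU.lt h0 h1
  have hlam := refreshRate_pos hU.pos hU.lt h0 h1
  have hD := hU.drift_bound h0 h1
  have h := hU.hasDerivWithinAt_coupledSemigroup (hU.coefA_nonneg h0 h1)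
    (coefB_pos hU.pos hU.lt).le hab hlam hD w
  exact ⟨fun t ht => hU.integrable_distSq_coupledPath hab hlam hD ht w, h.1,
    h.2.differentiableWithinAt⟩

lemma coupledGenerator_le (h0 : 0 ≤ α) (h1 : α < 1) (w : Phase d × Phase d) :
    coupledGenerator U α (refreshRate m M α) (distSq (coefA m M α) (coefB m M) 1) w
      ≤ -contractionRate m M α * distSq (coefA m M α) (coefB m M) 1 w := by
  have h := hU.hasDerivWithinAt_coupledSemigroup (hU.coefA_nonneg h0 h1)
    (coefB_pos hU.pos hU.lt).le (sq_coefB_lt_coefA hU.pos hU.lt h0 h1)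
    (refreshRate_pos hU.pos hU.lt h0 h1) (hU.drift_bound h0 h1) w
  rw [coupledGenerator, h.2.derivWithin (uniqueDiffOn_Ici 0 0 self_mem_Ici)]
  exact hU.flowDistSqDeriv_add_le h0 h1 w

lemma integrable_distSq_coefA (h0 : 0 ≤ α) (h1 : α < 1) {t : ℝ} (ht : 0 ≤ t)
    (w : Phase d × Phase d) :
    Integrable (fun ω => distSq (coefA m M α) (coefB m M) 1 (coupledPath U α ω w t))
      (noiseLaw d (refreshRate m M α)) :=
  hU.integrable_distSq_coupledPath (sq_coefB_lt_coefA hU.pos hU.lt h0 h1)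
    (refreshRate_pos hU.pos hU.lt h0 h1) (hU.drift_bound h0 h1) ht w

/-- The coupling contracts the square distance on average. -/
lemma coupledSemigroup_le_exp_mul (h0 : 0 ≤ α) (h1 : α < 1) {t : ℝ} (ht : 0 ≤ t)
    (w : Phase d × Phase d) :
    coupledSemigroup U α (refreshRate m M α) t (distSq (coefA m M α) (coefB m M) 1) w
      ≤ Real.exp (-contractionRate m M α * t) * distSq (coefA m M α) (coefB m M) 1 w := by
  have hD := hU.drift_bound h0 h1
  refine (hU.coupledSemigroup_distSq_le (sq_coefB_lt_coefA hU.pos hU.lt h0 h1)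
    (refreshRate_pos hU.pos hU.lt h0 h1) hD ht w).trans ?_
  refine (mul_le_mul_of_nonneg_left (hU.firstJumpBound_le hD ht w) (Real.exp_pos _).le).trans_eq ?_
  rw [← mul_assoc, ← Real.exp_add]
  congr 2
  ring

end StrictHessianBounds

end generator

/-! ### Stationarity and reversal in law -/

section stationary

variable {d : ℕ} {m M : ℝ} {U : Pos d → ℝ} {α lam t : ℝ}

namespace StrictHessianBounds

variable (hU : StrictHessianBounds m M U)

include hU

lemma measurable_path (t : ℝ) : Measurable fun p : Phase d × Noise d => path U α p.2 p.1 t := by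
  simp_rw [path_eq_jumpPath]
  exact (measurable_jumpPath hU.measurable_flow (measurable_refresh α)).comp
    (measurable_snd.prodMk (measurable_fst.prodMk measurable_const) :
      Measurable fun p : Phase d × Noise d => (p.2, (p.1, t)))

/-- The semigroup and its conjugate by the reversal of the velocity are adjoint. -/
lemma lintegral_mul_lintegral_path (h0 : 0 ≤ α) (h1 : α < 1) (hlam : 0 < lam) (ht : 0 ≤ t)
    {f g : Phase d → ENNReal} (hf : Measurable f) (hg : Measurable g) :
    ∫⁻ z, g z * ∫⁻ ω, f (path U α ω z t) ∂(noiseLaw d lam) ∂(target U)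
      = ∫⁻ z, f (flip z) * ∫⁻ ω, g (flip (path U α ω z t)) ∂(noiseLaw d lam) ∂(target U) := by
  have hΦ := hU.measurable_flow
  have hr := measurable_refresh (d := d) α
  have key : ∀ {f g : Phase d → ENNReal}, Measurable f → Measurable g →
      ∫⁻ z, g z * ∫⁻ ω, f (path U α ω z t) ∂(noiseLaw d lam) ∂(target U)
      = ∑' n, ENNReal.ofReal (lam ^ n * Real.exp (-(lam * t)))
        * ∫⁻ z, g z * jumpIntegral (flow U) (refresh α) f n t z ∂(target U) := by
    intro f g hf hg
    have hm : ∀ n, Measurable fun z => jumpIntegral (flow U) (refresh α) f n t z := fun n =>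
      (measurable_jumpIntegral hΦ hr hf n).comp
        (measurable_const.prodMk measurable_id : Measurable fun z : Phase d => (t, z))
    simp_rw [path_eq_jumpPath, lintegral_jumpPath hΦ hr hlam hf ht, jumpSemigroup,
      ← ENNReal.tsum_mul_left]
    have hm' : ∀ n, Measurable fun z => g z * (ENNReal.ofReal (lam ^ n * Real.exp (-(lam * t)))
        * jumpIntegral (flow U) (refresh α) f n t z) := fun n => hg.mul ((hm n).const_mul _)
    rw [lintegral_tsum fun n => (hm' n).aemeasurable]
    refine tsum_congr fun n => ?_
    simp_rw [mul_left_comm (g _)]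
    exact lintegral_const_mul _ (hg.mul (hm n))
  have hgf : Measurable fun z => g (flip z) := hg.comp measurable_flip
  have hff : Measurable fun z => f (flip z) := hf.comp measurable_flip
  rw [key hf hg, key hgf hff]
  refine tsum_congr fun n => ?_
  rw [hU.lintegral_mul_jumpIntegral h0 h1 n t hf hg]
  rfl

/-- In equilibrium, the law of the pair of the initial state and the state at time `t` is invariant
under reversal of time and velocities. -/
lemma map_swap_flip (h0 : 0 ≤ α) (h1 : α < 1) (hlam : 0 < lam) (ht : 0 ≤ t) :
    ((target U).prod (noiseLaw d lam)).map
        (fun p => (flip (path U α p.2 p.1 t), flip p.1))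
      = ((target U).prod (noiseLaw d lam)).map (fun p => (p.1, path U α p.2 p.1 t)) := by
  have := hU.isProbabilityMeasure_target
  have := isProbabilityMeasure_noiseLaw (d := d) hlam
  have hp := hU.measurable_path (α := α) t
  have hm1 : Measurable fun p : Phase d × Noise d => (flip (path U α p.2 p.1 t), flip p.1) :=
    (measurable_flip.comp hp).prodMk (measurable_flip.comp measurable_fst)
  have hm2 : Measurable fun p : Phase d × Noise d => (p.1, path U α p.2 p.1 t) :=
    measurable_fst.prodMk hp
  have := Measure.isFiniteMeasure_map ((target U).prod (noiseLaw d lam))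
    (fun p : Phase d × Noise d => (flip (path U α p.2 p.1 t), flip p.1))
  have key : ∀ {f g : Phase d → ENNReal}, Measurable f → Measurable g →
      ∫⁻ p, g p.1 * f (path U α p.2 p.1 t) ∂((target U).prod (noiseLaw d lam))
        = ∫⁻ z, g z * ∫⁻ ω, f (path U α ω z t) ∂(noiseLaw d lam) ∂(target U) := by
    intro f g hf hg
    have hgfp : Measurable fun p : Phase d × Noise d => g p.1 * f (path U α p.2 p.1 t) :=
      (hg.comp measurable_fst).mul (hf.comp hp)
    rw [lintegral_prod _ hgfp.aemeasurable]
    refine lintegral_congr fun z => ?_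
    have hz : Measurable fun ω : Noise d => (z, ω) := measurable_const.prodMk measurable_id
    have hfz : Measurable fun ω => f (path U α ω z t) := by
      simpa only [Function.comp_def] using hf.comp (hp.comp hz)
    rw [← lintegral_const_mul _ hfz]
  refine Measure.ext_prod fun {s u} hs hu => ?_
  have hs' : Measurable (s.indicator (1 : Phase d → ENNReal)) := measurable_one.indicator hs
  have hu' : Measurable (u.indicator (1 : Phase d → ENNReal)) := measurable_one.indicator hu
  have e := hU.lintegral_mul_lintegral_path h0 h1 hlam ht hu' hs'
  rw [← key hu' hs', ← key (f := fun z => s.indicator 1 (flip z))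
    (g := fun z => u.indicator 1 (flip z)) (hs'.comp measurable_flip)
    (hu'.comp measurable_flip)] at e
  rw [← lintegral_indicator_one (hs.prod hu), ← lintegral_indicator_one (hs.prod hu),
    lintegral_map (measurable_one.indicator (hs.prod hu)) hm1,
    lintegral_map (measurable_one.indicator (hs.prod hu)) hm2]
  calc _ = ∫⁻ p, u.indicator 1 (flip p.1) * s.indicator 1 (flip (path U α p.2 p.1 t))
        ∂((target U).prod (noiseLaw d lam)) := by
        refine lintegral_congr fun p => ?_
        rw [mul_comm, ← Set.indicator_prod_one]
    _ = _ := e.symm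
    _ = _ := by
        refine lintegral_congr fun p => ?_
        rw [← Set.indicator_prod_one]

/-- The target measure is invariant. -/
lemma measurePreserving_path (h0 : 0 ≤ α) (h1 : α < 1) (hlam : 0 < lam) (ht : 0 ≤ t) :
    MeasurePreserving (fun p : Phase d × Noise d => path U α p.2 p.1 t)
      ((target U).prod (noiseLaw d lam)) (target U) := by
  have := hU.isProbabilityMeasure_target
  have := isProbabilityMeasure_noiseLaw (d := d) hlam
  have hp := hU.measurable_path (α := α) t
  refine ⟨hp, ?_⟩
  have h := congrArg (Measure.map Prod.snd) (hU.map_swap_flip h0 h1 hlam ht)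
  have hm1 : Measurable fun p : Phase d × Noise d => (flip (path U α p.2 p.1 t), flip p.1) :=
    (measurable_flip.comp hp).prodMk (measurable_flip.comp measurable_fst)
  have hm2 : Measurable fun p : Phase d × Noise d => (p.1, path U α p.2 p.1 t) :=
    measurable_fst.prodMk hp
  rw [Measure.map_map measurable_snd hm1, Measure.map_map measurable_snd hm2] at h
  refine Eq.trans h.symm ?_
  exact ((measurePreserving_flip_target hU.contDiff.continuous).comp measurePreserving_fst).map_eq

/-! ### The semigroup on square integrable functions -/

section L2

variable (h0 : 0 ≤ α) (h1 : α < 1) (hlam : 0 < lam) (ht : 0 ≤ t) {f : Phase d → ℝ}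
  (hf : MemLp f 2 (target U))

include h0 h1 hlam ht hf

lemma memLp_comp_path : MemLp (fun p : Phase d × Noise d => f (path U α p.2 p.1 t)) 2
    ((target U).prod (noiseLaw d lam)) :=
  hf.comp_measurePreserving (hU.measurePreserving_path h0 h1 hlam ht)

lemma integrable_comp_path :
    Integrable (fun p : Phase d × Noise d => f (path U α p.2 p.1 t))
      ((target U).prod (noiseLaw d lam)) := by
  have := hU.isProbabilityMeasure_target
  have := isProbabilityMeasure_noiseLaw (d := d) hlam
  exact (hU.memLp_comp_path h0 h1 hlam ht hf).integrable one_le_two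

lemma ae_integrable_path :
    ∀ᵐ z ∂(target U), Integrable (fun ω => f (path U α ω z t)) (noiseLaw d lam) := by
  have := hU.isProbabilityMeasure_target
  have := isProbabilityMeasure_noiseLaw (d := d) hlam
  exact (hU.integrable_comp_path h0 h1 hlam ht hf).prod_right_ae

/-- Jensen's inequality. -/
lemma ae_sq_semigroup_le :
    ∀ᵐ z ∂(target U), (semigroup U α lam t f z) ^ 2
      ≤ ∫ ω, f (path U α ω z t) ^ 2 ∂(noiseLaw d lam) := by
  have := hU.isProbabilityMeasure_target
  have := isProbabilityMeasure_noiseLaw (d := d) hlam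
  filter_upwards [hU.ae_integrable_path h0 h1 hlam ht hf,
    (hU.memLp_comp_path h0 h1 hlam ht hf).integrable_sq.prod_right_ae] with z hz hz2
  have hm : MemLp (fun ω => f (path U α ω z t)) 2 (noiseLaw d lam) :=
    (memLp_two_iff_integrable_sq hz.aestronglyMeasurable).2 hz2
  have := variance_nonneg (fun ω => f (path U α ω z t)) (noiseLaw d lam)
  rw [variance_eq_sub hm] at this
  exact sub_nonneg.1 this

lemma memLp_semigroup : MemLp (semigroup U α lam t f) 2 (target U) := by
  have := hU.isProbabilityMeasure_target
  have := isProbabilityMeasure_noiseLaw (d := d) hlam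
  have hi := (hU.integrable_comp_path h0 h1 hlam ht hf).integral_prod_left.aestronglyMeasurable
  refine (memLp_two_iff_integrable_sq hi).2 ?_
  refine (hU.memLp_comp_path h0 h1 hlam ht hf).integrable_sq.integral_prod_left.mono'
    (hi.pow 2) ?_
  filter_upwards [hU.ae_sq_semigroup_le h0 h1 hlam ht hf] with z hz
  rw [Real.norm_of_nonneg (sq_nonneg _)]
  exact hz

lemma integral_sq_semigroup_le :
    ∫ z, (semigroup U α lam t f z) ^ 2 ∂(target U) ≤ ∫ z, (f z) ^ 2 ∂(target U) := by
  have := hU.isProbabilityMeasure_target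
  have := isProbabilityMeasure_noiseLaw (d := d) hlam
  have hsq := (hU.memLp_comp_path h0 h1 hlam ht hf).integrable_sq
  have hP := hU.measurePreserving_path (α := α) h0 h1 hlam ht
  calc ∫ z, (semigroup U α lam t f z) ^ 2 ∂(target U)
      ≤ ∫ z, ∫ ω, f (path U α ω z t) ^ 2 ∂(noiseLaw d lam) ∂(target U) :=
        integral_mono_ae (hU.memLp_semigroup h0 h1 hlam ht hf).integrable_sq hsq.integral_prod_left
          (hU.ae_sq_semigroup_le h0 h1 hlam ht hf)
    _ = ∫ p, f (path U α p.2 p.1 t) ^ 2 ∂((target U).prod (noiseLaw d lam)) :=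
        (integral_prod _ hsq).symm
    _ = ∫ z, f z ^ 2 ∂(target U) := by
        have h2 := hf.integrable_sq.aestronglyMeasurable
        rw [← hP.map_eq] at h2
        rw [← integral_map hP.measurable.aemeasurable h2, hP.map_eq]

lemma integral_semigroup :
    ∫ z, semigroup U α lam t f z ∂(target U) = ∫ z, f z ∂(target U) := by
  have := hU.isProbabilityMeasure_target
  have := isProbabilityMeasure_noiseLaw (d := d) hlam
  have hP := hU.measurePreserving_path (α := α) h0 h1 hlam ht
  have h2 := hf.aestronglyMeasurable
  rw [← hP.map_eq] at h2
  calc ∫ z, semigroup U α lam t f z ∂(target U)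
      = ∫ p, f (path U α p.2 p.1 t) ∂((target U).prod (noiseLaw d lam)) :=
        (integral_prod _ (hU.integrable_comp_path h0 h1 hlam ht hf)).symm
    _ = _ := by rw [← integral_map hP.measurable.aemeasurable h2, hP.map_eq]

lemma semigroup_sub {g : Phase d → ℝ} (hg : MemLp g 2 (target U)) :
    semigroup U α lam t (fun z => f z - g z)
      =ᵐ[target U] fun z => semigroup U α lam t f z - semigroup U α lam t g z := by
  filter_upwards [hU.ae_integrable_path h0 h1 hlam ht hf,
    hU.ae_integrable_path h0 h1 hlam ht hg] with z hz hz'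
  exact integral_sub hz hz'

end L2

end StrictHessianBounds

end stationary

/-! ### Log-convex sequences -/

/-- A log-convex sequence is at least geometric with the initial ratio, so that a geometric upper
bound on it, with any constant `K`, bounds the initial ratio. -/
lemma le_mul_of_sq_le_mul {β : ℕ → ℝ} (h0 : ∀ k, 0 ≤ β k)
    (hconv : ∀ k, β (k + 1) ^ 2 ≤ β k * β (k + 2)) {K ρ : ℝ} (hρ : 0 < ρ)
    (hK : ∀ k, β k ≤ K * ρ ^ k) : β 1 ≤ ρ * β 0 := by
  by_contra! hlt
  have hβ1 : 0 < β 1 := (mul_nonneg hρ.le (h0 0)).trans_lt hlt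
  have hβ0 : 0 < β 0 := by
    refine (h0 0).lt_of_ne' fun h => ?_
    have := hconv 0
    rw [h, zero_mul] at this
    nlinarith
  set q := β 1 / β 0
  have hq : ρ < q := (lt_div_iff₀ hβ0).2 hlt
  have hq0 : 0 < q := hρ.trans hq
  have step : ∀ k, 0 < β k ∧ q * β k ≤ β (k + 1) := by
    intro k
    induction k with
    | zero => exact ⟨hβ0, by rw [div_mul_cancel₀ _ hβ0.ne']⟩
    | succ k ih =>
      have hpos : 0 < β (k + 1) := (mul_pos hq0 ih.1).trans_le ih.2
      refine ⟨hpos, ?_⟩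
      have h2 : β k * (q * β (k + 1)) ≤ β k * β (k + 2) := by
        calc β k * (q * β (k + 1)) = (q * β k) * β (k + 1) := by ring
          _ ≤ β (k + 1) * β (k + 1) := by gcongr; exact ih.2
          _ ≤ _ := by rw [← sq]; exact hconv k
      exact le_of_mul_le_mul_left h2 ih.1
  have hgeom : ∀ k, β 0 * q ^ k ≤ β k := by
    intro k
    induction k with
    | zero => simp
    | succ k ih =>
      calc β 0 * q ^ (k + 1) = q * (β 0 * q ^ k) := by ring
        _ ≤ q * β k := by gcongr
        _ ≤ _ := (step k).2
  obtain ⟨k, hk⟩ := pow_unbounded_of_one_lt (K / β 0) ((one_lt_div hρ).2 hq)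
  rw [div_pow, div_lt_div_iff₀ hβ0 (by positivity)] at hk
  linarith [hgeom k, hK k]

/-- The Cauchy–Schwarz inequality for real square integrable functions. -/
lemma sq_integral_mul_le {Ω : Type*} [MeasurableSpace Ω] {ν : Measure Ω} {f g : Ω → ℝ}
    (hf : MemLp f 2 ν) (hg : MemLp g 2 ν) :
    (∫ z, f z * g z ∂ν) ^ 2 ≤ (∫ z, f z ^ 2 ∂ν) * ∫ z, g z ^ 2 ∂ν := by
  have hfg : Integrable (fun z => f z * g z) ν := hf.integrable_mul hg
  have h : ∀ s : ℝ, 0 ≤ (∫ z, g z ^ 2 ∂ν) * (s * s) + (2 * ∫ z, f z * g z ∂ν) * s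
      + ∫ z, f z ^ 2 ∂ν := fun s => by
    have h1 : 0 ≤ ∫ z, (g z ^ 2 * (s * s) + f z * g z * (2 * s) + f z ^ 2) ∂ν :=
      integral_nonneg fun z => by
        have := sq_nonneg (f z + s * g z)
        simp only [Pi.zero_apply]
        linarith
    rw [integral_add (((hg.integrable_sq.mul_const _).fun_add (hfg.mul_const _))) hf.integrable_sq,
      integral_add (hg.integrable_sq.mul_const _) (hfg.mul_const _), integral_mul_const,
      integral_mul_const] at h1
    linarith
  have := discrim_le_zero h
  rw [discrim] at this
  linarith

/-! ### Contraction of Lipschitz functions -/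

section Lipschitz

variable {d : ℕ} {m M : ℝ} {U : Pos d → ℝ} {α lam t : ℝ} {a b : ℝ}

/-- The constant `(a c + b² + 2 √(a c b²)) / (a c - b²)` for `c = 1`.  It compares the square
distance with its image under the reversal of the velocities, which changes the sign of the mixed
term. -/
noncomputable def flipConst (a b : ℝ) : ℝ :=
  (a * 1 + b ^ 2 + 2 * Real.sqrt (a * 1 * b ^ 2)) / (a * 1 - b ^ 2)

lemma flipConst_pos (hab : b ^ 2 < a) : 0 < flipConst a b := by
  have h1 : 0 < a := (sq_nonneg b).trans_lt hab
  have h2 : 0 < a * 1 - b ^ 2 := by linarith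
  unfold flipConst
  positivity

/-- With `r = √a`, the difference of the two sides is a multiple of `|r (x₂ - x₁) + (v₂ - v₁)|²`. -/
lemma distSq_flip_le (hb : 0 ≤ b) (hab : b ^ 2 < a) (z w : Phase d) :
    distSq a b 1 (flip z, flip w) ≤ flipConst a b * distSq a b 1 (z, w) := by
  have ha : 0 < a := (sq_nonneg b).trans_lt hab
  obtain ⟨r, hr0, rfl⟩ : ∃ r : ℝ, 0 < r ∧ a = r ^ 2 :=
    ⟨Real.sqrt a, Real.sqrt_pos.2 ha, (Real.sq_sqrt ha.le).symm⟩
  have hbr : b < r := lt_of_pow_lt_pow_left₀ 2 hr0.le hab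
  have hrb : 0 < r - b := sub_pos.2 hbr
  have hC : flipConst (r ^ 2) b = (r + b) / (r - b) := by
    have h1 : Real.sqrt (r ^ 2 * 1 * b ^ 2) = r * b := by
      rw [mul_one, ← mul_pow, Real.sqrt_sq (by positivity)]
    have h2 : r ^ 2 * 1 - b ^ 2 = (r + b) * (r - b) := by ring
    have h3 : r + b ≠ 0 := by positivity
    rw [flipConst, h1, h2]
    field_simp
    ring
  rw [hC, div_mul_eq_mul_div, le_div_iff₀ hrb]
  simp only [distSq, flip]
  have e : -w.2 - -z.2 = -(w.2 - z.2) := by abel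
  rw [e, inner_neg_right, norm_neg]
  set X := w.1 - z.1
  set V := w.2 - z.2
  have key : 0 ≤ 2 * b * ‖r • X + V‖ ^ 2 := by positivity
  rw [norm_add_sq_real, norm_smul, mul_pow, real_inner_smul_left, Real.norm_eq_abs, sq_abs] at key
  linarith

lemma StrictHessianBounds.integrable_distSq_prod (hU : StrictHessianBounds m M U) (a b : ℝ) :
    Integrable (distSq a b 1) ((target U).prod (target U)) := by
  have := hU.isProbabilityMeasure_target
  have h := hU.integrable_norm_sq_target
  have hs : Integrable (fun w : Phase d × Phase d => (‖w.1.1‖ ^ 2 + ‖w.1.2‖ ^ 2)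
      + (‖w.2.1‖ ^ 2 + ‖w.2.2‖ ^ 2)) ((target U).prod (target U)) :=
    (h.comp_fst (target U)).add (h.comp_snd (target U))
  refine (hs.const_mul (2 * (|a| + |b| + 1))).mono'
    (continuous_distSq a b 1).aestronglyMeasurable (Filter.Eventually.of_forall fun w => ?_)
  have hsub : ∀ x y : Pos d, ‖x - y‖ ^ 2 ≤ 2 * (‖x‖ ^ 2 + ‖y‖ ^ 2) := fun x y => by
    have := parallelogram_law_with_norm ℝ x y
    nlinarith [sq_nonneg ‖x + y‖]
  have hx := hsub w.2.1 w.1.1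
  have hv := hsub w.2.2 w.1.2
  rw [Real.norm_eq_abs, distSq]
  set X := w.2.1 - w.1.1
  set V := w.2.2 - w.1.2
  have hi : |2 * b * inner ℝ X V| ≤ |b| * (‖X‖ ^ 2 + ‖V‖ ^ 2) := by
    rw [mul_assoc, abs_mul, abs_mul, abs_two]
    have := abs_real_inner_le_norm X V
    nlinarith [two_mul_le_add_sq ‖X‖ ‖V‖, abs_nonneg b]
  calc |a * ‖X‖ ^ 2 + 2 * b * inner ℝ X V + 1 * ‖V‖ ^ 2|
      ≤ |a * ‖X‖ ^ 2| + |2 * b * inner ℝ X V| + |1 * ‖V‖ ^ 2| := abs_add_three _ _ _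
    _ ≤ |a| * ‖X‖ ^ 2 + |b| * (‖X‖ ^ 2 + ‖V‖ ^ 2) + ‖V‖ ^ 2 := by
        rw [abs_mul, abs_of_nonneg (sq_nonneg ‖X‖), one_mul, abs_of_nonneg (sq_nonneg ‖V‖)]
        gcongr
    _ ≤ (|a| + |b| + 1) * (‖X‖ ^ 2 + ‖V‖ ^ 2) := by
        nlinarith [sq_nonneg ‖X‖, sq_nonneg ‖V‖, abs_nonneg a, mul_nonneg (abs_nonneg a)
          (sq_nonneg ‖V‖)]
    _ ≤ (|a| + |b| + 1) * (2 * ((‖w.1.1‖ ^ 2 + ‖w.1.2‖ ^ 2) + (‖w.2.1‖ ^ 2 + ‖w.2.2‖ ^ 2))) := by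
        gcongr
        linarith
    _ = _ := by ring

/-- Bounded measurable functions with mean zero in equilibrium whose squared Lipschitz constant
with respect to the quadratic distance is at most `ℓ`. -/
structure IsTestFunction (U : Pos d → ℝ) (a b ℓ : ℝ) (g : Phase d → ℝ) : Prop where
  measurable : Measurable g
  bounded : ∃ B, ∀ z, |g z| ≤ B
  integral_eq_zero : ∫ z, g z ∂(target U) = 0
  sq_sub_le : ∀ z w, (g z - g w) ^ 2 ≤ ℓ * distSq a b 1 (z, w)

/-- The semigroup followed by the reversal of the velocity.  It is self-adjoint in equilibrium. -/
noncomputable def reversedSemigroup (U : Pos d → ℝ) (α lam t : ℝ) (g : Phase d → ℝ)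
    (z : Phase d) : ℝ :=
  semigroup U α lam t g (flip z)

namespace StrictHessianBounds

variable (hU : StrictHessianBounds m M U)

include hU

lemma memLp_of_abs_le {g : Phase d → ℝ} (hg : Measurable g) {B : ℝ} (hB : ∀ z, |g z| ≤ B) :
    MemLp g 2 (target U) := by
  have := hU.isProbabilityMeasure_target
  exact MemLp.of_bound hg.aestronglyMeasurable B (Filter.Eventually.of_forall hB)

lemma integral_comp_flip (g : Phase d → ℝ) :
    ∫ z, g (flip z) ∂(target U) = ∫ z, g z ∂(target U) := by
  have h := measurePreserving_flip_target hU.contDiff.continuous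
  have he : MeasurableEmbedding (flip : Phase d → Phase d) :=
    (MeasurableEquiv.mk ⟨flip, flip, flip_flip, flip_flip⟩ measurable_flip
      measurable_flip).measurableEmbedding
  exact h.integral_comp he g

lemma integrable_path_of_abs_le (hlam : 0 < lam) {g : Phase d → ℝ} (hg : Measurable g)
    {B : ℝ} (hB : ∀ z, |g z| ≤ B) (z : Phase d) :
    Integrable (fun ω => g (path U α ω z t)) (noiseLaw d lam) := by
  have := isProbabilityMeasure_noiseLaw (d := d) hlam
  have hz : Measurable fun ω : Noise d => (z, ω) := measurable_const.prodMk measurable_id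
  have hm : Measurable fun ω => g (path U α ω z t) := by
    simpa only [Function.comp_def] using hg.comp ((hU.measurable_path (α := α) t).comp hz)
  exact Integrable.of_bound hm.aestronglyMeasurable B (Filter.Eventually.of_forall fun ω => hB _)

lemma measurable_semigroup (hlam : 0 < lam) {g : Phase d → ℝ} (hg : Measurable g) (t : ℝ) :
    Measurable (semigroup U α lam t g) := by
  have := isProbabilityMeasure_noiseLaw (d := d) hlam
  have h : Measurable fun p : Phase d × Noise d => g (path U α p.2 p.1 t) := by
    simpa only [Function.comp_def] using hg.comp (hU.measurable_path (α := α) t)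
  exact (h.stronglyMeasurable.integral_prod_right' (ν := noiseLaw d lam)).measurable

omit hU in
lemma abs_semigroup_le (hlam : 0 < lam) {g : Phase d → ℝ} {B : ℝ} (hB : ∀ z, |g z| ≤ B)
    (z : Phase d) : |semigroup U α lam t g z| ≤ B := by
  have := isProbabilityMeasure_noiseLaw (d := d) hlam
  have h := norm_integral_le_of_norm_le_const (μ := noiseLaw d lam)
    (f := fun ω => g (path U α ω z t)) (Filter.Eventually.of_forall fun ω => hB _)
  simpa [semigroup] using h

lemma integral_mul_reversedSemigroup (h0 : 0 ≤ α) (h1 : α < 1) (hlam : 0 < lam) (ht : 0 ≤ t)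
    {f g : Phase d → ℝ} (hf : Measurable f) (hg : Measurable g) {B B' : ℝ}
    (hB : ∀ z, |f z| ≤ B) (hB' : ∀ z, |g z| ≤ B') :
    ∫ z, g z * reversedSemigroup U α lam t f z ∂(target U)
      = ∫ z, f z * reversedSemigroup U α lam t g z ∂(target U) := by
  have := hU.isProbabilityMeasure_target
  have := isProbabilityMeasure_noiseLaw (d := d) hlam
  have hp := hU.measurable_path (α := α) t
  -- both sides are integrals over the law of the initial and the final state
  have key : ∀ {f g : Phase d → ℝ} {B B' : ℝ}, Measurable f → Measurable g →
      (∀ z, |f z| ≤ B) → (∀ z, |g z| ≤ B') →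
      ∫ z, g z * reversedSemigroup U α lam t f z ∂(target U)
        = ∫ p, g (flip p.1) * f (path U α p.2 p.1 t) ∂((target U).prod (noiseLaw d lam)) := by
    intro f g B B' hf hg hB hB'
    have hm : Measurable fun p : Phase d × Noise d => g (flip p.1) * f (path U α p.2 p.1 t) :=
      (hg.comp (measurable_flip.comp measurable_fst)).mul (hf.comp hp)
    rw [integral_prod, ← hU.integral_comp_flip]
    · refine integral_congr_ae (Filter.Eventually.of_forall fun z => ?_)
      simp only [reversedSemigroup, flip_flip, semigroup]
      exact (integral_const_mul _ _).symm
    · refine Integrable.of_bound hm.aestronglyMeasurable (B' * B)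
        (Filter.Eventually.of_forall fun p => ?_)
      rw [norm_mul]
      exact mul_le_mul (hB' _) (hB _) (norm_nonneg _) ((abs_nonneg _).trans (hB' (flip p.1)))
  rw [key hf hg hB hB', key hg hf hB' hB]
  have hm1 : Measurable fun p : Phase d × Noise d => (flip (path U α p.2 p.1 t), flip p.1) :=
    (measurable_flip.comp hp).prodMk (measurable_flip.comp measurable_fst)
  have hm2 : Measurable fun p : Phase d × Noise d => (p.1, path U α p.2 p.1 t) :=
    measurable_fst.prodMk hp
  have hF : Measurable fun q : Phase d × Phase d => g (flip q.1) * f q.2 :=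
    (hg.comp (measurable_flip.comp measurable_fst)).mul (hf.comp measurable_snd)
  have e2 := integral_map (μ := (target U).prod (noiseLaw d lam)) hm2.aemeasurable
    (f := fun q : Phase d × Phase d => g (flip q.1) * f q.2) hF.aestronglyMeasurable
  have e1 := integral_map (μ := (target U).prod (noiseLaw d lam)) hm1.aemeasurable
    (f := fun q : Phase d × Phase d => g (flip q.1) * f q.2) hF.aestronglyMeasurable
  rw [← hU.map_swap_flip h0 h1 hlam ht, e1] at e2
  rw [← e2]
  refine integral_congr_ae (Filter.Eventually.of_forall fun p => ?_)
  simp only [flip_flip]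
  exact mul_comm _ _

/-- The contraction of the coupling, passed on to Lipschitz functions by Jensen's inequality. -/
lemma sq_semigroup_sub_le (h0 : 0 ≤ α) (h1 : α < 1) (ht : 0 ≤ t) {ℓ : ℝ} (hℓ : 0 ≤ ℓ)
    {g : Phase d → ℝ} (hg : IsTestFunction U (coefA m M α) (coefB m M) ℓ g) (z w : Phase d) :
    (semigroup U α (refreshRate m M α) t g z - semigroup U α (refreshRate m M α) t g w) ^ 2
      ≤ ℓ * (Real.exp (-contractionRate m M α * t)
        * distSq (coefA m M α) (coefB m M) 1 (z, w)) := by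
  have hlam := refreshRate_pos hU.pos hU.lt h0 h1
  have := isProbabilityMeasure_noiseLaw (d := d) hlam
  obtain ⟨B, hB⟩ := hg.bounded
  have hi := fun z => hU.integrable_path_of_abs_le (α := α) (t := t) hlam hg.measurable hB z
  have hdist := hU.integrable_distSq_coefA h0 h1 ht (z, w)
  have hb2 : ∀ ω, (g (path U α ω z t) - g (path U α ω w t)) ^ 2
      ≤ ℓ * distSq (coefA m M α) (coefB m M) 1 (coupledPath U α ω (z, w) t) := fun ω =>
    hg.sq_sub_le _ _
  have hm : AEStronglyMeasurable (fun ω => g (path U α ω z t) - g (path U α ω w t))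
      (noiseLaw d (refreshRate m M α)) := ((hi z).sub (hi w)).aestronglyMeasurable
  have hsq : Integrable (fun ω => (g (path U α ω z t) - g (path U α ω w t)) ^ 2)
      (noiseLaw d (refreshRate m M α)) := by
    refine (hdist.const_mul ℓ).mono' (hm.pow 2) (Filter.Eventually.of_forall fun ω => ?_)
    rw [Real.norm_of_nonneg (sq_nonneg _)]
    exact hb2 ω
  have hvar := variance_nonneg (fun ω => g (path U α ω z t) - g (path U α ω w t))
    (noiseLaw d (refreshRate m M α))
  rw [variance_eq_sub ((memLp_two_iff_integrable_sq hm).2 hsq), integral_sub (hi z) (hi w)] at hvar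
  calc _ ≤ ∫ ω, (g (path U α ω z t) - g (path U α ω w t)) ^ 2
        ∂(noiseLaw d (refreshRate m M α)) := sub_nonneg.1 hvar
    _ ≤ ∫ ω, ℓ * distSq (coefA m M α) (coefB m M) 1 (coupledPath U α ω (z, w) t)
        ∂(noiseLaw d (refreshRate m M α)) := integral_mono hsq (hdist.const_mul ℓ) hb2
    _ = ℓ * coupledSemigroup U α (refreshRate m M α) t
        (distSq (coefA m M α) (coefB m M) 1) (z, w) := integral_const_mul _ _
    _ ≤ _ := by
        gcongr
        exact hU.coupledSemigroup_le_exp_mul h0 h1 ht (z, w)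

/-- The reversed semigroup multiplies the squared Lipschitz constant by at most `C exp (-μ t)`. -/
lemma isTestFunction_reversedSemigroup (h0 : 0 ≤ α) (h1 : α < 1) (ht : 0 ≤ t) {ℓ : ℝ}
    (hℓ : 0 ≤ ℓ) {g : Phase d → ℝ} (hg : IsTestFunction U (coefA m M α) (coefB m M) ℓ g) :
    IsTestFunction U (coefA m M α) (coefB m M)
      (ℓ * (flipConst (coefA m M α) (coefB m M) * Real.exp (-contractionRate m M α * t)))
      (reversedSemigroup U α (refreshRate m M α) t g) := by
  have hlam := refreshRate_pos hU.pos hU.lt h0 h1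
  obtain ⟨B, hB⟩ := hg.bounded
  refine ⟨(hU.measurable_semigroup hlam hg.measurable t).comp measurable_flip,
    ⟨B, fun z => abs_semigroup_le hlam hB _⟩, ?_, fun z w => ?_⟩
  · simp only [reversedSemigroup]
    rw [hU.integral_comp_flip, hU.integral_semigroup h0 h1 hlam ht
      (hU.memLp_of_abs_le hg.measurable hB), hg.integral_eq_zero]
  · refine (hU.sq_semigroup_sub_le h0 h1 ht hℓ hg (flip z) (flip w)).trans ?_
    rw [mul_assoc, mul_comm (flipConst _ _), mul_assoc]
    gcongr
    exact distSq_flip_le (coefB_pos hU.pos hU.lt).le (sq_coefB_lt_coefA hU.pos hU.lt h0 h1) z w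

/-- The variance of a Lipschitz function is half its mean square increment between two independent
points. -/
lemma integral_sq_le_of_isTestFunction {ℓ : ℝ} {g : Phase d → ℝ}
    (hg : IsTestFunction U a b ℓ g) :
    ∫ z, g z ^ 2 ∂(target U) ≤ ℓ * ∫ w, distSq a b 1 w ∂((target U).prod (target U)) := by
  have := hU.isProbabilityMeasure_target
  obtain ⟨B, hB⟩ := hg.bounded
  have hL := hU.memLp_of_abs_le hg.measurable hB
  have hi := hL.integrable one_le_two
  have hsq := hL.integrable_sq
  have hprod := hi.mul_prod hi
  have e : ∫ w, (g w.1 - g w.2) ^ 2 ∂((target U).prod (target U))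
      = 2 * ∫ z, g z ^ 2 ∂(target U) := by
    have e1 : (fun w : Phase d × Phase d => (g w.1 - g w.2) ^ 2)
        = fun w => (g w.1 ^ 2 + g w.2 ^ 2) - 2 * (g w.1 * g w.2) := by
      funext w
      ring
    rw [e1, integral_sub ((hsq.comp_fst _).fun_add (hsq.comp_snd _)) (hprod.const_mul 2),
      integral_add (hsq.comp_fst _) (hsq.comp_snd _), integral_const_mul, integral_prod_mul,
      hg.integral_eq_zero, integral_fun_fst (fun z => g z ^ 2), integral_fun_snd (fun z => g z ^ 2)]
    simp
    ring
  have hint : Integrable (fun w : Phase d × Phase d => (g w.1 - g w.2) ^ 2)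
      ((target U).prod (target U)) := by
    refine Integrable.of_bound (C := (2 * B) ^ 2) (((hg.measurable.comp measurable_fst).sub
      (hg.measurable.comp measurable_snd)).pow_const 2).aestronglyMeasurable
      (Filter.Eventually.of_forall fun w => ?_)
    rw [Real.norm_of_nonneg (sq_nonneg _), ← sq_abs]
    gcongr
    exact (abs_sub _ _).trans (by linarith [hB w.1, hB w.2])
  have hle := integral_mono hint ((hU.integrable_distSq_prod a b).const_mul ℓ)
    fun w => hg.sq_sub_le w.1 w.2
  rw [e, integral_const_mul] at hle
  have : 0 ≤ ∫ z, g z ^ 2 ∂(target U) := integral_nonneg fun z => sq_nonneg _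
  linarith

/-- The decay on test functions: self-adjointness turns the geometric decay of the Lipschitz
constants into the same decay of the norms, with constant one. -/
lemma integral_sq_semigroup_le_of_isTestFunction (h0 : 0 ≤ α) (h1 : α < 1) (ht : 0 ≤ t) {ℓ : ℝ}
    (hℓ : 0 ≤ ℓ) {g : Phase d → ℝ} (hg : IsTestFunction U (coefA m M α) (coefB m M) ℓ g) :
    ∫ z, semigroup U α (refreshRate m M α) t g z ^ 2 ∂(target U)
      ≤ flipConst (coefA m M α) (coefB m M) * Real.exp (-contractionRate m M α * t)
        * ∫ z, g z ^ 2 ∂(target U) := by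
  have hlam := refreshRate_pos hU.pos hU.lt h0 h1
  set a := coefA m M α
  set b := coefB m M
  set ρ := flipConst a b * Real.exp (-contractionRate m M α * t)
  have hρ : 0 < ρ := mul_pos (flipConst_pos (sq_coefB_lt_coefA hU.pos hU.lt h0 h1)) (Real.exp_pos _)
  set T := reversedSemigroup U α (refreshRate m M α) t
  set G : ℕ → Phase d → ℝ := fun k => T^[k] g
  have hG : ∀ k, G (k + 1) = T (G k) := fun k => Function.iterate_succ_apply' T k g
  have htest : ∀ k, IsTestFunction U a b (ℓ * ρ ^ k) (G k) := by
    intro k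
    induction k with
    | zero => simpa [G] using hg
    | succ k ih =>
      rw [hG, pow_succ, ← mul_assoc]
      exact hU.isTestFunction_reversedSemigroup h0 h1 ht (by positivity) ih
  have hL : ∀ k, MemLp (G k) 2 (target U) := fun k => by
    obtain ⟨B, hB⟩ := (htest k).bounded
    exact hU.memLp_of_abs_le (htest k).measurable hB
  have hconv : ∀ k, (∫ z, G (k + 1) z ^ 2 ∂(target U)) ^ 2
      ≤ (∫ z, G k z ^ 2 ∂(target U)) * ∫ z, G (k + 2) z ^ 2 ∂(target U) := by
    intro k
    obtain ⟨B, hB⟩ := (htest k).bounded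
    obtain ⟨B', hB'⟩ := (htest (k + 1)).bounded
    have e : ∫ z, G (k + 1) z ^ 2 ∂(target U) = ∫ z, G k z * G (k + 2) z ∂(target U) := by
      have := hU.integral_mul_reversedSemigroup h0 h1 hlam ht (htest k).measurable
        (htest (k + 1)).measurable hB hB'
      rw [show k + 2 = k + 1 + 1 from rfl, hG (k + 1)]
      refine Eq.trans ?_ this
      refine integral_congr_ae (Filter.Eventually.of_forall fun z => ?_)
      simp only [hG k, T, sq]
    rw [e]
    exact sq_integral_mul_le (hL k) (hL (k + 2))
  have h := le_mul_of_sq_le_mul (β := fun k => ∫ z, G k z ^ 2 ∂(target U))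
    (fun k => integral_nonneg fun z => sq_nonneg _) hconv hρ
    (K := ℓ * ∫ w, distSq a b 1 w ∂((target U).prod (target U))) fun k => by
      refine (hU.integral_sq_le_of_isTestFunction (htest k)).trans_eq ?_
      ring
  refine le_trans (le_of_eq ?_) h
  exact (hU.integral_comp_flip fun z => semigroup U α (refreshRate m M α) t g z ^ 2).symm

end StrictHessianBounds

end Lipschitz

/-! ### Density of test functions and the decay in `L²` -/

section density

variable {d : ℕ} {m M : ℝ} {U : Pos d → ℝ} {α t : ℝ} {a b : ℝ}

/-- Here `x, y, x', y'` play the role of square norms, those of `x'` and `y'` belonging to vectors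
at distance at most `ε`; the bound `y' ≤ ρ x'` then passes to the limit `ε → 0`. -/
lemma le_mul_of_forall_approx {x y ρ : ℝ} (hρ : 0 ≤ ρ)
    (h : ∀ ε : ℝ, 0 < ε → ∃ x' y' : ℝ, x' ≤ (1 + ε) * x + (1 + ε⁻¹) * ε ^ 2 ∧
      y ≤ (1 + ε) * y' + (1 + ε⁻¹) * ε ^ 2 ∧ y' ≤ ρ * x') : y ≤ ρ * x := by
  have key : ∀ ε : ℝ, 0 < ε → y ≤ (1 + ε) * (ρ * ((1 + ε) * x + (ε ^ 2 + ε))) + (ε ^ 2 + ε) := by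
    intro ε hε
    obtain ⟨x', y', h1, h2, h3⟩ := h ε hε
    have e : (1 + ε⁻¹) * ε ^ 2 = ε ^ 2 + ε := by field_simp
    rw [e] at h1 h2
    refine h2.trans ?_
    gcongr
    exact h3.trans (by gcongr)
  have hc : Continuous fun ε : ℝ =>
      (1 + ε) * (ρ * ((1 + ε) * x + (ε ^ 2 + ε))) + (ε ^ 2 + ε) := by fun_prop
  have hlim := (hc.tendsto 0).mono_left (nhdsWithin_le_nhds (s := Ioi 0))
  have := ge_of_tendsto hlim (by
    filter_upwards [self_mem_nhdsWithin] with ε hε using key ε hε)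
  simpa using this

/-- The triangle inequality for square norms, with an adjustable weight. -/
lemma integral_sq_le_add {Ω : Type*} [MeasurableSpace Ω] {ν : Measure Ω} {f g : Ω → ℝ}
    (hf : MemLp f 2 ν) (hg : MemLp g 2 ν) {ε : ℝ} (hε : 0 < ε) :
    ∫ z, f z ^ 2 ∂ν ≤ (1 + ε) * ∫ z, g z ^ 2 ∂ν + (1 + ε⁻¹) * ∫ z, (f z - g z) ^ 2 ∂ν := by
  have hfg : Integrable (fun z => (f z - g z) ^ 2) ν := (hf.sub hg).integrable_sq
  rw [← integral_const_mul, ← integral_const_mul,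
    ← integral_add (hg.integrable_sq.const_mul _) (hfg.const_mul _)]
  refine integral_mono hf.integrable_sq ((hg.integrable_sq.const_mul _).add (hfg.const_mul _))
    fun z => ?_
  -- the difference of the two sides is `ε⁻¹ (ε g - (f - g))²`
  have e : (1 + ε) * g z ^ 2 + (1 + ε⁻¹) * (f z - g z) ^ 2
      = f z ^ 2 + ε⁻¹ * (ε * g z - (f z - g z)) ^ 2 := by
    field_simp
    ring
  have : 0 ≤ ε⁻¹ * (ε * g z - (f z - g z)) ^ 2 := by positivity
  simp only
  linarith

namespace StrictHessianBounds

variable (hU : StrictHessianBounds m M U)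

include hU

/-- Centered smooth functions with compact support are test functions, and they are dense. -/
lemma exists_isTestFunction (hab : b ^ 2 < a) {f : Phase d → ℝ} (hf : MemLp f 2 (target U))
    (hf0 : ∫ z, f z ∂(target U) = 0) {ε : ℝ} (hε : 0 < ε) :
    ∃ (ℓ : ℝ) (g : Phase d → ℝ), 0 ≤ ℓ ∧ IsTestFunction U a b ℓ g ∧
      ∫ z, (f z - g z) ^ 2 ∂(target U) ≤ ε ^ 2 := by
  have := hU.isProbabilityMeasure_target
  obtain ⟨g, hg1, hg2, hg3⟩ := hf.exist_eLpNorm_sub_le (by norm_num) (by norm_num) hε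
  have hgc : Continuous g := hg2.continuous
  obtain ⟨L, hL⟩ := ContDiff.lipschitzWith_of_hasCompactSupport hg1 hg2 (by simp)
  obtain ⟨B, hB⟩ := hg1.exists_bound_of_continuous hgc
  have hgL : MemLp g 2 (target U) := hU.memLp_of_abs_le hgc.measurable hB
  have hfg : MemLp (f - g) 2 (target U) := hf.sub hgL
  have hi := hf.integrable one_le_two
  have hgi := hgL.integrable one_le_two
  set c := ∫ z, g z ∂(target U)
  refine ⟨L ^ 2 * (2 + (1 + 2 * b ^ 2) / (a - b ^ 2)), fun z => g z - c, ?_, ⟨?_, ?_, ?_, ?_⟩, ?_⟩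
  · have := sub_pos.2 hab
    positivity
  · exact hgc.measurable.sub_const c
  · exact ⟨B + |c|, fun z => (abs_sub _ _).trans (add_le_add (hB z) le_rfl)⟩
  · rw [integral_sub hgi (integrable_const c)]
    simp [c]
  · intro z w
    have h1 := hL.dist_le_mul z w
    have h2 := norm_sq_add_norm_sq_le_distSq hab (z, w)
    have h3 : dist z w ^ 2 ≤ ‖w.1 - z.1‖ ^ 2 + ‖w.2 - z.2‖ ^ 2 := by
      rw [Prod.dist_eq, dist_comm z.1, dist_comm z.2, dist_eq_norm, dist_eq_norm]
      rcases max_choice ‖w.1 - z.1‖ ‖w.2 - z.2‖ with h | h <;> rw [h] <;>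
        linarith [sq_nonneg ‖w.1 - z.1‖, sq_nonneg ‖w.2 - z.2‖]
    calc (g z - c - (g w - c)) ^ 2 = dist (g z) (g w) ^ 2 := by
          rw [Real.dist_eq, sq_abs]
          ring
      _ ≤ (L * dist z w) ^ 2 := by gcongr
      _ = L ^ 2 * dist z w ^ 2 := by ring
      _ ≤ L ^ 2 * ((2 + (1 + 2 * b ^ 2) / (a - b ^ 2)) * distSq a b 1 (z, w)) := by
          gcongr
          exact h3.trans h2
      _ = _ := by ring
  · -- centering is an orthogonal projection
    have hvar := variance_le_expectation_sq (X := f - g) (μ := target U)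
      hfg.aestronglyMeasurable
    have hmean : ∫ z, (f - g) z ∂(target U) = -c := by
      simp only [Pi.sub_apply]
      rw [integral_sub hi hgi, hf0, zero_sub]
    rw [variance_eq_integral hfg.aemeasurable, hmean] at hvar
    have e : ∀ z, (f - g) z - -c = f z - (g z - c) := fun z => by
      simp only [Pi.sub_apply]
      ring
    simp_rw [e] at hvar
    refine hvar.trans ?_
    rw [hfg.eLpNorm_eq_integral_rpow_norm (by norm_num) (by norm_num),
      ENNReal.ofReal_le_ofReal_iff hε.le] at hg3
    have hn : 0 ≤ ∫ z, ‖(f - g) z‖ ^ (ENNReal.toReal 2) ∂(target U) :=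
      integral_nonneg fun z => by positivity
    rw [← Real.sqrt_le_left hε.le]
    rw [ENNReal.toReal_ofNat, ← one_div, ← Real.sqrt_eq_rpow] at hg3
    simpa using hg3

/-- The decay of the semigroup in `L²`, by approximation with test functions. -/
theorem integral_sq_semigroup_le_mul (h0 : 0 ≤ α) (h1 : α < 1) (ht : 0 ≤ t) {f : Phase d → ℝ}
    (hf : MemLp f 2 (target U)) (hf0 : ∫ z, f z ∂(target U) = 0) :
    ∫ z, semigroup U α (refreshRate m M α) t f z ^ 2 ∂(target U)
      ≤ flipConst (coefA m M α) (coefB m M) * Real.exp (-contractionRate m M α * t)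
        * ∫ z, f z ^ 2 ∂(target U) := by
  have hlam := refreshRate_pos hU.pos hU.lt h0 h1
  have hab := sq_coefB_lt_coefA hU.pos hU.lt h0 h1
  refine le_mul_of_forall_approx
    (mul_pos (flipConst_pos hab) (Real.exp_pos _)).le fun ε hε => ?_
  obtain ⟨ℓ, g, hℓ, hg, hfg⟩ := hU.exists_isTestFunction hab hf hf0 hε
  obtain ⟨B, hB⟩ := hg.bounded
  have hgL := hU.memLp_of_abs_le hg.measurable hB
  refine ⟨∫ z, g z ^ 2 ∂(target U),
    ∫ z, semigroup U α (refreshRate m M α) t g z ^ 2 ∂(target U), ?_, ?_,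
    hU.integral_sq_semigroup_le_of_isTestFunction h0 h1 ht hℓ hg⟩
  · refine (integral_sq_le_add hgL hf hε).trans ?_
    simp_rw [sub_sq_comm (g _)]
    gcongr
  · refine (integral_sq_le_add (hU.memLp_semigroup h0 h1 hlam ht hf)
      (hU.memLp_semigroup h0 h1 hlam ht hgL) hε).trans ?_
    have hsub := hU.semigroup_sub h0 h1 hlam ht hf hgL
    have hle := hU.integral_sq_semigroup_le h0 h1 hlam ht (hf.sub hgL)
    gcongr
    refine le_trans (le_of_eq ?_) (hle.trans hfg)
    refine integral_congr_ae ?_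
    filter_upwards [hsub] with z hz
    rw [← hz]
    rfl

end StrictHessianBounds

end density

end RHMC

theorem mainTheorem3 (m M α : ℝ) (hm : 0 < m) (hmM : m < M) (hα₀ : 0 ≤ α) (hα₁ : α < 1) :
    ∃ a b c : ℝ, (!![a, b; b, c] : Matrix (Fin 2) (Fin 2) ℝ).PosDef ∧
      ∀ (d : ℕ), 1 ≤ d → ∀ U : RHMC.Pos d → ℝ, RHMC.HessianBounds m M U →
        (RHMC.InCoupledDomain U α (RHMC.refreshRate m M α) (RHMC.distSq a b c) ∧
          ∀ w : RHMC.Phase d × RHMC.Phase d,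
            RHMC.coupledGenerator U α (RHMC.refreshRate m M α) (RHMC.distSq a b c) w
              ≤ -RHMC.contractionRate m M α * RHMC.distSq a b c w) ∧
        ∀ f : RHMC.Phase d → ℝ, MemLp f 2 (RHMC.target U) → ∫ z, f z ∂(RHMC.target U) = 0 →
          ∀ t : ℝ, 0 ≤ t →
            (∀ᵐ z ∂(RHMC.target U), Integrable (fun ω => f (RHMC.path U α ω z t))
              (RHMC.noiseLaw d (RHMC.refreshRate m M α))) ∧
            MemLp (RHMC.semigroup U α (RHMC.refreshRate m M α) t f) 2 (RHMC.target U) ∧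
            ∫ z, (RHMC.semigroup U α (RHMC.refreshRate m M α) t f z) ^ 2 ∂(RHMC.target U)
              ≤ min ((a * c + b ^ 2 + 2 * Real.sqrt (a * c * b ^ 2)) / (a * c - b ^ 2)
                    * Real.exp (-RHMC.contractionRate m M α * t)) 1
                * ∫ z, (f z) ^ 2 ∂(RHMC.target U) := by
  have hab := RHMC.sq_coefB_lt_coefA hm hmM hα₀ hα₁
  have hlam := RHMC.refreshRate_pos hm hmM hα₀ hα₁
  refine ⟨RHMC.coefA m M α, RHMC.coefB m M, 1, ?_, fun d _ U hU => ?_⟩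
  · refine Matrix.PosDef.of_dotProduct_mulVec_pos ?_ fun x hx => ?_
    · ext i j
      fin_cases i <;> fin_cases j <;> simp
    · have e : star x ⬝ᵥ (!![RHMC.coefA m M α, RHMC.coefB m M; RHMC.coefB m M, 1] :
          Matrix (Fin 2) (Fin 2) ℝ).mulVec x = (RHMC.coefA m M α - RHMC.coefB m M ^ 2) * x 0 ^ 2
          + (x 1 + RHMC.coefB m M * x 0) ^ 2 := by
        simp [dotProduct, Matrix.mulVec, Fin.sum_univ_two]
        ring
      rw [e]
      have hpos := sub_pos.2 hab
      by_cases h0 : x 0 = 0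
      · have h1 : x 1 ≠ 0 := fun h1 => hx (by ext i; fin_cases i <;> simp [h0, h1])
        rw [h0]
        simp only [mul_zero, add_zero]
        positivity
      · positivity
  have hS : RHMC.StrictHessianBounds m M U := { hU with pos := hm, lt := hmM }
  refine ⟨⟨hS.inCoupledDomain hα₀ hα₁, hS.coupledGenerator_le hα₀ hα₁⟩, fun f hf hf0 t ht => ?_⟩
  refine ⟨hS.ae_integrable_path hα₀ hα₁ hlam ht hf, hS.memLp_semigroup hα₀ hα₁ hlam ht hf, ?_⟩
  rcases min_choice ((RHMC.coefA m M α * 1 + RHMC.coefB m M ^ 2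
    + 2 * Real.sqrt (RHMC.coefA m M α * 1 * RHMC.coefB m M ^ 2))
    / (RHMC.coefA m M α * 1 - RHMC.coefB m M ^ 2)
    * Real.exp (-RHMC.contractionRate m M α * t)) 1 with h | h <;> rw [h]
  · exact hS.integral_sq_semigroup_le_mul hα₀ hα₁ ht hf hf0
  · rw [one_mul]
    exact hS.integral_sq_semigroup_le hα₀ hα₁ hlam ht hf
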